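/- Let $N\ge 2$ and $p_1,\dots,p_N\ge 2$. There is a constant $C>0$, depending only on $N$ and $p_1,\dots,p_N$, with the following property. Let $\Omega\subset\mathbb R^N$ be a bounded domain, $T>0$, $\Omega_T=\Omega\times(0,T]$, and let the obstacle $\phi:\Omega_T\to\mathbb R$ be continuous and bounded above. Let $K_\phi$ be the set of all $v\in C([0,T];L^2(\Omega))$ such that $v\in L^{p_i}(\Omega_T)$ and the weak derivative $\partial v/\partial x_i$ lies in $L^{p_i}(\Omega_T)$ for $i=1,\dots,N$, and $v\ge\phi$ a.e. in $\Omega_T$. Let $u\in K_\phi$ be a local weak solution of the obstacle problem for $u_t-\sum_{i=1}^N\frac{\partial}{\partial x_i}\big(|\frac{\partial u}{\partial x_i}|^{p_i-2}\frac{\partial u}{\partial x_i}\big)=0$, that is, $$\int_{\Omega_T}\Big\{\eta_t\big[\tfrac12u^2-uv\big]-\eta\,u\,v_t\Big\}\,dx\,dt+\sum_{i=1}^N\int_{\Omega_T}\Big|\frac{\partial u}{\partial x_i}\Big|^{p_i-2}\frac{\partial u}{\partial x_i}\,\frac{\partial}{\partial x_i}\big(\eta(v-u)\big)\,dx\,dt\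 \ge 0$$ for all $v\in K_\phi$ with weak derivative $v_t\in L^2(\Omega_T)$ and all nonnegative $\eta\in C_0^\infty(\Omega\times(0,T))$. Let $0<\rho_2<\rho_1$, let $B_{\rho_2}\subset B_{\rho_1}$ be concentric open Euclidean balls of these radii with $B_{\rho_1}\subset\Omega$, let $0<t_1<t_2<T$ and $Q_1=B_{\rho_1}\times(t_1,t_2)$. For $k\in\mathbb R$ write $(u-k)_+=\max\{u-k,0\}$, $(u-k)_-=\max\{k-u,0\}$ and $H_k^\pm=\operatorname{ess\,sup}_{Q_1}(u-k)_\pm$; for $H_k^\pm<\infty$ and $0<c<H_k^\pm$ put $$\Gamma_\pm=\left[\ln\frac{H_k^\pm}{H_k^\pm-s+c}\right]_+\quad\text{evaluated at } s=(u-k)_\pm,$$ and let $\Gamma_\pm'$ be the derivative of this expression in $s$, evaluated at $s=(u-k)_\pm$; the product $\Gamma_\pm(\Gamma_\pm')^{2-p_i}$ is read as $0$ where $\Gamma_\pm=0$. Then: 1. for every $k\in\mathbb R$ with $k\ge\sup_{Q_1}\phi$ and $H_k^+<\infty$, and every $0<c<H_k^+$, $$\operatorname*{ess\,sup}_{t\in(t_1,t_2)}\int_{B_{\rho_2}\times\{t\}}\Gamma_+^2\,dx\le\int_{B_{\rho_1}\times\{t_1\}}\Gamma_+^2\,dx+C\sum_{i=1}^N\frac1{(\rho_1-\rho_2)^{p_i}}\int_{Q_1}\Gamma_+(\Gamma_+')^{2-p_i}\,dx\,dt;$$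 2. for every $k>0$ with $H_k^-<\infty$, and every $0<c<H_k^-$, $$\operatorname*{ess\,sup}_{t\in(t_1,t_2)}\int_{B_{\rho_2}\times\{t\}}\Gamma_-^2\,dx\le\int_{B_{\rho_1}\times\{t_1\}}\Gamma_-^2\,dx+C\sum_{i=1}^N\frac1{(\rho_1-\rho_2)^{p_i}}\int_{Q_1}\Gamma_-(\Gamma_-')^{2-p_i}\,dx\,dt.$$ -/

import Mathlib

open MeasureTheory Set Filter Topology
open scoped ENNReal ContDiff

noncomputable section

namespace AnisoObstacle

/-- Points `(x, t)` with `x ∈ ℝᴺ` (Euclidean norm) and `t ∈ ℝ`; `volume` is Lebesgue measure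
`dx dt`. -/
abbrev SpaceTime (N : ℕ) : Type := EuclideanSpace ℝ (Fin N) × ℝ

/-- The direction of `∂/∂xᵢ` in space-time. -/
def dirX {N : ℕ} (i : Fin N) : SpaceTime N := (EuclideanSpace.single i (1 : ℝ), 0)

/-- The direction of `∂/∂t` in space-time. -/
def dirT (N : ℕ) : SpaceTime N := (0, 1)

/-- `Ω_T = Ω × (0, T]`. -/
def spaceTimeDomain {N : ℕ} (Ω : Set (EuclideanSpace ℝ (Fin N))) (T : ℝ) : Set (SpaceTime N) :=
  Ω ×ˢ Ioc 0 T

/-- `B_ρ(x₀) × (t₁, t₂)`. -/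
def cylinder {N : ℕ} (x₀ : EuclideanSpace ℝ (Fin N)) (ρ t₁ t₂ : ℝ) : Set (SpaceTime N) :=
  Metric.ball x₀ ρ ×ˢ Ioo t₁ t₂

/-- Smooth real functions with compact support contained in the open set `U`. -/
structure IsTestFunction {N : ℕ} (U : Set (SpaceTime N)) (η : SpaceTime N → ℝ) : Prop where
  smooth : ContDiff ℝ ∞ η
  compact : HasCompactSupport η
  support : tsupport η ⊆ U

/-- `g` is the weak (distributional) derivative of `f` in the constant direction `d` on the open
space-time set `U`. -/
structure HasWeakDeriv {N : ℕ} (U : Set (SpaceTime N)) (d : SpaceTime N)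
    (f g : SpaceTime N → ℝ) : Prop where
  locInt : LocallyIntegrableOn f U volume
  locInt_deriv : LocallyIntegrableOn g U volume
  eq : ∀ η : SpaceTime N → ℝ, IsTestFunction U η →
    ∫ z in U, f z * fderiv ℝ η z d = -∫ z in U, g z * η z

/-- `u ∈ C([0, T]; L²(Ω))`: `u (·, t)` is the value at time `t`. -/
structure ContL2 {N : ℕ} (Ω : Set (EuclideanSpace ℝ (Fin N))) (T : ℝ)
    (u : SpaceTime N → ℝ) : Prop where
  memLp : ∀ t ∈ Icc 0 T, MemLp (fun x => u (x, t)) 2 (volume.restrict Ω)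
  cont : ∀ t₀ ∈ Icc 0 T,
    Tendsto (fun t => eLpNorm (fun x => u (x, t) - u (x, t₀)) 2 (volume.restrict Ω))
      (𝓝[Icc 0 T] t₀) (𝓝 0)

/-- `Du = (∂u/∂x₁, …, ∂u/∂x_N)` weakly in `Ω × (0, T)`, with `∂u/∂xᵢ ∈ L^{pᵢ}(Ω_T)`. -/
def IsWeakGrad {N : ℕ} (Ω : Set (EuclideanSpace ℝ (Fin N))) (T : ℝ) (p : Fin N → ℝ)
    (u : SpaceTime N → ℝ) (Du : Fin N → SpaceTime N → ℝ) : Prop :=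
  ∀ i, MemLp (Du i) (ENNReal.ofReal (p i)) (volume.restrict (spaceTimeDomain Ω T)) ∧
    HasWeakDeriv (Ω ×ˢ Ioo 0 T) (dirX i) u (Du i)

/-- `ut = ∂u/∂t` weakly in `Ω × (0, T)`, with `∂u/∂t ∈ L²(Ω_T)`. -/
def IsWeakTimeDeriv {N : ℕ} (Ω : Set (EuclideanSpace ℝ (Fin N))) (T : ℝ)
    (u ut : SpaceTime N → ℝ) : Prop :=
  MemLp ut 2 (volume.restrict (spaceTimeDomain Ω T)) ∧
    HasWeakDeriv (Ω ×ˢ Ioo 0 T) (dirT N) u ut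

/-- The class `K_φ`: functions in `C([0, T]; L²(Ω)) ∩ ⋂ᵢ L^{pᵢ}(0, T; W^{1,pᵢ}(Ω))` that lie above
the obstacle `φ` a.e. in `Ω_T`. Here `W^{1,pᵢ}(Ω)` is the space of `w ∈ L^{pᵢ}(Ω)` with
`∂w/∂xᵢ ∈ L^{pᵢ}(Ω)`, for the one index `i`. -/
structure MemK {N : ℕ} (Ω : Set (EuclideanSpace ℝ (Fin N))) (T : ℝ) (p : Fin N → ℝ)
    (φ u : SpaceTime N → ℝ) : Prop where
  contL2 : ContL2 Ω T u
  memLp : ∀ i, MemLp u (ENNReal.ofReal (p i)) (volume.restrict (spaceTimeDomain Ω T))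
  weakGrad : ∃ Du, IsWeakGrad Ω T p u Du
  obstacle : ∀ᵐ z ∂(volume.restrict (spaceTimeDomain Ω T)), φ z ≤ u z

/-- The time term `⟨⟨u_t, η (v - u)⟩⟩ = ∫_{Ω_T} { η_t (u²/2 - u v) - η u v_t } dx dt`. -/
def timeTerm {N : ℕ} (Ω : Set (EuclideanSpace ℝ (Fin N))) (T : ℝ)
    (u v vt η : SpaceTime N → ℝ) : ℝ :=
  ∫ z in spaceTimeDomain Ω T,
    (fderiv ℝ η z (dirT N) * (1 / 2 * u z ^ 2 - u z * v z) - η z * u z * vt z)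

/-- The diffusion term
`∑ᵢ ∫_{Ω_T} |∂u/∂xᵢ|^{pᵢ-2} (∂u/∂xᵢ) ∂/∂xᵢ (η (v - u)) dx dt`, the last derivative being written
out by the product rule. -/
def diffusionTerm {N : ℕ} (Ω : Set (EuclideanSpace ℝ (Fin N))) (T : ℝ) (p : Fin N → ℝ)
    (u : SpaceTime N → ℝ) (Du : Fin N → SpaceTime N → ℝ)
    (v : SpaceTime N → ℝ) (Dv : Fin N → SpaceTime N → ℝ) (η : SpaceTime N → ℝ) : ℝ :=
  ∑ i, ∫ z in spaceTimeDomain Ω T,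
    |Du i z| ^ (p i - 2) * Du i z *
      (fderiv ℝ η z (dirX i) * (v z - u z) + η z * (Dv i z - Du i z))

/-- `u` is a local weak solution of the obstacle problem for
`u_t - ∑ᵢ ∂/∂xᵢ (|∂u/∂xᵢ|^{pᵢ-2} ∂u/∂xᵢ) = 0` with obstacle `φ`. The comparison functions `v` range
over the `v ∈ K_φ` with `v_t ∈ L²(Ω_T)`. (Weak derivatives are unique a.e., so quantifying over
`Du`, `Dv`, `vt` only names the derivatives.) -/
structure IsLocalWeakSolution {N : ℕ} (Ω : Set (EuclideanSpace ℝ (Fin N))) (T : ℝ)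
    (p : Fin N → ℝ) (φ u : SpaceTime N → ℝ) : Prop where
  memK : MemK Ω T p φ u
  ineq : ∀ Du, IsWeakGrad Ω T p u Du →
    ∀ v, MemK Ω T p φ v →
    ∀ Dv, IsWeakGrad Ω T p v Dv →
    ∀ vt, IsWeakTimeDeriv Ω T v vt →
    ∀ η, IsTestFunction (Ω ×ˢ Ioo 0 T) η → (∀ z, 0 ≤ η z) →
      0 ≤ timeTerm Ω T u v vt η + diffusionTerm Ω T p u Du v Dv η

/-- `(u - k)₊`. -/
def truncPos {N : ℕ} (u : SpaceTime N → ℝ) (k : ℝ) : SpaceTime N → ℝ := fun z => max (u z - k) 0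

/-- `(u - k)₋`. -/
def truncNeg {N : ℕ} (u : SpaceTime N → ℝ) (k : ℝ) : SpaceTime N → ℝ := fun z => max (k - u z) 0

/-- `ess sup_Q |w|`, as an extended nonnegative number. -/
def height {N : ℕ} (Q : Set (SpaceTime N)) (w : SpaceTime N → ℝ) : ℝ≥0∞ :=
  essSup (fun z => ENNReal.ofReal |w z|) (volume.restrict Q)

/-- `Γ(H, s, c) = [ln (H / (H - s + c))]₊`. -/
def logGamma (H c s : ℝ) : ℝ := max (Real.log (H / (H - s + c))) 0

/-- `z ↦ Γ(H, w(z), c)` with `H = ess sup_Q |w|` (used when this is finite). -/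
def Gam {N : ℕ} (Q : Set (SpaceTime N)) (w : SpaceTime N → ℝ) (c : ℝ) : SpaceTime N → ℝ :=
  fun z => logGamma (height Q w).toReal c (w z)

/-- `z ↦ Γ'(H, w(z), c)` with `H = ess sup_Q |w|`; the prime is the derivative in the variable `s`
of `Γ(H, s, c)`. -/
def Gam' {N : ℕ} (Q : Set (SpaceTime N)) (w : SpaceTime N → ℝ) (c : ℝ) : SpaceTime N → ℝ :=
  fun z => deriv (logGamma (height Q w).toReal c) (w z)

end AnisoObstacle

end

set_option linter.unusedSectionVars false

namespace AnisoObstacle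

/-! ### Averages of translates and their convergence in `L^r` -/

section Averaging

/-! Formally one compares `u` with `v = u - λ G(u)`, where `G(r) = σ F(σ (r - k))`, `F = (Γ²)'`, and
`σ = 1` or `σ = -1` selects the positive or the negative truncation. If `λ F' ≤ 1`, then `r ↦ r - λ
G(r)` is nondecreasing. Since moreover `G ≤ 0` at all levels the obstacle can reach in the cylinder,
it follows that `v ≥ min(u, k') ≥ φ` for an upper bound `k'` of `φ` there. For `σ = 1` this uses `k
≥ sup φ` and the vanishing of `F` on `(-∞, c]`; for `σ = -1` the perturbation only raises `u`, so no
relation between `k` and `φ` is needed. Dividing by `λ` gives `energy_inequality`, whose right side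
is `∫ η_t Ψ` with `Ψ` a primitive of `G`.

Take `η = ζ(x)^q θ(t)` and write `a = H - s + c`, so that `Γ' = 1/a` where `Γ > 0`, `(Γ²)' = 2Γ/a`
and `(Γ²)'' = 2(1 + Γ)/a²`. The inequalities `F ≤ 2Γ/a` and `F ≤ F' a` let the cut-off term be
absorbed into the gradient term, at the cost of a multiple of `Γ a^(p-2) = Γ (Γ')^(2-p)`; this is
`neg_le_flux_mul_of_profile`. Letting `θ` approach the indicator of a time interval turns the result
into a bound on the growth of `∫ ζ^q Ψ` (`le_add_of_forall_testFunction`, `profile_evolution`).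

Two regularizations make this rigorous. First, `u` has no time derivative, so in `v` it is replaced
by an exponential average over the past, `f`, of a mollification `m` of the localized `u`. Then `f_t
= (m - f)/h`, so `(m - f) f_t ≥ 0`, and the only time error of the wrong sign is controlled by `|m -
u| |f_t|`. It vanishes if the mollification is made fine enough relative to `h`
(`exists_approximation`, `time_term_le`). Adding a small `ε` to `v` restores the obstacle condition.
Second, `(Γ²)''` jumps at `s = c` and `Γ` is singular beyond `H`, so `exists_log_profile` supplies a
bounded `C¹` substitute for `F` whose primitive is within `ε` of `Γ²` up to height `H`. Finally,
`ContL2.ae_slice_le` carries the bound by `H` to each time slice, including the initial one. -/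

theorem enorm_integral_rpow_le {α : Type*} [MeasurableSpace α] {ν : Measure α}
    [IsProbabilityMeasure ν] {r : ℝ} (hr : 1 ≤ r) {g : α → ℝ} (hg : AEStronglyMeasurable g ν) :
    ‖∫ a, g a ∂ν‖ₑ ^ r ≤ ∫⁻ a, ‖g a‖ₑ ^ r ∂ν := by
  have hr0 : 0 < r := by linarith
  have h1 : ‖∫ a, g a ∂ν‖ₑ ≤ eLpNorm g 1 ν := by
    rw [eLpNorm_one_eq_lintegral_enorm]
    exact enorm_integral_le_lintegral_enorm g
  have h2 : eLpNorm g 1 ν ≤ eLpNorm g (ENNReal.ofReal r) ν :=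
    eLpNorm_le_eLpNorm_of_exponent_le (by simpa using hr) hg
  have h3 := ENNReal.rpow_le_rpow (h1.trans h2) hr0.le
  rw [eLpNorm_eq_lintegral_rpow_enorm_toReal (by simpa using hr0) ENNReal.ofReal_ne_top,
    ENNReal.toReal_ofReal hr0.le, ← ENNReal.rpow_mul, one_div_mul_cancel hr0.ne',
    ENNReal.rpow_one] at h3
  exact h3

variable {E : Type*} [NormedAddCommGroup E] [NormedSpace ℝ E] [FiniteDimensional ℝ E]
  [MeasurableSpace E] [BorelSpace E] {μ : Measure E} [μ.IsAddHaarMeasure]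

theorem measurePreserving_sub_const (y : E) : MeasurePreserving (fun z : E => z - y) μ μ :=
  measurePreserving_sub_right μ y

/-- The `L^r` modulus of continuity of translations of `u`, to the power `r`. -/
noncomputable def translationModulus (μ : Measure E) (u : E → ℝ) (r : ℝ) (y : E) : ℝ≥0∞ :=
  ∫⁻ z, ‖u (z - y) - u z‖ₑ ^ r ∂μ

theorem eLpNorm_ofReal_rpow {α : Type*} [MeasurableSpace α] {ν : Measure α} {r : ℝ} (hr : 0 < r)
    (g : α → ℝ) : eLpNorm g (ENNReal.ofReal r) ν ^ r = ∫⁻ a, ‖g a‖ₑ ^ r ∂ν := by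
  rw [eLpNorm_eq_lintegral_rpow_enorm_toReal (by simpa using hr) ENNReal.ofReal_ne_top,
    ENNReal.toReal_ofReal hr.le, ← ENNReal.rpow_mul, one_div_mul_cancel hr.ne', ENNReal.rpow_one]

theorem translationModulus_eq_rpow (u : E → ℝ) {r : ℝ} (hr : 0 < r) (y : E) :
    translationModulus μ u r y =
      eLpNorm (fun z => u (z - y) - u z) (ENNReal.ofReal r) μ ^ r := by
  rw [eLpNorm_ofReal_rpow hr, translationModulus]

/-- Translations depend continuously on the shift in the compact-open topology and preserve the
measure, so composition with them is continuous in `L^r` for finite `r`. -/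
theorem continuous_translationModulus {u : E → ℝ} {r : ℝ} (hr : 1 ≤ r)
    (hu : MemLp u (ENNReal.ofReal r) μ) : Continuous (translationModulus μ u r) := by
  have : Fact (1 ≤ ENNReal.ofReal r) := ⟨by simpa using hr⟩
  let g : E → C(E, E) := fun y => ⟨fun z => z - y, by fun_prop⟩
  have hg : Continuous g :=
    ContinuousMap.continuous_of_continuous_uncurry _ (by
      change Continuous (fun q : E × E => q.2 - q.1); fun_prop)
  have hgm : ∀ y, MeasurePreserving (g y) μ μ := fun y => measurePreserving_sub_const y
  have h1 := (continuous_const (y := hu.toLp u)).compMeasurePreservingLp hg hgm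
    ENNReal.ofReal_ne_top
  have h2 : Continuous fun y => ‖(Lp.compMeasurePreserving (g y) (hgm y)) (hu.toLp u) -
      hu.toLp u‖ₑ ^ r :=
    (ENNReal.continuous_rpow_const).comp (continuous_enorm.comp (h1.sub continuous_const))
  convert h2 using 2 with y
  rw [translationModulus_eq_rpow u (by linarith), Lp.toLp_compMeasurePreserving, ← MemLp.toLp_sub,
    Lp.enorm_toLp]
  rfl

theorem translationModulus_zero (u : E → ℝ) {r : ℝ} (hr : 0 < r) :
    translationModulus μ u r 0 = 0 := by
  simp [translationModulus, hr]

theorem translationModulus_le {u : E → ℝ} {r : ℝ} (hr : 1 ≤ r)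
    (hu : MemLp u (ENNReal.ofReal r) μ) (y : E) :
    translationModulus μ u r y ≤ (2 * eLpNorm u (ENNReal.ofReal r) μ) ^ r := by
  rw [translationModulus_eq_rpow u (by linarith)]
  gcongr
  have hm : MemLp (fun z => u (z - y)) (ENNReal.ofReal r) μ :=
    hu.comp_measurePreserving (measurePreserving_sub_const y)
  refine (eLpNorm_sub_le hm.1 hu.1 (by simpa using hr)).trans ?_
  rw [two_mul]
  gcongr
  exact (eLpNorm_comp_measurePreserving hu.1 (measurePreserving_sub_const y)).le

/-- Averages of the modulus of continuity over shrinking dilations. -/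
theorem tendsto_lintegral_translationModulus {α : Type*} [MeasurableSpace α] {ν : Measure α}
    [IsProbabilityMeasure ν] {u : E → ℝ} {r : ℝ} (hr : 1 ≤ r)
    (hu : MemLp u (ENNReal.ofReal r) μ) {Y : ℕ → α → E} (hY : ∀ n, Measurable (Y n))
    (hlim : ∀ a, Tendsto (fun n => Y n a) atTop (𝓝 0)) :
    Tendsto (fun n => ∫⁻ a, translationModulus μ u r (Y n a) ∂ν) atTop (𝓝 0) := by
  have hc := continuous_translationModulus hr hu
  have := tendsto_lintegral_filter_of_dominated_convergence (μ := ν) (l := atTop)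
    (F := fun n a => translationModulus μ u r (Y n a)) (f := fun _ => 0)
    (fun _ => (2 * eLpNorm u (ENNReal.ofReal r) μ) ^ r)
    (Eventually.of_forall fun n => hc.measurable.comp (hY n))
    (Eventually.of_forall fun n => Eventually.of_forall fun a => translationModulus_le hr hu _)
    (by
      rw [lintegral_const, measure_univ, mul_one]
      exact ENNReal.rpow_ne_top_of_nonneg (by linarith)
        (ENNReal.mul_ne_top (by simp) hu.2.ne))
    (Eventually.of_forall fun a => by
      have := (hc.tendsto 0).comp (hlim a)
      rwa [translationModulus_zero u (by linarith)] at this)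
  simpa using this

/-- Jensen's inequality for the probability measure `ν`, followed by Tonelli. -/
theorem lintegral_enorm_average_sub_le {α : Type*} [MeasurableSpace α] {ν : Measure α}
    [IsProbabilityMeasure ν] {u : E → ℝ} {r : ℝ} (hr : 1 ≤ r)
    {Y : α → E} (hY : Measurable Y) (hu : StronglyMeasurable u)
    (hint : ∀ z, Integrable (fun a => u (z - Y a)) ν) :
    ∫⁻ z, ‖(∫ a, u (z - Y a) ∂ν) - u z‖ₑ ^ r ∂μ ≤
      ∫⁻ a, translationModulus μ u r (Y a) ∂ν := by
  have hm : Measurable (fun q : E × α => u (q.1 - Y q.2) - u q.1) := by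
    have := hu.measurable
    fun_prop
  calc ∫⁻ z, ‖(∫ a, u (z - Y a) ∂ν) - u z‖ₑ ^ r ∂μ
      ≤ ∫⁻ z, ∫⁻ a, ‖u (z - Y a) - u z‖ₑ ^ r ∂ν ∂μ := by
        refine lintegral_mono fun z => ?_
        have : (∫ a, u (z - Y a) ∂ν) - u z = ∫ a, (u (z - Y a) - u z) ∂ν := by
          rw [integral_sub (hint z) (integrable_const _)]; simp
        rw [this]
        exact enorm_integral_rpow_le hr ((hint z).1.sub aestronglyMeasurable_const)
    _ = ∫⁻ a, ∫⁻ z, ‖u (z - Y a) - u z‖ₑ ^ r ∂μ ∂ν := by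
        refine lintegral_lintegral_swap (f := fun z a => ‖u (z - Y a) - u z‖ₑ ^ r) ?_
        exact (hm.enorm.pow_const r).aemeasurable

end Averaging

end AnisoObstacle

namespace AnisoObstacle

/-! ### Mollification as an average over a bump measure -/

section Averaging

variable {E : Type*} [NormedAddCommGroup E] [NormedSpace ℝ E] [FiniteDimensional ℝ E]
  [MeasurableSpace E] [BorelSpace E] {μ : Measure E} [μ.IsAddHaarMeasure]

/-- Here the measure itself varies with `n`, so the smallness of the modulus near the origin
replaces dominated convergence. -/
theorem tendsto_lintegral_translationModulus_of_support {u : E → ℝ} {r : ℝ} (hr : 1 ≤ r)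
    (hu : MemLp u (ENNReal.ofReal r) μ) {ν : ℕ → Measure E} [∀ n, IsProbabilityMeasure (ν n)]
    {δ : ℕ → ℝ} (hδ : Tendsto δ atTop (𝓝 0)) (hν : ∀ n, ∀ᵐ y ∂(ν n), ‖y‖ ≤ δ n) :
    Tendsto (fun n => ∫⁻ a, translationModulus μ u r a ∂(ν n)) atTop (𝓝 0) := by
  have hc := (continuous_translationModulus hr hu).tendsto 0
  rw [translationModulus_zero u (by linarith)] at hc
  rw [ENNReal.tendsto_nhds_zero] at hc ⊢
  intro ε hε
  obtain ⟨d, hd, hball⟩ := Metric.eventually_nhds_iff.1 (hc ε hε)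
  filter_upwards [hδ.eventually_lt_const hd] with n hn
  calc ∫⁻ a, translationModulus μ u r a ∂(ν n) ≤ ∫⁻ _, ε ∂(ν n) := by
        refine lintegral_mono_ae ?_
        filter_upwards [hν n] with y hy
        exact hball (by simpa using hy.trans_lt hn)
    _ = ε := by simp

/-- Insert `u (z - Y a)` between the two terms. By translation invariance the average of `m` is no
further from the average of `u` than `m` is from `u`, so two successive averagings can be combined.
-/
theorem lintegral_enorm_average_sub_le_of_approx {α : Type*} [MeasurableSpace α] {ν : Measure α}
    [IsProbabilityMeasure ν] {u m : E → ℝ} {r : ℝ} (hr : 1 ≤ r)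
    {Y : α → E} (hY : Measurable Y) (hu : StronglyMeasurable u) (hm : StronglyMeasurable m)
    (hint : ∀ z, Integrable (fun a => m (z - Y a)) ν) :
    ∫⁻ z, ‖(∫ a, m (z - Y a) ∂ν) - u z‖ₑ ^ r ∂μ ≤
      2 ^ (r - 1) * ((∫⁻ z, ‖m z - u z‖ₑ ^ r ∂μ) + ∫⁻ a, translationModulus μ u r (Y a) ∂ν) := by
  have h1 : Measurable (fun q : E × α => m (q.1 - Y q.2) - u (q.1 - Y q.2)) := by
    have := hu.measurable
    have := hm.measurable
    fun_prop
  have h2 : Measurable (fun q : E × α => u (q.1 - Y q.2) - u q.1) := by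
    have := hu.measurable
    fun_prop
  have h3 : Measurable (fun q : E × α => ‖u (q.1 - Y q.2) - u q.1‖ₑ ^ r) := h2.enorm.pow_const r
  have h4 : Measurable (fun q : E × α => ‖m (q.1 - Y q.2) - u (q.1 - Y q.2)‖ₑ ^ r) :=
    h1.enorm.pow_const r
  calc ∫⁻ z, ‖(∫ a, m (z - Y a) ∂ν) - u z‖ₑ ^ r ∂μ
      ≤ ∫⁻ z, ∫⁻ a, 2 ^ (r - 1) * (‖m (z - Y a) - u (z - Y a)‖ₑ ^ r
          + ‖u (z - Y a) - u z‖ₑ ^ r) ∂ν ∂μ := by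
        refine lintegral_mono fun z => ?_
        have : (∫ a, m (z - Y a) ∂ν) - u z = ∫ a, (m (z - Y a) - u z) ∂ν := by
          rw [integral_sub (hint z) (integrable_const _)]; simp
        rw [this]
        refine (enorm_integral_rpow_le hr
          ((hint z).1.sub aestronglyMeasurable_const)).trans ?_
        refine lintegral_mono fun a => ?_
        refine le_trans ?_ (ENNReal.rpow_add_le_mul_rpow_add_rpow _ _ hr)
        gcongr
        refine le_trans (le_of_eq ?_) (enorm_add_le _ _)
        simp
    _ = 2 ^ (r - 1) * ∫⁻ a, ∫⁻ z, (‖m (z - Y a) - u (z - Y a)‖ₑ ^ r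
          + ‖u (z - Y a) - u z‖ₑ ^ r) ∂μ ∂ν := by
        rw [lintegral_lintegral_swap, ← lintegral_const_mul]
        · refine lintegral_congr fun a => ?_
          exact lintegral_const_mul _ ((h4.comp measurable_prodMk_right).add
            (h3.comp measurable_prodMk_right))
        · exact (h4.add h3).lintegral_prod_left'
        · exact ((h4.add h3).const_mul _).aemeasurable
    _ = 2 ^ (r - 1) * ((∫⁻ z, ‖m z - u z‖ₑ ^ r ∂μ) +
          ∫⁻ a, translationModulus μ u r (Y a) ∂ν) := by
        congr 1
        have : ∀ a, ∫⁻ z, (‖m (z - Y a) - u (z - Y a)‖ₑ ^ r + ‖u (z - Y a) - u z‖ₑ ^ r) ∂μ =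
            (∫⁻ z, ‖m z - u z‖ₑ ^ r ∂μ) + translationModulus μ u r (Y a) := by
          intro a
          rw [lintegral_add_left (f := fun z => ‖m (z - Y a) - u (z - Y a)‖ₑ ^ r)
            (h4.comp measurable_prodMk_right)]
          congr 1
          exact lintegral_sub_right_eq_self (fun z => ‖m z - u z‖ₑ ^ r) (Y a)
        simp_rw [this]
        rw [lintegral_add_left measurable_const]
        simp

/-- Convolution with a normalized smooth bump. -/
noncomputable def mollify (μ : Measure E) (ρ : ContDiffBump (0 : E)) (u : E → ℝ) : E → ℝ :=
  convolution u (ρ.normed μ) (ContinuousLinearMap.mul ℝ ℝ) μ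

theorem mollify_apply (ρ : ContDiffBump (0 : E)) (u : E → ℝ) (z : E) :
    mollify μ ρ u z = ∫ y, u y * ρ.normed μ (z - y) ∂μ := rfl

/-- The probability measure with density a normalized bump. -/
noncomputable def bumpMeasure (μ : Measure E) (ρ : ContDiffBump (0 : E)) : Measure E :=
  μ.withDensity fun y => ENNReal.ofReal (ρ.normed μ y)

instance (ρ : ContDiffBump (0 : E)) : IsProbabilityMeasure (bumpMeasure μ ρ) := by
  constructor
  rw [bumpMeasure, withDensity_apply _ MeasurableSet.univ, Measure.restrict_univ,
    ← ofReal_integral_eq_lintegral_ofReal ρ.integrable_normed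
      (Eventually.of_forall fun y => ρ.nonneg_normed y), ρ.integral_normed, ENNReal.ofReal_one]

theorem ae_bumpMeasure_norm_le (ρ : ContDiffBump (0 : E)) :
    ∀ᵐ y ∂(bumpMeasure μ ρ), ‖y‖ ≤ ρ.rOut := by
  rw [bumpMeasure, ae_withDensity_iff (by
    exact (ρ.continuous_normed.measurable).ennreal_ofReal)]
  refine Eventually.of_forall fun y hy => ?_
  have : y ∈ Function.support (ρ.normed μ) := by
    intro h; simp [h] at hy
  rw [ρ.support_normed_eq] at this
  exact (mem_ball_zero_iff.1 this).le

theorem integral_bumpMeasure (ρ : ContDiffBump (0 : E)) (g : E → ℝ) :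
    ∫ y, g y ∂(bumpMeasure μ ρ) = ∫ y, g y * ρ.normed μ y ∂μ := by
  rw [bumpMeasure, integral_withDensity_eq_integral_toReal_smul
    ((ρ.continuous_normed.measurable).ennreal_ofReal) (Eventually.of_forall fun _ => by simp)]
  refine integral_congr_ae (Eventually.of_forall fun y => ?_)
  simp [ENNReal.toReal_ofReal (ρ.nonneg_normed y), mul_comm]

theorem integrable_bumpMeasure {ρ : ContDiffBump (0 : E)} {g : E → ℝ}
    (hg : LocallyIntegrable g μ) : Integrable g (bumpMeasure μ ρ) := by
  rw [bumpMeasure, integrable_withDensity_iff_integrable_smul₀'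
    ((ρ.continuous_normed.measurable).ennreal_ofReal).aemeasurable
    (Eventually.of_forall fun _ => by simp)]
  have h := hg.integrable_smul_left_of_hasCompactSupport (ρ.continuous_normed (μ := μ))
    ρ.hasCompactSupport_normed
  refine h.congr (Eventually.of_forall fun y => ?_)
  simp [ENNReal.toReal_ofReal (ρ.nonneg_normed y)]

theorem mollify_eq_integral (ρ : ContDiffBump (0 : E)) (u : E → ℝ) (z : E) :
    mollify μ ρ u z = ∫ y, u (z - y) ∂(bumpMeasure μ ρ) := by
  rw [integral_bumpMeasure, mollify_apply,
    ← integral_sub_left_eq_self (fun y => u y * ρ.normed μ (z - y)) μ z]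
  simp

theorem integrable_bumpMeasure_comp_sub {ρ : ContDiffBump (0 : E)} {u : E → ℝ}
    (hu : Integrable u μ) (z : E) : Integrable (fun y => u (z - y)) (bumpMeasure μ ρ) :=
  integrable_bumpMeasure (hu.comp_sub_left z).locallyIntegrable

theorem mollify_contDiff (ρ : ContDiffBump (0 : E)) {u : E → ℝ} (hu : LocallyIntegrable u μ) :
    ContDiff ℝ ∞ (mollify μ ρ u) :=
  ρ.hasCompactSupport_normed.contDiff_convolution_right _ hu ρ.contDiff_normed

theorem mollify_hasCompactSupport (ρ : ContDiffBump (0 : E)) {u : E → ℝ}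
    (hu : HasCompactSupport u) : HasCompactSupport (mollify μ ρ u) :=
  HasCompactSupport.convolution _ hu ρ.hasCompactSupport_normed

/-- The derivative falls on the kernel; this is the form to which the definition of a weak
derivative applies. -/
theorem mollify_fderiv (ρ : ContDiffBump (0 : E)) {u : E → ℝ} (hu : LocallyIntegrable u μ)
    (z d : E) :
    fderiv ℝ (mollify μ ρ u) z d = ∫ y, u y * fderiv ℝ (ρ.normed μ) (z - y) d ∂μ := by
  have hρ : ContDiff ℝ 1 (ρ.normed μ) := ρ.contDiff_normed
  have h := (ρ.hasCompactSupport_normed.hasFDerivAt_convolution_right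
    (ContinuousLinearMap.mul ℝ ℝ) hu hρ z).fderiv
  rw [mollify, h]
  exact convolution_precompR_apply _ hu (ρ.hasCompactSupport_normed.fderiv (𝕜 := ℝ))
    (hρ.continuous_fderiv one_ne_zero) z d

/-- An order that holds only almost everywhere becomes pointwise after mollification; this is how
the obstacle condition reaches the smooth comparison functions. -/
theorem mollify_mono_of_ae (ρ : ContDiffBump (0 : E)) {u v : E → ℝ} (hu : LocallyIntegrable u μ)
    (hv : LocallyIntegrable v μ) (h : ∀ᵐ z ∂μ, u z ≤ v z) (z : E) :
    mollify μ ρ u z ≤ mollify μ ρ v z := by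
  rw [mollify_apply, mollify_apply]
  have key : ∀ w : E → ℝ, LocallyIntegrable w μ →
      Integrable (fun y => w y * ρ.normed μ (z - y)) μ := fun w hw =>
    hw.integrable_smul_right_of_hasCompactSupport
      (ρ.continuous_normed.comp (continuous_const.sub continuous_id))
      (ρ.hasCompactSupport_normed.comp_homeomorph (Homeomorph.subLeft z))
  refine integral_mono_ae (key u hu) (key v hv) ?_
  filter_upwards [h] with y hy
  exact mul_le_mul_of_nonneg_right hy (ρ.nonneg_normed _)

end Averaging

end AnisoObstacle

/-! ### Exponential averages over the past -/

namespace AnisoObstacle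

instance instIsAddHaarMeasureSpaceTime (N : ℕ) :
    (volume : Measure (SpaceTime N)).IsAddHaarMeasure :=
  Measure.prod.instIsAddHaarMeasure (volume : Measure (EuclideanSpace ℝ (Fin N)))
    (volume : Measure ℝ)

/-- The standard exponential distribution. -/
noncomputable def expMeasure : Measure ℝ :=
  (volume.restrict (Ioi (0 : ℝ))).withDensity fun s => ENNReal.ofReal (Real.exp (-s))

theorem integral_expMeasure {F : Type*} [NormedAddCommGroup F] [NormedSpace ℝ F] (g : ℝ → F) :
    ∫ s, g s ∂expMeasure = ∫ s in Ioi (0 : ℝ), Real.exp (-s) • g s := by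
  rw [expMeasure, integral_withDensity_eq_integral_toReal_smul
    (by fun_prop) (Eventually.of_forall fun _ => by simp)]
  simp [ENNReal.toReal_ofReal, Real.exp_nonneg]

instance : IsProbabilityMeasure expMeasure := by
  constructor
  rw [expMeasure, withDensity_apply _ MeasurableSet.univ, Measure.restrict_univ,
    ← ofReal_integral_eq_lintegral_ofReal (integrableOn_exp_neg_Ioi 0)
      (Eventually.of_forall fun y => (Real.exp_pos _).le), integral_exp_neg_Ioi_zero,
    ENNReal.ofReal_one]

section ExpAvg

variable {N : ℕ}

/-- Exponentially weighted average over the past, at time scale `h`. -/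
noncomputable def expAvg (h : ℝ) (m : SpaceTime N → ℝ) (z : SpaceTime N) : ℝ :=
  ∫ s, m (z - (h * s) • dirT N) ∂expMeasure

variable {m : SpaceTime N → ℝ}

theorem integrable_comp_sub_expMeasure {F : Type*} [NormedAddCommGroup F]
    {m : SpaceTime N → F} (hm : Continuous m) (hc : HasCompactSupport m)
    (h : ℝ) (z : SpaceTime N) :
    Integrable (fun s => m (z - (h * s) • dirT N)) expMeasure := by
  obtain ⟨C, hC⟩ := hc.exists_bound_of_continuous hm
  refine Integrable.of_bound (Continuous.aestronglyMeasurable (by fun_prop)) C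
    (Eventually.of_forall fun s => hC _)

theorem expAvg_hasFDerivAt (hm : ContDiff ℝ 1 m) (hc : HasCompactSupport m) (h : ℝ)
    (z : SpaceTime N) :
    HasFDerivAt (expAvg h m) (∫ s, fderiv ℝ m (z - (h * s) • dirT N) ∂expMeasure) z := by
  have hm' : Continuous (fderiv ℝ m) := hm.continuous_fderiv one_ne_zero
  obtain ⟨C, hC⟩ := (hc.fderiv (𝕜 := ℝ)).exists_bound_of_continuous hm'
  have hmc := hm.continuous
  refine hasFDerivAt_integral_of_dominated_of_fderiv_le (bound := fun _ => C)
    (F := fun z s => m (z - (h * s) • dirT N)) (s := univ)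
    (F' := fun z s => fderiv ℝ m (z - (h * s) • dirT N)) univ_mem
    (Eventually.of_forall fun x => (integrable_comp_sub_expMeasure hmc hc h x).1)
    (integrable_comp_sub_expMeasure hmc hc h z)
    (integrable_comp_sub_expMeasure hm' (hc.fderiv (𝕜 := ℝ)) h z).1
    (Eventually.of_forall fun a x _ => hC _) (integrable_const _)
    (Eventually.of_forall fun a x _ => ?_)
  have h1 := (hm.differentiable one_ne_zero (x - (h * a) • dirT N)).hasFDerivAt
  simpa [Function.comp_def] using h1.comp x ((hasFDerivAt_id x).sub_const ((h * a) • dirT N))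

theorem expAvg_contDiff (hm : ContDiff ℝ 1 m) (hc : HasCompactSupport m) (h : ℝ) :
    ContDiff ℝ 1 (expAvg h m) := by
  rw [contDiff_one_iff_fderiv]
  refine ⟨fun z => (expAvg_hasFDerivAt hm hc h z).differentiableAt, ?_⟩
  have hm' : Continuous (fderiv ℝ m) := hm.continuous_fderiv one_ne_zero
  obtain ⟨C, hC⟩ := (hc.fderiv (𝕜 := ℝ)).exists_bound_of_continuous hm'
  simp_rw [funext fun z => (expAvg_hasFDerivAt hm hc h z).fderiv]
  refine continuous_of_dominated (bound := fun _ => C)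
    (fun z => (integrable_comp_sub_expMeasure hm' (hc.fderiv (𝕜 := ℝ)) h z).1)
    (fun z => Eventually.of_forall fun s => hC _) (integrable_const _)
    (Eventually.of_forall fun s => by fun_prop)

theorem expAvg_fderiv (hm : ContDiff ℝ 1 m) (hc : HasCompactSupport m) (h : ℝ)
    (z d : SpaceTime N) :
    fderiv ℝ (expAvg h m) z d = expAvg h (fun z => fderiv ℝ m z d) z := by
  rw [(expAvg_hasFDerivAt hm hc h z).fderiv, ContinuousLinearMap.integral_apply
    (integrable_comp_sub_expMeasure (hm.continuous_fderiv one_ne_zero)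
      (hc.fderiv (𝕜 := ℝ)) h z)]
  rfl

/-- Integrate by parts against `e^(-s)`, using that the `s`-derivative of `m (z - h s e_t)` is `-h`
times the time derivative. The identity gives `m - f` the sign of the time derivative of the average
`f`. -/
theorem expAvg_fderiv_dirT (hm : ContDiff ℝ 1 m) (hc : HasCompactSupport m) {h : ℝ} (hh : 0 < h)
    (z : SpaceTime N) :
    fderiv ℝ (expAvg h m) z (dirT N) = (m z - expAvg h m z) / h := by
  rw [expAvg_fderiv hm hc]
  set w : ℝ → ℝ := fun s => m (z - (h * s) • dirT N) with hw
  set w' : ℝ → ℝ := fun s => fderiv ℝ m (z - (h * s) • dirT N) (dirT N) with hw'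
  have hmc := hm.continuous
  have hm' : Continuous (fderiv ℝ m) := hm.continuous_fderiv one_ne_zero
  have hcw : Continuous w := by fun_prop
  have hcw' : Continuous w' := by fun_prop
  obtain ⟨C, hC⟩ := hc.exists_bound_of_continuous hmc
  have hint : ∀ {g : ℝ → ℝ}, Integrable g expMeasure →
      IntegrableOn (fun s => Real.exp (-s) * g s) (Ioi 0) := by
    intro g hg
    rw [expMeasure, integrable_withDensity_iff_integrable_smul₀' (by fun_prop)
      (Eventually.of_forall fun _ => by simp)] at hg
    simpa [ENNReal.toReal_ofReal, Real.exp_nonneg, IntegrableOn] using hg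
  have hd' : Integrable w' expMeasure :=
    (integrable_comp_sub_expMeasure hm' (hc.fderiv (𝕜 := ℝ)) h z).apply_continuousLinearMap _
  have h1 : ∀ s, HasDerivAt w (-h * w' s) s := by
    intro s
    have e1 : HasDerivAt (fun s : ℝ => z - (h * s) • dirT N) (-(h • dirT N)) s := by
      have := (((hasDerivAt_id s).const_mul h).smul_const (dirT N)).const_sub z
      simpa using this
    have e2 := (hm.differentiable one_ne_zero (z - (h * s) • dirT N)).hasFDerivAt.comp_hasDerivAt
      s e1
    simpa [hw', hw, Function.comp_def] using e2
  have key := integral_Ioi_mul_deriv_eq_deriv_mul (a := 0) (a' := w 0) (b' := 0)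
    (u := fun s => Real.exp (-s)) (u' := fun s => -Real.exp (-s)) (v := w)
    (v' := fun s => -h * w' s)
    (fun s _ => by simpa [Function.comp_def] using (Real.hasDerivAt_exp (-s)).comp s (hasDerivAt_neg s))
    (fun s _ => h1 s)
    (by simpa [Pi.mul_def, mul_assoc] using hint (hd'.const_mul (-h)))
    (by
      have := (hint (integrable_comp_sub_expMeasure hmc hc h z)).neg
      refine this.congr (Eventually.of_forall fun s => ?_)
      simp [hw])
    (by
      have : Continuous ((fun s => Real.exp (-s)) * w) := by
        exact (Real.continuous_exp.comp continuous_neg).mul hcw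
      have := this.tendsto 0
      simp only [Pi.mul_apply, neg_zero, Real.exp_zero, one_mul] at this
      exact this.mono_left nhdsWithin_le_nhds)
    (by
      have h2 : Tendsto (fun s : ℝ => Real.exp (-s) * C) atTop (𝓝 0) := by
        simpa using (Real.tendsto_exp_neg_atTop_nhds_zero.mul_const C)
      refine squeeze_zero_norm (fun s => ?_) h2
      simp only [Pi.mul_apply, norm_mul, Real.norm_eq_abs, Real.abs_exp]
      exact mul_le_mul_of_nonneg_left (hC _) (Real.exp_pos _).le)
  have e1 : expAvg h (fun z => fderiv ℝ m z (dirT N)) z =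
      ∫ s in Ioi (0 : ℝ), Real.exp (-s) * w' s := integral_expMeasure _
  have e2 : expAvg h m z = ∫ s in Ioi (0 : ℝ), Real.exp (-s) * w s := integral_expMeasure _
  rw [e1, e2, eq_div_iff hh.ne']
  have e3 : ∫ s in Ioi (0 : ℝ), Real.exp (-s) * (-h * w' s) =
      -h * ∫ s in Ioi (0 : ℝ), Real.exp (-s) * w' s := by
    rw [← integral_const_mul]
    refine integral_congr_ae (Eventually.of_forall fun s => ?_)
    simp only; ring
  have e4 : ∫ s in Ioi (0 : ℝ), -Real.exp (-s) * w s =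
      - ∫ s in Ioi (0 : ℝ), Real.exp (-s) * w s := by
    rw [← integral_neg]
    refine integral_congr_ae (Eventually.of_forall fun s => ?_)
    simp only; ring
  have e5 : w 0 = m z := by simp [hw]
  rw [e3, e4, e5] at key
  linarith

theorem expAvg_mono {m₁ m₂ : SpaceTime N → ℝ} (h₁ : Continuous m₁) (hc₁ : HasCompactSupport m₁)
    (h₂ : Continuous m₂) (hc₂ : HasCompactSupport m₂) (hle : ∀ z, m₁ z ≤ m₂ z) (h : ℝ)
    (z : SpaceTime N) : expAvg h m₁ z ≤ expAvg h m₂ z :=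
  integral_mono (integrable_comp_sub_expMeasure h₁ hc₁ h z)
    (integrable_comp_sub_expMeasure h₂ hc₂ h z) fun _ => hle _

end ExpAvg

/-- A function with a weak derivative on the whole space: the derivative of the mollification
is the mollification of the derivative. -/
theorem mollify_fderiv_of_hasWeakDeriv {N : ℕ} (ρ : ContDiffBump (0 : SpaceTime N))
    {u g : SpaceTime N → ℝ} {d : SpaceTime N} (h : HasWeakDeriv univ d u g) (z : SpaceTime N) :
    fderiv ℝ (mollify volume ρ u) z d = mollify volume ρ g z := by
  have hu : LocallyIntegrable u volume := locallyIntegrableOn_univ.1 h.locInt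
  rw [mollify_fderiv ρ hu, mollify_apply]
  have hρ : ContDiff ℝ ∞ (ρ.normed (volume : Measure (SpaceTime N))) := ρ.contDiff_normed
  have ht : IsTestFunction univ (fun y => ρ.normed volume (z - y)) :=
    ⟨hρ.comp (contDiff_const.sub contDiff_id),
      ρ.hasCompactSupport_normed.comp_homeomorph (Homeomorph.subLeft z), subset_univ _⟩
  have h2 := h.eq _ ht
  have h3 : ∀ y, fderiv ℝ (fun y => ρ.normed volume (z - y)) y d =
      -fderiv ℝ (ρ.normed volume) (z - y) d := by
    intro y
    have e1 := (hρ.differentiable (by simp) (z - y)).hasFDerivAt.comp y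
      ((hasFDerivAt_id y).const_sub z)
    have e2 := e1.fderiv
    simp only [Function.comp_def] at e2
    rw [e2]; simp
  simp only [h3, Measure.restrict_univ, mul_neg, integral_neg] at h2
  linarith

end AnisoObstacle

/-! ### Approximation of a localized solution -/

namespace AnisoObstacle

section Approximation

variable {N : ℕ}

theorem tendsto_lintegral_mollify_sub {ρ : ℕ → ContDiffBump (0 : SpaceTime N)}
    (hρ : Tendsto (fun n => (ρ n).rOut) atTop (𝓝 0)) {w : SpaceTime N → ℝ} {r : ℝ} (hr : 1 ≤ r)
    (hw : StronglyMeasurable w) (hi : Integrable w volume)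
    (hp : MemLp w (ENNReal.ofReal r) volume) :
    Tendsto (fun n => ∫⁻ z, ‖mollify volume (ρ n) w z - w z‖ₑ ^ r) atTop (𝓝 0) := by
  refine tendsto_of_tendsto_of_tendsto_of_le_of_le tendsto_const_nhds
    (tendsto_lintegral_translationModulus_of_support hr hp
      (ν := fun n => bumpMeasure volume (ρ n)) hρ
      (fun n => ae_bumpMeasure_norm_le (ρ n))) (fun _ => zero_le) fun n => ?_
  simp_rw [mollify_eq_integral]
  exact lintegral_enorm_average_sub_le hr measurable_id hw
    fun z => integrable_bumpMeasure_comp_sub hi z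

/-- The averaged functions may change with `n`: only the translation modulus of the limit `w`
enters, not those of the `m n`. -/
theorem tendsto_lintegral_expAvg_sub {m : ℕ → SpaceTime N → ℝ} {h : ℕ → ℝ}
    (hh : Tendsto h atTop (𝓝 0)) {w : SpaceTime N → ℝ} {r : ℝ} (hr : 1 ≤ r)
    (hw : StronglyMeasurable w) (hp : MemLp w (ENNReal.ofReal r) volume)
    (hm : ∀ n, Continuous (m n)) (hc : ∀ n, HasCompactSupport (m n))
    (hlim : Tendsto (fun n => ∫⁻ z, ‖m n z - w z‖ₑ ^ r) atTop (𝓝 0)) :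
    Tendsto (fun n => ∫⁻ z, ‖expAvg (h n) (m n) z - w z‖ₑ ^ r) atTop (𝓝 0) := by
  have h1 := tendsto_lintegral_translationModulus (ν := expMeasure) hr hp
    (Y := fun n s => (h n * s) • dirT N) (fun n => by fun_prop) (fun s => by
      have := ((hh.mul_const s).smul_const (dirT N))
      simpa using this)
  have h2 := ENNReal.Tendsto.const_mul (a := 2 ^ (r - 1)) (hlim.add h1)
    (Or.inr (ENNReal.rpow_ne_top_of_nonneg (by linarith) (by simp)))
  rw [add_zero, mul_zero] at h2
  refine tendsto_of_tendsto_of_tendsto_of_le_of_le tendsto_const_nhds h2 (fun _ => zero_le)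
    fun n => ?_
  exact lintegral_enorm_average_sub_le_of_approx hr (by fun_prop) hw (hm n).stronglyMeasurable
    fun z => integrable_comp_sub_expMeasure (hm n) (hc n) (h n) z

theorem integrable_id_expMeasure : Integrable (fun s : ℝ => s) expMeasure := by
  rw [expMeasure, integrable_withDensity_iff_integrable_smul₀' (by fun_prop)
      (Eventually.of_forall fun _ => by simp)]
  have := Real.GammaIntegral_convergent (s := 2) (by norm_num)
  refine this.congr_fun (fun s _ => ?_) measurableSet_Ioi
  norm_num [ENNReal.toReal_ofReal, Real.exp_nonneg]

theorem ae_expMeasure_pos : ∀ᵐ s ∂expMeasure, 0 < s :=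
  (withDensity_absolutelyContinuous _ _).ae_le (ae_restrict_mem measurableSet_Ioi)

theorem norm_dirT : ‖dirT N‖ = 1 := by
  simp [dirT, Prod.norm_def]

/-- Mollifications of a continuous compactly supported function are uniformly almost above it. -/
theorem eventually_le_expAvg_mollify {ρ : ℕ → ContDiffBump (0 : SpaceTime N)} {h : ℕ → ℝ}
    (hρ : Tendsto (fun n => (ρ n).rOut) atTop (𝓝 0)) (hh : Tendsto h atTop (𝓝 0))
    (hpos : ∀ n, 0 < h n) {φ : SpaceTime N → ℝ} (hφ : Continuous φ) (hc : HasCompactSupport φ)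
    {ε : ℝ} (hε : 0 < ε) :
    ∀ᶠ n in atTop, ∀ z, φ z ≤ expAvg (h n) (mollify volume (ρ n) φ) z + ε := by
  obtain ⟨C, hC⟩ := hc.exists_bound_of_continuous hφ
  have hC0 : 0 ≤ C := (norm_nonneg _).trans (hC 0)
  obtain ⟨δ, hδ, hδφ⟩ := Metric.uniformContinuous_iff.1
    (hc.uniformContinuous_of_continuous hφ) (ε / 4) (by positivity)
  -- An affine modulus valid for all shifts: uniform continuity serves for short ones and the bound
  -- `2C` for long ones. Linear growth is integrable against the exponential law, whose support is
  -- unbounded.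
  have hmod : ∀ z y, φ z - (ε / 4 + 2 * C / δ * ‖y‖) ≤ φ (z - y) := by
    intro z y
    have hn : 0 ≤ 2 * C / δ * ‖y‖ := by positivity
    by_cases hy : ‖y‖ < δ
    · have := hδφ (a := z - y) (b := z) (by simpa [dist_eq_norm] using hy)
      rw [Real.dist_eq, abs_lt] at this
      linarith [this.1]
    · have h1 : 2 * C ≤ 2 * C / δ * ‖y‖ := by
        rw [div_mul_eq_mul_div, le_div_iff₀ hδ]
        exact mul_le_mul_of_nonneg_left (not_lt.1 hy) (by positivity)
      have h2 := abs_le.1 (hC z)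
      have h3 := abs_le.1 (hC (z - y))
      linarith [h2.2, h3.1]
  have hφi : Integrable φ volume := hφ.integrable_of_hasCompactSupport hc
  have hmoll : ∀ n z, φ z - (ε / 4 + 2 * C / δ * (ρ n).rOut) ≤ mollify volume (ρ n) φ z := by
    intro n z
    rw [mollify_eq_integral]
    have := integral_mono_ae (μ := bumpMeasure volume (ρ n))
      (f := fun _ => φ z - (ε / 4 + 2 * C / δ * (ρ n).rOut)) (integrable_const _)
      (integrable_bumpMeasure_comp_sub hφi z) (by
        filter_upwards [ae_bumpMeasure_norm_le (μ := volume) (ρ n)] with y hy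
        have h1 := hmod z y
        have h2 : 2 * C / δ * ‖y‖ ≤ 2 * C / δ * (ρ n).rOut :=
          mul_le_mul_of_nonneg_left hy (by positivity)
        linarith)
    simpa using this
  set S : ℝ := ∫ s, s ∂expMeasure with hS
  have hexp : ∀ n z, φ z - (ε / 4 + 2 * C / δ * (ρ n).rOut) - (ε / 4 + 2 * C / δ * (h n * S)) ≤
      expAvg (h n) (mollify volume (ρ n) φ) z := by
    intro n z
    have hmc := (mollify_contDiff (ρ n) hφi.locallyIntegrable).continuous
    have hms := mollify_hasCompactSupport (μ := volume) (ρ n) hc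
    have h1 : Integrable (fun s => φ z - (ε / 4 + 2 * C / δ * (ρ n).rOut) -
        (ε / 4 + 2 * C / δ * (h n * s))) expMeasure := by
      refine (integrable_const _).sub ((integrable_const _).add ?_)
      exact (integrable_id_expMeasure.const_mul _).const_mul _
    have h2 := integral_mono_ae h1 (integrable_comp_sub_expMeasure hmc hms (h n) z) (by
      filter_upwards [ae_expMeasure_pos] with s hs
      have e1 := hmoll n (z - (h n * s) • dirT N)
      have e2 := hmod z ((h n * s) • dirT N)
      rw [norm_smul, norm_dirT, mul_one, Real.norm_of_nonneg (by have := hpos n; positivity)] at e2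
      linarith)
    refine le_trans (le_of_eq ?_) h2
    have i1 : Integrable (fun s : ℝ => 2 * C / δ * (h n * s)) expMeasure :=
      (integrable_id_expMeasure.const_mul _).const_mul _
    rw [integral_sub (integrable_const _)
        (show Integrable (fun s : ℝ => ε / 4 + 2 * C / δ * (h n * s)) expMeasure from
          (integrable_const _).add i1), integral_add (integrable_const _) i1, integral_const_mul, integral_const_mul]
    simp [hS]
  have hl : Tendsto (fun n => 2 * C / δ * (ρ n).rOut + 2 * C / δ * (h n * S)) atTop (𝓝 0) := by
    have := (hρ.const_mul (2 * C / δ)).add ((hh.mul_const S).const_mul (2 * C / δ))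
    simpa using this
  filter_upwards [hl.eventually_lt_const (show (0 : ℝ) < ε / 2 by positivity)] with n hn z
  linarith [hexp n z]

/-- Split `m - f = (m - u) - (f - u)` and apply a weighted Young inequality. The large factor `2 / h
^ 3` falls on `m - u`, which can be made small after `h` has been fixed. -/
theorem lintegral_mul_time_derivative_le {u m f : SpaceTime N → ℝ} (hu : Measurable u)
    (hm : Measurable m) {h : ℝ} (hh : 0 < h) (hh1 : h ≤ 1) :
    ∫⁻ z, ‖m z - u z‖ₑ * ‖(m z - f z) / h‖ₑ ≤
      ENNReal.ofReal (2 / h ^ 3) * (∫⁻ z, ‖m z - u z‖ₑ ^ (2 : ℝ)) +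
        ENNReal.ofReal h * ∫⁻ z, ‖f z - u z‖ₑ ^ (2 : ℝ) := by
  have hmu : Measurable fun z => ‖m z - u z‖ₑ ^ (2 : ℝ) := (hm.sub hu).enorm.pow_const _
  rw [← lintegral_const_mul _ hmu, ← lintegral_const_mul' _ _ ENNReal.ofReal_ne_top,
    ← lintegral_add_left (hmu.const_mul _)]
  refine lintegral_mono fun z => ?_
  simp only [Real.enorm_eq_ofReal_abs]
  rw [ENNReal.ofReal_rpow_of_nonneg (abs_nonneg _) (by norm_num),
    ENNReal.ofReal_rpow_of_nonneg (abs_nonneg _) (by norm_num), ← ENNReal.ofReal_mul (abs_nonneg _),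
    ← ENNReal.ofReal_mul (by positivity), ← ENNReal.ofReal_mul hh.le,
    ← ENNReal.ofReal_add (by positivity) (by positivity)]
  refine ENNReal.ofReal_le_ofReal ?_
  rw [Real.rpow_two, Real.rpow_two, abs_div, abs_of_pos hh]
  set a := |m z - u z|
  set b := |f z - u z|
  have ha : 0 ≤ a := abs_nonneg _
  have hb : 0 ≤ b := abs_nonneg _
  have hab : |m z - f z| ≤ a + b := by
    have : m z - f z = (m z - u z) - (f z - u z) := by ring
    rw [this]; exact abs_sub _ _
  calc a * (|m z - f z| / h) ≤ a * ((a + b) / h) := by gcongr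
    _ ≤ 2 / h ^ 3 * a ^ 2 + h * b ^ 2 := by
      rw [← sub_nonneg]
      have e : 2 / h ^ 3 * a ^ 2 + h * b ^ 2 - a * ((a + b) / h) =
          (a ^ 2 * (1 - h ^ 2) + (a ^ 2 - h ^ 2 * a * b + h ^ 4 * b ^ 2)) / h ^ 3 := by
        field_simp; ring
      rw [e]
      have h2 : h ^ 2 ≤ 1 := by nlinarith
      have : 0 ≤ a ^ 2 - h ^ 2 * a * b + h ^ 4 * b ^ 2 := by
        nlinarith [sq_nonneg (a - h ^ 2 * b / 2), sq_nonneg (h ^ 2 * b)]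
      have h3 : 0 ≤ a ^ 2 * (1 - h ^ 2) := mul_nonneg (sq_nonneg _) (by linarith)
      positivity

/-- `f` is the exponential average at scale `h` of the mollification `m`. Convergence in all the
required norms comes from the averaging lemmas; the product of `m - u` with the time derivative
vanishes because the mollification radius is chosen after `h`. -/
theorem exists_approximation {p : Fin N → ℝ} (hp : ∀ i, 2 ≤ p i) {u : SpaceTime N → ℝ}
    {g : Fin N → SpaceTime N → ℝ} (hu : StronglyMeasurable u) (hui : Integrable u)
    (huc : HasCompactSupport u) (hu2 : MemLp u 2)
    (hup : ∀ i, MemLp u (ENNReal.ofReal (p i)))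
    (hg : ∀ i, StronglyMeasurable (g i)) (hgi : ∀ i, Integrable (g i))
    (hgc : ∀ i, HasCompactSupport (g i)) (hgp : ∀ i, MemLp (g i) (ENNReal.ofReal (p i)))
    (hug : ∀ i, HasWeakDeriv univ (dirX i) u (g i))
    {φ : SpaceTime N → ℝ} (hφ : Continuous φ) (hφc : HasCompactSupport φ)
    (hφu : ∀ᵐ z, φ z ≤ u z) :
    ∃ (f m : ℕ → SpaceTime N → ℝ) (h : ℕ → ℝ), (∀ n, 0 < h n) ∧ (∀ n, ContDiff ℝ 1 (f n)) ∧
      (∀ n, Continuous (m n)) ∧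
      (∀ n z, fderiv ℝ (f n) z (dirT N) = (m n z - f n z) / h n) ∧
      Tendsto (fun n => ∫⁻ z, ‖f n z - u z‖ₑ ^ (2 : ℝ)) atTop (𝓝 0) ∧
      (∀ i, Tendsto (fun n => ∫⁻ z, ‖f n z - u z‖ₑ ^ p i) atTop (𝓝 0)) ∧
      (∀ i, Tendsto (fun n => ∫⁻ z, ‖fderiv ℝ (f n) z (dirX i) - g i z‖ₑ ^ p i) atTop (𝓝 0)) ∧
      Tendsto (fun n => ∫⁻ z, ‖m n z - u z‖ₑ * ‖fderiv ℝ (f n) z (dirT N)‖ₑ) atTop (𝓝 0) ∧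
      (∀ᵐ z, Tendsto (fun n => f n z) atTop (𝓝 (u z))) ∧
      ∀ ε > 0, ∀ᶠ n in atTop, ∀ z, φ z ≤ f n z + ε := by
  have hu2' : MemLp u (ENNReal.ofReal 2) := by simpa using hu2
  let h : ℕ → ℝ := fun n => 1 / ((n : ℝ) + 1)
  have hh : Tendsto h atTop (𝓝 0) := tendsto_one_div_add_atTop_nhds_zero_nat
  have hpos : ∀ n, 0 < h n := fun n => by positivity
  have hle1 : ∀ n, h n ≤ 1 := fun n => by
    simp only [h]
    rw [div_le_one (by positivity)]
    linarith [(Nat.cast_nonneg n : (0 : ℝ) ≤ n)]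
  let ρ₀ : ℕ → ContDiffBump (0 : SpaceTime N) := fun n =>
    ⟨h n / 2, h n, by have := hpos n; positivity, by have := hpos n; linarith⟩
  have hA := tendsto_lintegral_mollify_sub (ρ := ρ₀) hh one_le_two hu hui hu2'
  -- The power `h ^ 4` beats the factor `2 / h ^ 3` of `lintegral_mul_time_derivative_le` and leaves
  -- `2 h`.
  have hk : ∀ n, ∃ k, n ≤ k ∧
      ∫⁻ z, ‖mollify volume (ρ₀ k) u z - u z‖ₑ ^ (2 : ℝ) ≤ ENNReal.ofReal (h n ^ 4) := by
    intro n
    have h0 : (0 : ℝ≥0∞) < ENNReal.ofReal (h n ^ 4) := by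
      have := hpos n
      rw [ENNReal.ofReal_pos]; positivity
    exact ((eventually_ge_atTop n).and ((ENNReal.tendsto_nhds_zero.1 hA) _ h0)).exists
  choose k hkn hkA using hk
  let ρ : ℕ → ContDiffBump (0 : SpaceTime N) := fun n => ρ₀ (k n)
  have hρ : Tendsto (fun n => (ρ n).rOut) atTop (𝓝 0) :=
    hh.comp (tendsto_atTop_mono hkn tendsto_id)
  let m : ℕ → SpaceTime N → ℝ := fun n => mollify volume (ρ n) u
  let f : ℕ → SpaceTime N → ℝ := fun n => expAvg (h n) (m n)
  have hmC : ∀ n, ContDiff ℝ ∞ (m n) := fun n => mollify_contDiff (ρ n) hui.locallyIntegrable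
  have hmC1 : ∀ n, ContDiff ℝ 1 (m n) := fun n => (hmC n).of_le (by exact_mod_cast le_top)
  have hmc : ∀ n, HasCompactSupport (m n) := fun n => mollify_hasCompactSupport (ρ n) huc
  have hfC : ∀ n, ContDiff ℝ 1 (f n) := fun n => expAvg_contDiff (hmC1 n) (hmc n) (h n)
  have hft : ∀ n z, fderiv ℝ (f n) z (dirT N) = (m n z - f n z) / h n := fun n z =>
    expAvg_fderiv_dirT (hmC1 n) (hmc n) (hpos n) z
  have hconv : ∀ {r : ℝ}, 1 ≤ r → MemLp u (ENNReal.ofReal r) →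
      Tendsto (fun n => ∫⁻ z, ‖f n z - u z‖ₑ ^ r) atTop (𝓝 0) := fun hr hur =>
    tendsto_lintegral_expAvg_sub hh hr hu hur (fun n => (hmC n).continuous) hmc
      (tendsto_lintegral_mollify_sub hρ hr hu hui hur)
  have hconv2 := hconv one_le_two hu2'
  have hconvg : ∀ i, Tendsto (fun n => ∫⁻ z, ‖fderiv ℝ (f n) z (dirX i) - g i z‖ₑ ^ p i)
      atTop (𝓝 0) := by
    intro i
    have hr : 1 ≤ p i := one_le_two.trans (hp i)
    have := tendsto_lintegral_expAvg_sub hh hr (hg i) (hgp i)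
      (fun n => (mollify_contDiff (ρ n) (hgi i).locallyIntegrable).continuous)
      (fun n => mollify_hasCompactSupport (ρ n) (hgc i))
      (tendsto_lintegral_mollify_sub hρ hr (hg i) (hgi i) (hgp i))
    refine this.congr fun n => lintegral_congr fun z => ?_
    congr 3
    rw [expAvg_fderiv (hmC1 n) (hmc n)]
    congr 1
    funext z
    exact (mollify_fderiv_of_hasWeakDeriv (ρ n) (hug i) z).symm
  have htime : Tendsto (fun n => ∫⁻ z, ‖m n z - u z‖ₑ * ‖fderiv ℝ (f n) z (dirT N)‖ₑ) atTop
      (𝓝 0) := by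
    have hlim : Tendsto (fun n => ENNReal.ofReal (2 * h n) +
        ENNReal.ofReal (h n) * ∫⁻ z, ‖f n z - u z‖ₑ ^ (2 : ℝ)) atTop (𝓝 0) := by
      have e1 : Tendsto (fun n => ENNReal.ofReal (2 * h n)) atTop (𝓝 0) := by
        have := ENNReal.tendsto_ofReal (hh.const_mul 2)
        simpa using this
      have e2 : Tendsto (fun n => ENNReal.ofReal (h n)) atTop (𝓝 0) := by
        simpa using ENNReal.tendsto_ofReal hh
      have e3 := ENNReal.Tendsto.mul e2 (Or.inr ENNReal.zero_ne_top) hconv2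
        (Or.inr ENNReal.zero_ne_top)
      simpa using e1.add e3
    refine tendsto_of_tendsto_of_tendsto_of_le_of_le tendsto_const_nhds hlim (fun _ => zero_le)
      fun n => ?_
    simp_rw [hft]
    refine (lintegral_mul_time_derivative_le hu.measurable (hmC n).continuous.measurable (hpos n)
      (hle1 n)).trans ?_
    gcongr
    refine (mul_le_mul_right (hkA n) _).trans ?_
    have := hpos n
    rw [← ENNReal.ofReal_mul (by positivity)]
    refine ENNReal.ofReal_le_ofReal (le_of_eq ?_)
    field_simp
  have hmeas : TendstoInMeasure volume f atTop u := by
    refine tendstoInMeasure_of_tendsto_eLpNorm (p := 2) (by simp)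
      (fun n => (hfC n).continuous.aestronglyMeasurable) hu.aestronglyMeasurable ?_
    have := (ENNReal.continuous_rpow_const (y := (1 / 2 : ℝ))).tendsto 0 |>.comp hconv2
    simp only [one_div, inv_pos, Nat.ofNat_pos, ENNReal.zero_rpow_of_pos] at this
    refine this.congr fun n => ?_
    rw [eLpNorm_eq_lintegral_rpow_enorm_toReal (by simp) (by simp)]
    simp
  -- Pass to a subsequence with pointwise convergence, needed later for nonlinear functions of `f`
  -- under the integral.
  obtain ⟨ns, hns, hae⟩ := hmeas.exists_seq_tendsto_ae
  have hnt := hns.tendsto_atTop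
  refine ⟨fun n => f (ns n), fun n => m (ns n), fun n => h (ns n), fun n => hpos _,
    fun n => hfC _, fun n => (hmC _).continuous, fun n z => hft _ z, hconv2.comp hnt,
    fun i => (hconv (one_le_two.trans (hp i)) (hup i)).comp hnt, fun i => (hconvg i).comp hnt,
    htime.comp hnt, hae, fun ε hε => ?_⟩
  have h1 := eventually_le_expAvg_mollify hρ hh hpos hφ hφc hε
  filter_upwards [hnt.eventually h1] with n hn z
  refine (hn z).trans ?_
  have hφi : Integrable φ volume := hφ.integrable_of_hasCompactSupport hφc
  have := expAvg_mono (mollify_contDiff (ρ (ns n)) hφi.locallyIntegrable).continuous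
    (mollify_hasCompactSupport (ρ (ns n)) hφc) (hmC (ns n)).continuous (hmc (ns n))
    (mollify_mono_of_ae (ρ (ns n)) hφi.locallyIntegrable hui.locallyIntegrable hφu)
    (h (ns n)) z
  simp only [f]
  linarith

end Approximation

end AnisoObstacle

/-! ### Test functions and localization of weak derivatives -/

namespace AnisoObstacle

variable {N : ℕ}

namespace IsTestFunction

variable {U V : Set (SpaceTime N)} {η χ : SpaceTime N → ℝ}

theorem mono (h : IsTestFunction U η) (hUV : U ⊆ V) : IsTestFunction V η :=
  ⟨h.smooth, h.compact, h.support.trans hUV⟩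

theorem mul_left (hχ : IsTestFunction U χ) (hη : ContDiff ℝ ∞ η) :
    IsTestFunction U (fun z => χ z * η z) :=
  ⟨hχ.smooth.mul hη, hχ.compact.mul_right, (tsupport_mul_subset_left).trans hχ.support⟩

theorem contDiff_one (h : IsTestFunction U η) : ContDiff ℝ 1 η :=
  h.smooth.of_le (by exact_mod_cast le_top)

theorem differentiable (h : IsTestFunction U η) : Differentiable ℝ η :=
  h.contDiff_one.differentiable one_ne_zero

theorem continuous_fderiv_apply (h : IsTestFunction U η) (d : SpaceTime N) :
    Continuous fun z => fderiv ℝ η z d :=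
  (h.contDiff_one.continuous_fderiv one_ne_zero).clm_apply continuous_const

theorem eq_zero (_ : IsTestFunction U η) {z : SpaceTime N} (hz : z ∉ tsupport η) : η z = 0 :=
  image_eq_zero_of_notMem_tsupport hz

theorem fderiv_eq_zero (_ : IsTestFunction U η) {z : SpaceTime N} (hz : z ∉ tsupport η)
    (d : SpaceTime N) : fderiv ℝ η z d = 0 := by
  have : z ∉ tsupport (fderiv ℝ η) := fun h => hz (tsupport_fderiv_subset ℝ h)
  rw [image_eq_zero_of_notMem_tsupport this]; rfl

theorem hasCompactSupport_fderiv_apply (h : IsTestFunction U η) (d : SpaceTime N) :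
    HasCompactSupport fun z => fderiv ℝ η z d := by
  refine HasCompactSupport.of_support_subset_isCompact h.compact fun z hz => ?_
  by_contra hn
  exact hz (h.fderiv_eq_zero hn d)

end IsTestFunction

/-- Equality with `1` on a neighbourhood of `K`, rather than on `K` alone, makes the derivatives of
the cut-off vanish on `K`. -/
theorem exists_testFunction_eq_one {K U : Set (SpaceTime N)} (hK : IsCompact K) (hU : IsOpen U)
    (hKU : K ⊆ U) : ∃ χ : SpaceTime N → ℝ, IsTestFunction U χ ∧ (∀ z, 0 ≤ χ z) ∧
      (∀ z, χ z ≤ 1) ∧ ∀ᶠ z in 𝓝ˢ K, χ z = 1 := by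
  obtain ⟨K', hK', hKK', hK'U⟩ := exists_compact_between hK hU hKU
  obtain ⟨f, hf1, hf0, hf⟩ := exists_contMDiffMap_one_nhds_of_subset_interior
    (n := ⊤) (modelWithCornersSelf ℝ (SpaceTime N)) hK.isClosed hKK'
  have hs : tsupport (f : SpaceTime N → ℝ) ⊆ K' := by
    refine closure_minimal (fun z hz => ?_) hK'.isClosed
    by_contra hn
    exact hz (hf0 z hn)
  exact ⟨f, ⟨f.contMDiff.contDiff, hK'.of_isClosed_subset (isClosed_tsupport _) hs,
    hs.trans hK'U⟩, fun z => (hf z).1, fun z => (hf z).2, hf1⟩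

theorem integrable_mul_of_locallyIntegrableOn {U : Set (SpaceTime N)} {u a : SpaceTime N → ℝ}
    (hu : LocallyIntegrableOn u U volume) (ha : Continuous a) (hc : HasCompactSupport a)
    (hU : tsupport a ⊆ U) : Integrable (fun z => a z * u z) volume := by
  have h1 : IntegrableOn (fun z => a z * u z) (tsupport a) volume :=
    (hu.integrableOn_compact_subset hU hc).continuousOn_mul ha.continuousOn hc
  refine (integrableOn_iff_integrable_of_support_subset fun z hz => ?_).1 h1
  exact subset_tsupport _ (left_ne_zero_of_mul hz)

theorem setIntegral_eq_integral_of_tsupport {U : Set (SpaceTime N)} {K : Set (SpaceTime N)}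
    (hK : K ⊆ U) {a : SpaceTime N → ℝ} (ha : ∀ z ∉ K, a z = 0) :
    ∫ z in U, a z = ∫ z, a z :=
  setIntegral_eq_integral_of_forall_compl_eq_zero fun z hz => ha z fun h => hz (hK h)

/-- Localization of a weak derivative by a smooth cutoff. -/
theorem HasWeakDeriv.cutoff {U : Set (SpaceTime N)} {d : SpaceTime N} {u g χ : SpaceTime N → ℝ}
    (h : HasWeakDeriv U d u g) (hχ : IsTestFunction U χ) :
    HasWeakDeriv univ d (fun z => χ z * u z) (fun z => χ z * g z + fderiv ℝ χ z d * u z) := by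
  have hsub : tsupport (fun z => fderiv ℝ χ z d) ⊆ tsupport χ := by
    refine closure_minimal (fun z hz => ?_) (isClosed_tsupport _)
    by_contra hn
    exact hz (hχ.fderiv_eq_zero hn d)
  have i1 : Integrable (fun z => χ z * u z) :=
    integrable_mul_of_locallyIntegrableOn h.locInt hχ.smooth.continuous hχ.compact hχ.support
  have i2 : Integrable (fun z => χ z * g z) :=
    integrable_mul_of_locallyIntegrableOn h.locInt_deriv hχ.smooth.continuous hχ.compact
      hχ.support
  have i3 : Integrable (fun z => fderiv ℝ χ z d * u z) :=
    integrable_mul_of_locallyIntegrableOn h.locInt (hχ.continuous_fderiv_apply d)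
      (hχ.hasCompactSupport_fderiv_apply d) (hsub.trans hχ.support)
  refine ⟨locallyIntegrableOn_univ.2 i1.locallyIntegrable,
    locallyIntegrableOn_univ.2 (i2.add i3).locallyIntegrable, fun η hη => ?_⟩
  have key := h.eq _ (hχ.mul_left hη.smooth)
  have hd : ∀ z, fderiv ℝ (fun z => χ z * η z) z d = χ z * fderiv ℝ η z d +
      fderiv ℝ χ z d * η z := by
    intro z
    rw [fderiv_fun_mul (hχ.differentiable z) (hη.differentiable z)]
    simp [mul_comm]
  have hbdd : ∀ {a b : SpaceTime N → ℝ}, Integrable a → Continuous b → HasCompactSupport b →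
      Integrable fun z => a z * b z := by
    intro a b ha hb hbc
    obtain ⟨C, hC⟩ := hbc.exists_bound_of_continuous hb
    exact ha.mul_bdd hb.aestronglyMeasurable (Eventually.of_forall hC)
  have j1 := hbdd i1 (hη.continuous_fderiv_apply d) (hη.hasCompactSupport_fderiv_apply d)
  have j2 := hbdd i2 hη.smooth.continuous hη.compact
  have j3 := hbdd i3 hη.smooth.continuous hη.compact
  rw [setIntegral_eq_integral_of_tsupport hχ.support (fun z hz => by
      rw [hd, hχ.eq_zero hz, hχ.fderiv_eq_zero hz]; simp),
    setIntegral_eq_integral_of_tsupport hχ.support (fun z hz => by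
      rw [hχ.eq_zero hz]; simp)] at key
  rw [Measure.restrict_univ]
  have e1 : ∫ z, u z * fderiv ℝ (fun z => χ z * η z) z d =
      (∫ z, χ z * u z * fderiv ℝ η z d) + ∫ z, fderiv ℝ χ z d * u z * η z := by
    rw [← integral_add j1 j3]
    refine integral_congr_ae (Eventually.of_forall fun z => ?_)
    simp only [hd]; ring
  have e2 : ∫ z, (χ z * g z + fderiv ℝ χ z d * u z) * η z =
      (∫ z, χ z * g z * η z) + ∫ z, fderiv ℝ χ z d * u z * η z := by
    rw [← integral_add j2 j3]
    refine integral_congr_ae (Eventually.of_forall fun z => ?_)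
    simp only; ring
  have e3 : ∫ z, g z * (χ z * η z) = ∫ z, χ z * g z * η z :=
    integral_congr_ae (Eventually.of_forall fun z => by simp only; ring)
  rw [e2]
  linarith

theorem HasWeakDeriv.congr_ae {d : SpaceTime N} {u g u' g' : SpaceTime N → ℝ}
    (h : HasWeakDeriv univ d u g) (hu : u =ᵐ[volume] u') (hg : g =ᵐ[volume] g') :
    HasWeakDeriv univ d u' g' := by
  refine ⟨locallyIntegrableOn_univ.2 ((locallyIntegrableOn_univ.1 h.locInt).congr hu),
    locallyIntegrableOn_univ.2 ((locallyIntegrableOn_univ.1 h.locInt_deriv).congr hg),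
    fun η hη => ?_⟩
  have := h.eq η hη
  rw [Measure.restrict_univ] at this ⊢
  have e1 : ∫ z, u z * fderiv ℝ η z d = ∫ z, u' z * fderiv ℝ η z d :=
    integral_congr_ae (hu.mul (EventuallyEq.refl _ fun z => fderiv ℝ η z d))
  have e2 : ∫ z, g z * η z = ∫ z, g' z * η z :=
    integral_congr_ae (hg.mul (EventuallyEq.refl _ η))
  rw [← e1, ← e2, this]

/-! ### Admissible comparison functions -/

section Comparison

variable {Ω : Set (EuclideanSpace ℝ (Fin N))} {T M : ℝ} {q : SpaceTime N → ℝ}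

theorem continuous_fderiv_apply_of_contDiff_one (hq : ContDiff ℝ 1 q) (d : SpaceTime N) :
    Continuous fun z => fderiv ℝ q z d :=
  (hq.continuous_fderiv one_ne_zero).clm_apply continuous_const

theorem integral_mul_fderiv_eq_neg_of_contDiff_one {v η : SpaceTime N → ℝ} {V : Set (SpaceTime N)}
    (hv : ContDiff ℝ 1 v) (hη : IsTestFunction V η) (d : SpaceTime N) :
    ∫ z, v z * fderiv ℝ η z d = -∫ z, fderiv ℝ v z d * η z := by
  have hη1 := hη.smooth.continuous
  refine integral_mul_fderiv_eq_neg_fderiv_mul_of_integrable ?_ ?_ ?_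
    (fun z _ => hv.differentiable one_ne_zero z) (fun z _ => hη.differentiable z)
  · exact ((continuous_fderiv_apply_of_contDiff_one hv d).mul
      hη1).integrable_of_hasCompactSupport hη.compact.mul_left
  · exact (hv.continuous.mul (hη.continuous_fderiv_apply d)).integrable_of_hasCompactSupport
      (hη.hasCompactSupport_fderiv_apply d).mul_left
  · exact (hv.continuous.mul hη1).integrable_of_hasCompactSupport hη.compact.mul_left

theorem hasWeakDeriv_const_add (hq : ContDiff ℝ 1 q) (M : ℝ) (U : Set (SpaceTime N))
    (d : SpaceTime N) : HasWeakDeriv U d (fun z => M + q z) (fun z => fderiv ℝ q z d) := by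
  have hv : ContDiff ℝ 1 fun z => M + q z := contDiff_const.add hq
  refine ⟨hv.continuous.locallyIntegrable.locallyIntegrableOn _,
    (continuous_fderiv_apply_of_contDiff_one hq d).locallyIntegrable.locallyIntegrableOn _,
    fun η hη => ?_⟩
  rw [setIntegral_eq_integral_of_tsupport hη.support (fun z hz => by
      rw [hη.fderiv_eq_zero hz]; simp),
    setIntegral_eq_integral_of_tsupport hη.support (fun z hz => by
      rw [hη.eq_zero hz]; simp), integral_mul_fderiv_eq_neg_of_contDiff_one hv hη]
  simp only [fderiv_const_add]

theorem isFiniteMeasure_restrict_of_isBounded (hΩ : Bornology.IsBounded Ω) :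
    IsFiniteMeasure (volume.restrict Ω) :=
  ⟨by rw [Measure.restrict_apply_univ]; exact hΩ.measure_lt_top⟩

theorem isFiniteMeasure_restrict_spaceTimeDomain (hΩ : Bornology.IsBounded Ω) (T : ℝ) :
    IsFiniteMeasure (volume.restrict (spaceTimeDomain Ω T)) :=
  ⟨by
    rw [Measure.restrict_apply_univ]
    exact (hΩ.prod (Metric.isBounded_Ioc 0 T)).measure_lt_top⟩

/-- A compactly supported continuous function is uniformly continuous, so its time slices vary
continuously in the supremum norm, hence in `L²` of the bounded set `Ω`. -/
theorem contL2_const_add (hΩ : Bornology.IsBounded Ω) (hq : Continuous q)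
    (hc : HasCompactSupport q) : ContL2 Ω T (fun z => M + q z) := by
  have := isFiniteMeasure_restrict_of_isBounded hΩ
  obtain ⟨C, hC⟩ := hc.exists_bound_of_continuous hq
  have hs : ∀ t, Continuous fun x => q (x, t) := fun t => by fun_prop
  refine ⟨fun t _ => ?_, fun t₀ _ => ?_⟩
  · refine MemLp.of_bound (continuous_const.add (hs t)).aestronglyMeasurable (‖M‖ + C)
      (Eventually.of_forall fun x => (norm_add_le _ _).trans ?_)
    gcongr
    exact hC _
  · have huc := hc.uniformContinuous_of_continuous hq
    set V := volume.restrict Ω univ ^ (1 / (2 : ℝ≥0∞).toReal) with hV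
    have hVt : V ≠ ⊤ := ENNReal.rpow_ne_top_of_nonneg (by simp) (measure_ne_top _ _)
    have hlim : Tendsto (fun t => ⨆ x, ‖q (x, t) - q (x, t₀)‖ₑ) (𝓝 t₀) (𝓝 0) := by
      rw [ENNReal.tendsto_nhds_zero]
      intro ε hε
      by_cases hεt : ε = ⊤
      · simp [hεt]
      obtain ⟨δ, hδ, hd⟩ := Metric.uniformContinuous_iff.1 huc ε.toReal
        (ENNReal.toReal_pos hε.ne' hεt)
      filter_upwards [Metric.ball_mem_nhds t₀ hδ] with t ht
      refine iSup_le fun x => ?_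
      have := hd (a := (x, t)) (b := (x, t₀)) (by
        rw [Prod.dist_eq]; simpa using ht)
      rw [dist_eq_norm] at this
      rw [← ofReal_norm]
      exact (ENNReal.ofReal_le_ofReal this.le).trans (ENNReal.ofReal_toReal hεt).le
    have hlim2 : Tendsto (fun t => V * ⨆ x, ‖q (x, t) - q (x, t₀)‖ₑ) (𝓝[Icc 0 T] t₀) (𝓝 0) := by
      have := ENNReal.Tendsto.const_mul (a := V)
        (hlim.mono_left (nhdsWithin_le_nhds (s := Icc 0 T)))
        (Or.inr hVt)
      rwa [mul_zero] at this
    refine tendsto_of_tendsto_of_tendsto_of_le_of_le tendsto_const_nhds hlim2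
      (fun _ => zero_le) fun t => ?_
    simp only [add_sub_add_left_eq_sub]
    rw [eLpNorm_eq_lintegral_rpow_enorm_toReal (by simp) (by simp)]
    calc (∫⁻ x in Ω, ‖q (x, t) - q (x, t₀)‖ₑ ^ (2 : ℝ≥0∞).toReal) ^ (1 / (2 : ℝ≥0∞).toReal)
        ≤ (∫⁻ _ in Ω, (⨆ x, ‖q (x, t) - q (x, t₀)‖ₑ) ^ (2 : ℝ≥0∞).toReal) ^
            (1 / (2 : ℝ≥0∞).toReal) := by
          gcongr with x
          exact le_iSup (fun x => ‖q (x, t) - q (x, t₀)‖ₑ) x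
      _ = V * ⨆ x, ‖q (x, t) - q (x, t₀)‖ₑ := by
          rw [lintegral_const, ENNReal.mul_rpow_of_nonneg _ _ (by simp), ← ENNReal.rpow_mul, hV,
            mul_comm]
          simp

theorem memLp_restrict_of_bounded (hΩ : Bornology.IsBounded Ω) {v : SpaceTime N → ℝ}
    (hv : Continuous v) {C : ℝ} (hC : ∀ z, ‖v z‖ ≤ C) (r : ℝ≥0∞) :
    MemLp v r (volume.restrict (spaceTimeDomain Ω T)) :=
  have := isFiniteMeasure_restrict_spaceTimeDomain hΩ T
  MemLp.of_bound hv.aestronglyMeasurable C (Eventually.of_forall hC)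

theorem memLp_fderiv_apply (hΩ : Bornology.IsBounded Ω) (hq : ContDiff ℝ 1 q)
    (hc : HasCompactSupport q) (d : SpaceTime N) (r : ℝ≥0∞) :
    MemLp (fun z => fderiv ℝ q z d) r (volume.restrict (spaceTimeDomain Ω T)) := by
  obtain ⟨C, hC⟩ := (hc.fderiv (𝕜 := ℝ)).exists_bound_of_continuous
    (hq.continuous_fderiv one_ne_zero)
  exact memLp_restrict_of_bounded hΩ (continuous_fderiv_apply_of_contDiff_one hq d)
    (fun z => (ContinuousLinearMap.le_of_opNorm_le _ (hC z) d)) r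

theorem isWeakGrad_const_add (hΩ : Bornology.IsBounded Ω) (hq : ContDiff ℝ 1 q)
    (hc : HasCompactSupport q) (p : Fin N → ℝ) :
    IsWeakGrad Ω T p (fun z => M + q z) (fun i z => fderiv ℝ q z (dirX i)) :=
  fun _ => ⟨memLp_fderiv_apply hΩ hq hc _ _, hasWeakDeriv_const_add hq M _ _⟩

theorem isWeakTimeDeriv_const_add (hΩ : Bornology.IsBounded Ω) (hq : ContDiff ℝ 1 q)
    (hc : HasCompactSupport q) :
    IsWeakTimeDeriv Ω T (fun z => M + q z) (fun z => fderiv ℝ q z (dirT N)) :=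
  ⟨memLp_fderiv_apply hΩ hq hc _ _, hasWeakDeriv_const_add hq M _ _⟩

/-- Since `K_φ` imposes no boundary values, a comparison function may be a constant above the
obstacle away from the cylinder, with a compactly supported perturbation inside it. -/
theorem memK_const_add (hΩ : Bornology.IsBounded Ω) (hΩo : IsOpen Ω) (hq : ContDiff ℝ 1 q)
    (hc : HasCompactSupport q) (p : Fin N → ℝ) {φ : SpaceTime N → ℝ}
    (hφ : ∀ z ∈ spaceTimeDomain Ω T, φ z ≤ M + q z) :
    MemK Ω T p φ (fun z => M + q z) := by
  obtain ⟨C, hC⟩ := hc.exists_bound_of_continuous hq.continuous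
  refine ⟨contL2_const_add hΩ hq.continuous hc, fun _ =>
    memLp_restrict_of_bounded hΩ (continuous_const.add hq.continuous) (C := ‖M‖ + C)
      (fun z => (norm_add_le _ _).trans (by gcongr; exact hC _)) _,
    ⟨_, isWeakGrad_const_add hΩ hq hc p⟩, ?_⟩
  filter_upwards [ae_restrict_mem (hΩo.measurableSet.prod measurableSet_Ioc)] with z hz
  exact hφ z hz

end Comparison

end AnisoObstacle

namespace AnisoObstacle

/-! ### Convergence of integrals, and the flux -/

section IntTendsto

variable {α : Type*} [MeasurableSpace α] {μ : Measure α}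

/-- Eventual integrability together with convergence of the integrals. -/
structure IntTendsto (μ : Measure α) (c : ℕ → α → ℝ) (c' : α → ℝ) : Prop where
  eventually_integrable : ∀ᶠ n in atTop, Integrable (c n) μ
  integrable : Integrable c' μ
  tendsto : Tendsto (fun n => ∫ a, c n a ∂μ) atTop (𝓝 (∫ a, c' a ∂μ))

theorem IntTendsto.add {c d : ℕ → α → ℝ} {c' d' : α → ℝ} (hc : IntTendsto μ c c')
    (hd : IntTendsto μ d d') :
    IntTendsto μ (fun n a => c n a + d n a) (fun a => c' a + d' a) := by
  refine ⟨?_, hc.integrable.add hd.integrable, ?_⟩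
  · filter_upwards [hc.eventually_integrable, hd.eventually_integrable] with n h1 h2
    exact h1.add h2
  · rw [integral_add hc.integrable hd.integrable]
    refine (hc.tendsto.add hd.tendsto).congr' ?_
    filter_upwards [hc.eventually_integrable, hd.eventually_integrable] with n h1 h2
    rw [integral_add h1 h2]

theorem IntTendsto.const {c : α → ℝ} (hc : Integrable c μ) : IntTendsto μ (fun _ => c) c :=
  ⟨Eventually.of_forall fun _ => hc, hc, tendsto_const_nhds⟩

theorem IntTendsto.congr {c d : ℕ → α → ℝ} {c' d' : α → ℝ} (hc : IntTendsto μ c c')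
    (h : ∀ n a, c n a = d n a) (h' : ∀ a, c' a = d' a) : IntTendsto μ d d' := by
  have e1 : c = d := funext fun n => funext (h n)
  have e2 : c' = d' := funext h'
  rwa [← e1, ← e2]

/-- Only eventual integrability can be claimed: the `L¹` norms tend to zero, but the first ones may
be infinite. -/
theorem intTendsto_zero_of_lintegral {c : ℕ → α → ℝ}
    (hm : ∀ n, AEStronglyMeasurable (c n) μ)
    (h : Tendsto (fun n => ∫⁻ a, ‖c n a‖ₑ ∂μ) atTop (𝓝 0)) : IntTendsto μ c (fun _ => 0) := by
  refine ⟨?_, integrable_zero _ _ _, ?_⟩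
  · filter_upwards [h.eventually_lt_const (show (0 : ℝ≥0∞) < 1 by simp)] with n hn
    exact ⟨hm n, hn.trans (by simp)⟩
  · rw [integral_zero, tendsto_zero_iff_enorm_tendsto_zero]
    exact tendsto_of_tendsto_of_tendsto_of_le_of_le tendsto_const_nhds h (fun _ => zero_le)
      fun n => enorm_integral_le_lintegral_enorm _

theorem intTendsto_zero_of_le {c b : ℕ → α → ℝ} {C r : ℝ} (hr : 0 < r)
    (hm : ∀ n, AEStronglyMeasurable (c n) μ)
    (hle : ∀ n, ∀ a, |c n a| ≤ C * |b n a| ^ r) (hC : 0 ≤ C)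
    (h : Tendsto (fun n => ∫⁻ a, ‖b n a‖ₑ ^ r ∂μ) atTop (𝓝 0)) :
    IntTendsto μ c (fun _ => 0) := by
  refine intTendsto_zero_of_lintegral hm ?_
  have h2 := ENNReal.Tendsto.const_mul (a := ENNReal.ofReal C) h (Or.inr ENNReal.ofReal_ne_top)
  rw [mul_zero] at h2
  refine tendsto_of_tendsto_of_tendsto_of_le_of_le tendsto_const_nhds h2 (fun _ => zero_le)
    fun n => ?_
  rw [← lintegral_const_mul' _ _ ENNReal.ofReal_ne_top]
  refine lintegral_mono fun a => ?_
  simp only [Real.enorm_eq_ofReal_abs]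
  rw [ENNReal.ofReal_rpow_of_nonneg (abs_nonneg _) hr.le, ← ENNReal.ofReal_mul hC]
  exact ENNReal.ofReal_le_ofReal (hle n a)

/-- Hölder: a fixed `L^{p'}` factor times a sequence vanishing in `L^p`. -/
theorem intTendsto_zero_of_holder {p q : ℝ} (hpq : p.HolderConjugate q) {g : α → ℝ}
    {c b : ℕ → α → ℝ} (hg : AEMeasurable g μ) (hgq : ∫⁻ a, ‖g a‖ₑ ^ q ∂μ ≠ ⊤)
    (hb : ∀ n, AEMeasurable (b n) μ) (hm : ∀ n, AEStronglyMeasurable (c n) μ)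
    (hle : ∀ n, ∀ a, |c n a| ≤ |b n a| * |g a|)
    (h : Tendsto (fun n => ∫⁻ a, ‖b n a‖ₑ ^ p ∂μ) atTop (𝓝 0)) :
    IntTendsto μ c (fun _ => 0) := by
  refine intTendsto_zero_of_lintegral hm ?_
  have hp := hpq.pos
  have h1 := (ENNReal.continuous_rpow_const (y := 1 / p)).tendsto 0 |>.comp h
  rw [ENNReal.zero_rpow_of_pos (by positivity)] at h1
  have h2 := ENNReal.Tendsto.mul_const (b := (∫⁻ a, ‖g a‖ₑ ^ q ∂μ) ^ (1 / q)) h1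
    (Or.inr (ENNReal.rpow_ne_top_of_nonneg (by have := hpq.symm.pos; positivity) hgq))
  rw [zero_mul] at h2
  refine tendsto_of_tendsto_of_tendsto_of_le_of_le tendsto_const_nhds h2 (fun _ => zero_le)
    fun n => ?_
  refine le_trans (lintegral_mono fun a => ?_)
    (ENNReal.lintegral_mul_le_Lp_mul_Lq μ hpq (hb n).enorm hg.enorm)
  simp only [Pi.mul_apply, Real.enorm_eq_ofReal_abs]
  rw [← ENNReal.ofReal_mul (abs_nonneg _)]
  exact ENNReal.ofReal_le_ofReal (hle n a)

theorem intTendsto_of_dominated {c : ℕ → α → ℝ} {c' B : α → ℝ}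
    (hm : ∀ n, AEStronglyMeasurable (c n) μ) (hB : Integrable B μ)
    (hle : ∀ n a, |c n a| ≤ B a) (h : ∀ᵐ a ∂μ, Tendsto (fun n => c n a) atTop (𝓝 (c' a))) :
    IntTendsto μ c c' := by
  refine ⟨Eventually.of_forall fun n => hB.mono' (hm n) (Eventually.of_forall (hle n)), ?_, ?_⟩
  · refine hB.mono' (aestronglyMeasurable_of_tendsto_ae atTop hm h) ?_
    filter_upwards [h] with a ha
    exact le_of_tendsto' ha.abs fun n => hle n a
  · exact tendsto_integral_of_dominated_convergence B hm hB
      (fun n => Eventually.of_forall (hle n)) h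

end IntTendsto

/-- The nonlinearity `|s|^{p-2} s`. -/
noncomputable def flux (p s : ℝ) : ℝ := |s| ^ (p - 2) * s

theorem abs_flux {p : ℝ} (hp : 2 ≤ p) (s : ℝ) : |flux p s| = |s| ^ (p - 1) := by
  rcases eq_or_ne s 0 with rfl | hs
  · rw [flux, mul_zero, abs_zero, Real.zero_rpow (by linarith)]
  · have : 0 < |s| := abs_pos.2 hs
    rw [flux, abs_mul, abs_of_nonneg (by positivity)]
    nth_rw 2 [← Real.rpow_one |s|]
    rw [← Real.rpow_add this]
    congr 1; ring

theorem flux_mul_self {p : ℝ} (hp : 2 ≤ p) (s : ℝ) : flux p s * s = |s| ^ p := by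
  rcases eq_or_ne s 0 with rfl | hs
  · rw [mul_zero, abs_zero, Real.zero_rpow (by linarith)]
  · have : 0 < |s| := abs_pos.2 hs
    rw [flux, mul_assoc, ← sq, ← sq_abs, ← Real.rpow_two, ← Real.rpow_add this]
    congr 1; ring

theorem measurable_flux (p : ℝ) : Measurable (flux p) := by
  unfold flux
  fun_prop

section Limits

variable {N : ℕ} {U : SpaceTime N → ℝ} {f : ℕ → SpaceTime N → ℝ} {Q : Set (SpaceTime N)}
  {η : SpaceTime N → ℝ} {F F' : ℝ → ℝ} {L B : ℝ}

theorem lintegral_rpow_ne_top_of_memLp {α : Type*} [MeasurableSpace α] {μ : Measure α} {g : α → ℝ}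
    {p : ℝ} (hp : 0 < p) (hg : MemLp g (ENNReal.ofReal p) μ) :
    ∫⁻ a, ‖g a‖ₑ ^ p ∂μ ≠ ⊤ := by
  rw [← eLpNorm_ofReal_rpow hp]
  exact ENNReal.rpow_ne_top_of_nonneg hp.le hg.2.ne

/-- The conjugate exponent satisfies `(p - 1) q = p`, so the flux of an `L^p` function lies in the
dual space. -/
theorem lintegral_flux_ne_top {α : Type*} [MeasurableSpace α] {μ : Measure α} {g : α → ℝ}
    {p q : ℝ} (hp : 2 ≤ p) (hpq : p.HolderConjugate q) (hg : MemLp g (ENNReal.ofReal p) μ) :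
    ∫⁻ a, ‖flux p (g a)‖ₑ ^ q ∂μ ≠ ⊤ := by
  have : ∀ a, ‖flux p (g a)‖ₑ ^ q = ‖g a‖ₑ ^ p := by
    intro a
    rw [Real.enorm_eq_ofReal_abs, abs_flux hp, Real.enorm_eq_ofReal_abs,
      ← ENNReal.ofReal_rpow_of_nonneg (abs_nonneg _) (by linarith), ← ENNReal.rpow_mul]
    congr 1
    exact hpq.sub_one_mul_conj
  simp_rw [this]
  exact lintegral_rpow_ne_top_of_memLp (by linarith) hg

theorem integrable_flux_mul_self {α : Type*} [MeasurableSpace α] {μ : Measure α} {g : α → ℝ}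
    {p : ℝ} (hp : 2 ≤ p) (hg : MemLp g (ENNReal.ofReal p) μ) :
    Integrable (fun a => flux p (g a) * g a) μ := by
  simp_rw [flux_mul_self hp]
  have := hg.integrable_norm_rpow (by simpa using by linarith) ENNReal.ofReal_ne_top
  rwa [ENNReal.toReal_ofReal (by linarith)] at this

theorem locallyIntegrable_of_lintegral_rpow {g : SpaceTime N → ℝ} {q : ℝ} (hq : 1 ≤ q)
    (hm : AEStronglyMeasurable g volume) (hg : ∫⁻ a, ‖g a‖ₑ ^ q ≠ ⊤) :
    LocallyIntegrable g volume := by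
  have : MemLp g (ENNReal.ofReal q) volume := by
    refine ⟨hm, ?_⟩
    rw [eLpNorm_eq_lintegral_rpow_enorm_toReal (by simpa using by linarith) ENNReal.ofReal_ne_top,
      ENNReal.toReal_ofReal (by linarith)]
    exact ENNReal.rpow_lt_top_of_nonneg (by positivity) hg
  exact this.locallyIntegrable (by simpa using hq)

/-- Separate the differences `f n - U` and `df n - G`, whose terms vanish by Hölder. What remains
depends on `f n` only through the bounded functions `F` and `F'`, and converges by domination. -/
theorem diffusion_intTendsto {p : ℝ} (hp : 2 ≤ p) {G : SpaceTime N → ℝ}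
    {df : ℕ → SpaceTime N → ℝ} (hη : IsTestFunction Q η) (d : SpaceTime N)
    (hF : Continuous F) (hF' : Continuous F') (hFB : ∀ s, |F s| ≤ B) (hF0 : ∀ s, 0 ≤ F' s)
    (hFL : ∀ s, F' s ≤ L) {lam : ℝ} (hlam : 0 ≤ lam) (hlamL : lam * L ≤ 1)
    (hU : Measurable U) (hG : Measurable G) (hGp : MemLp G (ENNReal.ofReal p))
    (hf : ∀ n, Continuous (f n)) (hdf : ∀ n, Continuous (df n))
    (hfU : Tendsto (fun n => ∫⁻ z, ‖f n z - U z‖ₑ ^ p) atTop (𝓝 0))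
    (hdfG : Tendsto (fun n => ∫⁻ z, ‖df n z - G z‖ₑ ^ p) atTop (𝓝 0))
    (hae : ∀ᵐ z, Tendsto (fun n => f n z) atTop (𝓝 (U z))) (ε : ℝ) :
    IntTendsto volume
      (fun n z => flux p (G z) * (fderiv ℝ η z d * (f n z - lam * F (f n z) + ε - U z) +
        η z * ((1 - lam * F' (f n z)) * df n z - G z)))
      (fun z => flux p (G z) * (fderiv ℝ η z d * (ε - lam * F (U z)) -
        η z * (lam * F' (U z) * G z))) := by
  obtain ⟨C₁, hC₁⟩ := hη.compact.exists_bound_of_continuous hη.smooth.continuous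
  obtain ⟨C₂, hC₂⟩ := (hη.hasCompactSupport_fderiv_apply d).exists_bound_of_continuous
    (hη.continuous_fderiv_apply d)
  simp only [Real.norm_eq_abs] at hC₁ hC₂
  have hpq : p.HolderConjugate (p.conjExponent) := .conjExponent (by linarith)
  have hmfl : Measurable fun z => flux p (G z) := (measurable_flux p).comp hG
  have hηm := hη.smooth.continuous.measurable
  have hηdm := (hη.continuous_fderiv_apply d).measurable
  have hFm := hF.measurable
  have hF'm := hF'.measurable
  have hfm : ∀ n, Measurable (f n) := fun n => (hf n).measurable
  have hdfm : ∀ n, Measurable (df n) := fun n => (hdf n).measurable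
  have hflt := lintegral_flux_ne_top hp hpq hGp
  have hscale : ∀ C : ℝ, ∫⁻ z, ‖C * flux p (G z)‖ₑ ^ p.conjExponent ≠ ⊤ := by
    intro C
    simp_rw [enorm_mul, ENNReal.mul_rpow_of_nonneg _ _ hpq.symm.nonneg]
    rw [lintegral_const_mul' _ _ (ENNReal.rpow_ne_top_of_nonneg hpq.symm.nonneg (by simp))]
    exact ENNReal.mul_ne_top (ENNReal.rpow_ne_top_of_nonneg hpq.symm.nonneg (by simp)) hflt
  have hfl_loc : LocallyIntegrable (fun z => flux p (G z)) volume :=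
    locallyIntegrable_of_lintegral_rpow hpq.symm.lt.le hmfl.aestronglyMeasurable hflt
  have hint1 : Integrable fun z => flux p (G z) * fderiv ℝ η z d :=
    hfl_loc.integrable_smul_right_of_hasCompactSupport (hη.continuous_fderiv_apply d)
      (hη.hasCompactSupport_fderiv_apply d)
  have hint2 := integrable_flux_mul_self hp hGp
  have hB0 : 0 ≤ B := (abs_nonneg _).trans (hFB 0)
  have hL0 : 0 ≤ L := (hF0 0).trans (hFL 0)
  have t1 : IntTendsto volume
      (fun n z => flux p (G z) * (fderiv ℝ η z d * (f n z - U z))) (fun _ => 0) := by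
    refine intTendsto_zero_of_holder hpq (b := fun n z => f n z - U z)
      (hmfl.const_mul C₂).aemeasurable (hscale C₂)
      (fun n => ((hfm n).sub hU).aemeasurable)
      (fun n => (by fun_prop : Measurable _).aestronglyMeasurable) (fun n z => ?_) hfU
    rw [abs_mul, abs_mul, abs_mul, abs_of_nonneg ((abs_nonneg _).trans (hC₂ 0))]
    have := hC₂ z
    calc _ = |f n z - U z| * (|fderiv ℝ η z d| * |flux p (G z)|) := by ring
      _ ≤ _ := by gcongr
  have t2 : IntTendsto volume
      (fun n z => flux p (G z) * (fderiv ℝ η z d * (ε - lam * F (f n z))))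
      (fun z => flux p (G z) * (fderiv ℝ η z d * (ε - lam * F (U z)))) := by
    refine intTendsto_of_dominated (fun n => (by fun_prop : Measurable _).aestronglyMeasurable)
      (hint1.abs.const_mul (|ε| + lam * B)) (fun n z => ?_) ?_
    · have h1 : |ε - lam * F (f n z)| ≤ |ε| + lam * B := by
        refine (abs_sub _ _).trans ?_
        rw [abs_mul, abs_of_nonneg hlam]
        gcongr
        exact hFB _
      rw [← mul_assoc, abs_mul, mul_comm]
      gcongr
    · filter_upwards [hae] with z hz
      exact ((((hF.tendsto _).comp hz).const_mul lam).const_sub ε).const_mul _ |>.const_mul _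
  have t3 : IntTendsto volume
      (fun n z => flux p (G z) * (η z * ((1 - lam * F' (f n z)) * (df n z - G z))))
      (fun _ => 0) := by
    refine intTendsto_zero_of_holder hpq (b := fun n z => df n z - G z)
      (hmfl.const_mul C₁).aemeasurable (hscale C₁)
      (fun n => ((hdfm n).sub hG).aemeasurable)
      (fun n => (by fun_prop : Measurable _).aestronglyMeasurable) (fun n z => ?_) hdfG
    have h1 : |1 - lam * F' (f n z)| ≤ 1 := by
      have e1 := mul_nonneg hlam (hF0 (f n z))
      have e2 := mul_le_mul_of_nonneg_left (hFL (f n z)) hlam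
      rw [abs_le]; constructor <;> linarith
    have h2 := hC₁ z
    rw [abs_mul, abs_mul, abs_mul, abs_mul, abs_of_nonneg ((abs_nonneg _).trans (hC₁ 0))]
    calc _ = |df n z - G z| * (|η z| * |1 - lam * F' (f n z)| * |flux p (G z)|) := by ring
      _ ≤ |df n z - G z| * (C₁ * 1 * |flux p (G z)|) := by gcongr; exact (abs_nonneg _).trans h2
      _ = _ := by ring
  have t4 : IntTendsto volume
      (fun n z => -(flux p (G z) * (η z * (lam * F' (f n z) * G z))))
      (fun z => -(flux p (G z) * (η z * (lam * F' (U z) * G z)))) := by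
    refine intTendsto_of_dominated (fun n => (by fun_prop : Measurable _).aestronglyMeasurable)
      (hint2.abs.const_mul (C₁ * (lam * L))) (fun n z => ?_) ?_
    · have h2 := hC₁ z
      rw [abs_neg]
      calc |flux p (G z) * (η z * (lam * F' (f n z) * G z))|
          = |η z| * (lam * F' (f n z)) * |flux p (G z) * G z| := by
            rw [show flux p (G z) * (η z * (lam * F' (f n z) * G z)) =
              η z * (lam * F' (f n z)) * (flux p (G z) * G z) by ring, abs_mul, abs_mul,
              abs_of_nonneg (mul_nonneg hlam (hF0 _))]
        _ ≤ C₁ * (lam * L) * |flux p (G z) * G z| := by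
            have h3 := mul_nonneg hlam (hF0 (f n z))
            have h4 := mul_le_mul_of_nonneg_left (hFL (f n z)) hlam
            have h5 := (abs_nonneg _).trans h2
            exact mul_le_mul_of_nonneg_right (mul_le_mul h2 h4 h3 h5) (abs_nonneg _)
    · filter_upwards [hae] with z hz
      exact (((((hF'.tendsto _).comp hz).const_mul lam).mul_const _).const_mul _
        |>.const_mul _).neg
  exact (((t1.add t2).add t3).add t4).congr (fun n z => by ring) (fun z => by ring)

/-- Boundedness of `F` makes `Ψ` Lipschitz, so every term containing a difference vanishes by `L²`
convergence. The last term vanishes by the assumption on the product of `m - U` and `dt`. -/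
theorem time_intTendsto {m dt : ℕ → SpaceTime N → ℝ} {Ψ : ℝ → ℝ} (hη : IsTestFunction Q η)
    (d : SpaceTime N) (hF : Continuous F) (hFB : ∀ s, |F s| ≤ B)
    (hΨ : ∀ s, HasDerivAt Ψ (F s) s) (lam : ℝ)
    (hU : Measurable U) (hUi : Integrable U) (hf : ∀ n, Continuous (f n))
    (hm : ∀ n, Continuous (m n)) (hdt : ∀ n, Continuous (dt n))
    (hfU : Tendsto (fun n => ∫⁻ z, ‖f n z - U z‖ₑ ^ (2 : ℝ)) atTop (𝓝 0))
    (hmdt : Tendsto (fun n => ∫⁻ z, ‖m n z - U z‖ₑ * ‖dt n z‖ₑ) atTop (𝓝 0)) (ε : ℝ) :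
    IntTendsto volume
      (fun n z => fderiv ℝ η z d * (1 / 2 * (U z - f n z) ^ 2 - U z * ε +
        lam * (U z - f n z) * F (f n z) + lam * Ψ (f n z)) +
        η z * (|m n z - U z| * |dt n z|))
      (fun z => fderiv ℝ η z d * (lam * Ψ (U z) - U z * ε)) := by
  obtain ⟨C₁, hC₁⟩ := hη.compact.exists_bound_of_continuous hη.smooth.continuous
  obtain ⟨C₂, hC₂⟩ := (hη.hasCompactSupport_fderiv_apply d).exists_bound_of_continuous
    (hη.continuous_fderiv_apply d)
  simp only [Real.norm_eq_abs] at hC₁ hC₂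
  have hC₁0 := (abs_nonneg _).trans (hC₁ 0)
  have hC₂0 := (abs_nonneg _).trans (hC₂ 0)
  have hηm := hη.smooth.continuous.measurable
  have hηdm := (hη.continuous_fderiv_apply d).measurable
  have hFm := hF.measurable
  have hΨd : Differentiable ℝ Ψ := fun s => (hΨ s).differentiableAt
  have hΨm : Measurable Ψ := hΨd.continuous.measurable
  have hΨL : ∀ a b, |Ψ a - Ψ b| ≤ B * |a - b| := fun a b => by
    have := convex_univ.norm_image_sub_le_of_norm_hasDerivWithin_le (f := Ψ) (C := B)
      (fun s _ => (hΨ s).hasDerivWithinAt) (fun s _ => hFB s) (mem_univ b) (mem_univ a)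
    simpa using this
  have hfm : ∀ n, Measurable (f n) := fun n => (hf n).measurable
  have hmm : ∀ n, Measurable (m n) := fun n => (hm n).measurable
  have hdm : ∀ n, Measurable (dt n) := fun n => (hdt n).measurable
  have h22 : (2 : ℝ).HolderConjugate 2 := by
    rw [Real.holderConjugate_iff]; norm_num
  have hηL : ∀ C : ℝ, ∫⁻ z, ‖C * fderiv ℝ η z d‖ₑ ^ (2 : ℝ) ≠ ⊤ := by
    intro C
    have h1 : MemLp (fun z => C * fderiv ℝ η z d) (ENNReal.ofReal 2) (volume) :=
      (continuous_const.mul (hη.continuous_fderiv_apply d)).memLp_of_hasCompactSupport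
        (hη.hasCompactSupport_fderiv_apply d).mul_left
    exact lintegral_rpow_ne_top_of_memLp two_pos h1
  have hdU : Integrable fun z => fderiv ℝ η z d * U z :=
    hUi.bdd_mul hηdm.aestronglyMeasurable (Eventually.of_forall hC₂)
  have hdΨ : Integrable fun z => fderiv ℝ η z d * Ψ (U z) := by
    have hd1 : Integrable fun z => fderiv ℝ η z d :=
      (hη.continuous_fderiv_apply d).integrable_of_hasCompactSupport
        (hη.hasCompactSupport_fderiv_apply d)
    refine ((hd1.abs.const_mul |Ψ 0|).add (hdU.abs.const_mul B)).mono'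
      (by fun_prop : Measurable _).aestronglyMeasurable (Eventually.of_forall fun z => ?_)
    have h1 : |Ψ (U z)| ≤ |Ψ 0| + B * |U z| := by
      have := hΨL (U z) 0
      rw [sub_zero] at this
      have h3 := abs_sub_abs_le_abs_sub (Ψ (U z)) (Ψ 0)
      linarith
    simp only [Pi.add_apply, Real.norm_eq_abs, abs_mul]
    calc |fderiv ℝ η z d| * |Ψ (U z)| ≤ |fderiv ℝ η z d| * (|Ψ 0| + B * |U z|) := by gcongr
      _ = _ := by ring
  have t1 : IntTendsto volume (fun n z => fderiv ℝ η z d * (1 / 2 * (U z - f n z) ^ 2))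
      (fun _ => 0) := by
    refine intTendsto_zero_of_le two_pos (b := fun n z => f n z - U z) (C := C₂)
      (fun n => (by fun_prop : Measurable _).aestronglyMeasurable) (fun n z => ?_) hC₂0 hfU
    rw [abs_mul, Real.rpow_two, sq_abs, abs_of_nonneg (a := 1 / 2 * (U z - f n z) ^ 2)
      (by positivity)]
    refine mul_le_mul (hC₂ z) ?_ (by positivity) hC₂0
    nlinarith [sq_nonneg (U z - f n z)]
  have t2 : IntTendsto volume
      (fun (_ : ℕ) z => fderiv ℝ η z d * (lam * Ψ (U z) - U z * ε))
      (fun z => fderiv ℝ η z d * (lam * Ψ (U z) - U z * ε)) := by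
    refine IntTendsto.const (((hdΨ.const_mul lam).sub (hdU.const_mul ε)).congr
      (Eventually.of_forall fun z => ?_))
    simp only [Pi.sub_apply]; ring
  have t3 : IntTendsto volume
      (fun n z => fderiv ℝ η z d * (lam * (U z - f n z) * F (f n z))) (fun _ => 0) := by
    refine intTendsto_zero_of_holder h22 (b := fun n z => f n z - U z)
      (hηdm.const_mul (lam * B)).aemeasurable (hηL _)
      (fun n => ((hfm n).sub hU).aemeasurable)
      (fun n => (by fun_prop : Measurable _).aestronglyMeasurable) (fun n z => ?_) hfU
    simp only [abs_mul]
    rw [abs_sub_comm (U z), abs_of_nonneg ((abs_nonneg _).trans (hFB 0))]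
    have := hFB (f n z)
    calc _ = |f n z - U z| * (|lam| * |F (f n z)| * |fderiv ℝ η z d|) := by ring
      _ ≤ _ := by gcongr
  have t4 : IntTendsto volume
      (fun n z => fderiv ℝ η z d * (lam * (Ψ (f n z) - Ψ (U z)))) (fun _ => 0) := by
    refine intTendsto_zero_of_holder h22 (b := fun n z => f n z - U z)
      (hηdm.const_mul (lam * B)).aemeasurable (hηL _)
      (fun n => ((hfm n).sub hU).aemeasurable)
      (fun n => (by fun_prop : Measurable _).aestronglyMeasurable) (fun n z => ?_) hfU
    simp only [abs_mul]
    rw [abs_of_nonneg (a := B) ((abs_nonneg _).trans (hFB 0))]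
    have := hΨL (f n z) (U z)
    calc _ ≤ |fderiv ℝ η z d| * (|lam| * (B * |f n z - U z|)) := by gcongr
      _ = _ := by ring
  have t5 : IntTendsto volume
      (fun n z => η z * (|m n z - U z| * |dt n z|)) (fun _ => 0) := by
    refine intTendsto_zero_of_lintegral
      (fun n => (by fun_prop : Measurable _).aestronglyMeasurable) ?_
    have h2 := ENNReal.Tendsto.const_mul (a := ENNReal.ofReal C₁) hmdt
      (Or.inr ENNReal.ofReal_ne_top)
    rw [mul_zero] at h2
    refine tendsto_of_tendsto_of_tendsto_of_le_of_le tendsto_const_nhds h2 (fun _ => zero_le)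
      fun n => ?_
    rw [← lintegral_const_mul' _ _ ENNReal.ofReal_ne_top]
    refine lintegral_mono fun z => ?_
    rw [enorm_mul, enorm_mul, Real.enorm_abs, Real.enorm_abs]
    gcongr
    rw [Real.enorm_eq_ofReal_abs]
    exact ENNReal.ofReal_le_ofReal (hC₁ z)
  exact ((((t1.add t2).add t3).add t4).add t5).congr (fun n z => by ring) (fun z => by ring)

end Limits

end AnisoObstacle

/-! ### The energy inequality -/

namespace AnisoObstacle

variable {N : ℕ}

theorem integrable_mul_of_locallyIntegrable {w a : SpaceTime N → ℝ}
    (hw : LocallyIntegrable w volume) (ha : Continuous a) (hc : HasCompactSupport a) :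
    Integrable (fun z => a z * w z) volume :=
  integrable_mul_of_locallyIntegrableOn (locallyIntegrableOn_univ.2 hw) ha hc (subset_univ _)

theorem memLp_mul_of_restrict {D : Set (SpaceTime N)} (hD : MeasurableSet D)
    {w a : SpaceTime N → ℝ} {r : ℝ≥0∞} (hw : MemLp w r (volume.restrict D)) (ha : Continuous a)
    (hc : HasCompactSupport a) (hs : ∀ z ∉ D, a z = 0) : MemLp (fun z => a z * w z) r volume := by
  obtain ⟨C, hC⟩ := hc.exists_bound_of_continuous ha
  have h1 : MemLp (fun z => a z * w z) r (volume.restrict D) :=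
    MemLp.of_le_mul hw (ha.aestronglyMeasurable.mul hw.1) (c := C)
      (Eventually.of_forall fun z => by rw [norm_mul]; gcongr; exact hC z)
  have h2 := (memLp_indicator_iff_restrict hD).2 h1
  have h3 : D.indicator (fun z => a z * w z) = fun z => a z * w z :=
    indicator_eq_self.2 fun z hz => by
      by_contra hn
      exact hz (by simp [hs z hn])
  rwa [h3] at h2

/-- In `U v_t`, with `v = f - λ F(f) + ε`, write `U = f - (f - m) - (m - U)`. The part with `f` is
an exact time derivative and is integrated by parts. The part with `f - m` has a favourable sign
because `m - f = h f_t`, and the part with `m - U` is kept as an error. -/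
theorem time_term_le {U f m η : SpaceTime N → ℝ} {Q : Set (SpaceTime N)} {F F' Ψ : ℝ → ℝ}
    {lam L h ε : ℝ} (hη : IsTestFunction Q η) (hη0 : ∀ z, 0 ≤ η z)
    (hF : ∀ s, HasDerivAt F (F' s) s) (hF'c : Continuous F') (hΨ : ∀ s, HasDerivAt Ψ (F s) s)
    (hF0 : ∀ s, 0 ≤ F' s) (hFL : ∀ s, F' s ≤ L) (hlam : 0 ≤ lam) (hlamL : lam * L ≤ 1)
    (hUi : Integrable U) (hU2 : MemLp U 2) (hf : ContDiff ℝ 1 f)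
    (hm : Continuous m) (hh : 0 < h)
    (hft : ∀ z, fderiv ℝ f z (dirT N) = (m z - f z) / h) :
    ∫ z, (fderiv ℝ η z (dirT N) * (1 / 2 * U z ^ 2 - U z * (f z - lam * F (f z) + ε)) -
        η z * U z * ((1 - lam * F' (f z)) * fderiv ℝ f z (dirT N))) ≤
      ∫ z, (fderiv ℝ η z (dirT N) * (1 / 2 * (U z - f z) ^ 2 - U z * ε +
        lam * (U z - f z) * F (f z) + lam * Ψ (f z)) +
        η z * (|m z - U z| * |fderiv ℝ f z (dirT N)|)) := by
  have hFd : Differentiable ℝ F := fun s => (hF s).differentiableAt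
  have hFc : Continuous F := hFd.continuous
  have hfc := hf.continuous
  have hηc := hη.smooth.continuous
  have hdtc := continuous_fderiv_apply_of_contDiff_one hf (dirT N)
  have hdη := hη.continuous_fderiv_apply (dirT N)
  have hdηs := hη.hasCompactSupport_fderiv_apply (dirT N)
  have hU2i : Integrable fun z => U z ^ 2 := hU2.integrable_sq
  -- The primitive of `s (1 - λ F'(s))`, so that `f v_t` is the time derivative of `A(f)`.
  let A : ℝ → ℝ := fun s => s ^ 2 / 2 - lam * (s * F s) + lam * Ψ s
  have hA : ∀ s, HasDerivAt A (s * (1 - lam * F' s)) s := by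
    intro s
    have h1 := (((hasDerivAt_pow 2 s).div_const 2).sub
      (((hasDerivAt_id s).mul (hF s)).const_mul lam)).add ((hΨ s).const_mul lam)
    refine h1.congr_deriv ?_
    simp; ring
  have hA1 : ContDiff ℝ 1 A := by
    rw [contDiff_one_iff_deriv]
    refine ⟨fun s => (hA s).differentiableAt, ?_⟩
    rw [funext fun s => (hA s).deriv]
    fun_prop
  have hAf : ContDiff ℝ 1 fun z => A (f z) := hA1.comp hf
  have hAd : ∀ z, fderiv ℝ (fun z => A (f z)) z (dirT N) =
      f z * (1 - lam * F' (f z)) * fderiv ℝ f z (dirT N) := by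
    intro z
    have := (hA (f z)).comp_hasFDerivAt z (hf.differentiable one_ne_zero z).hasFDerivAt
    rw [show (fun z => A (f z)) = A ∘ f from rfl, this.fderiv]
    simp
  have ibp := integral_mul_fderiv_eq_neg_of_contDiff_one hAf hη (dirT N)
  simp only [hAd] at ibp
  have i1 : Integrable fun z => A (f z) * fderiv ℝ η z (dirT N) :=
    (hAf.continuous.mul hdη).integrable_of_hasCompactSupport hdηs.mul_left
  have i2 : Integrable fun z => f z * (1 - lam * F' (f z)) * fderiv ℝ f z (dirT N) * η z :=
    Continuous.integrable_of_hasCompactSupport (by fun_prop) hη.compact.mul_left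
  have i3 : Integrable fun z => fderiv ℝ η z (dirT N) * U z ^ 2 :=
    integrable_mul_of_locallyIntegrable hU2i.locallyIntegrable hdη hdηs
  have i4 : Integrable fun z => fderiv ℝ η z (dirT N) * (f z - lam * F (f z) + ε) * U z :=
    integrable_mul_of_locallyIntegrable hUi.locallyIntegrable (by fun_prop) hdηs.mul_right
  have i5 : Integrable fun z => η z * |fderiv ℝ f z (dirT N)| * |m z - U z| := by
    have h1 : LocallyIntegrable (fun z => |m z - U z|) :=
      fun z => ((hm.locallyIntegrable.sub hUi.locallyIntegrable) z).norm
    exact integrable_mul_of_locallyIntegrable h1 (by fun_prop) hη.compact.mul_right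
  have i6 : Integrable fun z => η z * ((1 - lam * F' (f z)) * fderiv ℝ f z (dirT N)) * U z :=
    integrable_mul_of_locallyIntegrable hUi.locallyIntegrable (by fun_prop) hη.compact.mul_right
  have i7 : Integrable fun z => fderiv ℝ η z (dirT N) *
      (1 / 2 * U z ^ 2 - U z * (f z - lam * F (f z) + ε)) +
      η z * (|m z - U z| * |fderiv ℝ f z (dirT N)|) := by
    refine (((i3.const_mul (1 / 2)).sub i4).add i5).congr (Eventually.of_forall fun z => ?_)
    simp only [Pi.add_apply, Pi.sub_apply]; ring
  have e1 : ∫ z, (fderiv ℝ η z (dirT N) * (1 / 2 * (U z - f z) ^ 2 - U z * ε +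
        lam * (U z - f z) * F (f z) + lam * Ψ (f z)) +
        η z * (|m z - U z| * |fderiv ℝ f z (dirT N)|)) =
      ∫ z, ((fderiv ℝ η z (dirT N) * (1 / 2 * U z ^ 2 - U z * (f z - lam * F (f z) + ε)) +
        η z * (|m z - U z| * |fderiv ℝ f z (dirT N)|)) -
        f z * (1 - lam * F' (f z)) * fderiv ℝ f z (dirT N) * η z) := by
    rw [integral_sub i7 i2, sub_eq_add_neg, ← ibp, ← integral_add i7 i1]
    refine integral_congr_ae (Eventually.of_forall fun z => ?_)
    simp only [A]; ring
  rw [e1]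
  refine integral_mono ?_ (i7.sub i2) fun z => ?_
  · refine (((i3.const_mul (1 / 2)).sub i4).sub i6).congr (Eventually.of_forall fun z => ?_)
    simp only [Pi.sub_apply]; ring
  · simp only
    set D := fderiv ℝ f z (dirT N)
    set θ := 1 - lam * F' (f z)
    have hθ0 : 0 ≤ θ := by
      have := mul_le_mul_of_nonneg_left (hFL (f z)) hlam
      simp only [θ]; linarith
    have hθ1 : θ ≤ 1 := by
      have := mul_nonneg hlam (hF0 (f z))
      simp only [θ]; linarith
    have hmf : m z - f z = D * h := by
      simp only [D]; rw [hft, div_mul_cancel₀ _ hh.ne']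
    have h1 : 0 ≤ η z * θ * (m z - f z) * D := by
      rw [hmf]
      have : η z * θ * (D * h) * D = η z * θ * h * D ^ 2 := by ring
      rw [this]
      have := hη0 z
      positivity
    have h2 : η z * θ * ((m z - U z) * D) ≤ η z * (|m z - U z| * |D|) := by
      have h3 : (m z - U z) * D ≤ |m z - U z| * |D| := by
        rw [← abs_mul]; exact le_abs_self _
      have h4 : 0 ≤ |m z - U z| * |D| := by positivity
      have h5 := hη0 z
      calc η z * θ * ((m z - U z) * D) ≤ η z * θ * (|m z - U z| * |D|) := by gcongr
        _ ≤ η z * 1 * (|m z - U z| * |D|) := by gcongr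
        _ = _ := by ring
    nlinarith [h1, h2]

/-- The energy inequality for a bounded nondecreasing `C¹` nonlinearity `F` which is nonpositive
at the levels where the obstacle may be active. -/
theorem energy_inequality {Ω : Set (EuclideanSpace ℝ (Fin N))} (hΩ : IsOpen Ω)
    (hΩb : Bornology.IsBounded Ω) {T : ℝ} {p : Fin N → ℝ} (hp : ∀ i, 2 ≤ p i) (hN : 0 < N)
    {φ u : SpaceTime N → ℝ} (hφ : ContinuousOn φ (spaceTimeDomain Ω T))
    (hφb : BddAbove (φ '' spaceTimeDomain Ω T)) (hu : IsLocalWeakSolution Ω T p φ u)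
    {Du : Fin N → SpaceTime N → ℝ} (hDu : IsWeakGrad Ω T p u Du)
    {Q : Set (SpaceTime N)} (hQ : IsOpen Q) (hQΩ : Q ⊆ Ω ×ˢ Ioo 0 T)
    {F F' Ψ : ℝ → ℝ} {L B k : ℝ} (hF : ∀ s, HasDerivAt F (F' s) s) (hF'c : Continuous F')
    (hΨ : ∀ s, HasDerivAt Ψ (F s) s) (hF0 : ∀ s, 0 ≤ F' s) (hFL : ∀ s, F' s ≤ L)
    (hFB : ∀ s, |F s| ≤ B) (hFk : ∀ s ≤ k, F s ≤ 0) (hφk : ∀ z ∈ Q, φ z ≤ k)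
    {η : SpaceTime N → ℝ} (hη : IsTestFunction Q η) (hη0 : ∀ z, 0 ≤ η z) :
    ∑ i, ∫ z, flux (p i) (Du i z) * (fderiv ℝ η z (dirX i) * F (u z) +
        η z * (F' (u z) * Du i z)) ≤
      ∫ z, fderiv ℝ η z (dirT N) * Ψ (u z) := by
  have hFd : Differentiable ℝ F := fun s => (hF s).differentiableAt
  have hFc : Continuous F := hFd.continuous
  have hL0 : 0 ≤ L := (hF0 0).trans (hFL 0)
  have hDm : MeasurableSet (spaceTimeDomain Ω T) := hΩ.measurableSet.prod measurableSet_Ioc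
  have hUo : Ω ×ˢ Ioo 0 T ⊆ spaceTimeDomain Ω T := prod_mono_right Ioo_subset_Ioc_self
  have hQD : Q ⊆ spaceTimeDomain Ω T := hQΩ.trans hUo
  obtain ⟨M, hM⟩ := hφb
  have hM' : ∀ z ∈ spaceTimeDomain Ω T, φ z ≤ M := fun z hz => hM (mem_image_of_mem φ hz)
  -- Nested cut-offs: `ζ = 1` near the support of `η` localizes the comparison function, and `χ = 1`
  -- near the support of `ζ` localizes `u` and `φ` before they are mollified on the whole space.
  obtain ⟨ζ, hζ, hζ0, hζ1, hζK⟩ := exists_testFunction_eq_one hη.compact.isCompact hQ hη.support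
  obtain ⟨χ, hχ, hχ0, hχ1, hχK⟩ := exists_testFunction_eq_one hζ.compact.isCompact hQ hζ.support
  have hζn : ∀ z ∈ tsupport η, ∀ᶠ y in 𝓝 z, ζ y = 1 := fun z hz =>
    (eventually_nhdsSet_iff_forall.1 hζK) z hz
  have hχn : ∀ z ∈ tsupport ζ, ∀ᶠ y in 𝓝 z, χ y = 1 := fun z hz =>
    (eventually_nhdsSet_iff_forall.1 hχK) z hz
  have hKK : tsupport η ⊆ tsupport ζ := fun z hz =>
    subset_tsupport _ (by simp [(hζn z hz).self_of_nhds])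
  have hχ' : IsTestFunction (Ω ×ˢ Ioo 0 T) χ := hχ.mono hQΩ
  have hχoff : ∀ z ∉ spaceTimeDomain Ω T, χ z = 0 := fun z hz =>
    hχ.eq_zero fun h => hz (hQD (hχ.support h))
  have hdχoff : ∀ d, ∀ z ∉ spaceTimeDomain Ω T, fderiv ℝ χ z d = 0 := fun d z hz =>
    hχ.fderiv_eq_zero (fun h => hz (hQD (hχ.support h))) d
  -- The localized function and its weak derivatives, with strongly measurable representatives.
  have hlp : ∀ i, MemLp (fun z => χ z * u z) (ENNReal.ofReal (p i)) volume := fun i =>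
    memLp_mul_of_restrict hDm (hu.memK.memLp i) hχ.smooth.continuous hχ.compact hχoff
  have hgp : ∀ i, MemLp (fun z => χ z * Du i z + fderiv ℝ χ z (dirX i) * u z)
      (ENNReal.ofReal (p i)) volume := fun i =>
    (memLp_mul_of_restrict hDm (hDu i).1 hχ.smooth.continuous hχ.compact hχoff).add
      (memLp_mul_of_restrict hDm (hu.memK.memLp i) (hχ.continuous_fderiv_apply _)
        (hχ.hasCompactSupport_fderiv_apply _) (hdχoff _))
  have hwk : ∀ i, HasWeakDeriv univ (dirX i) (fun z => χ z * u z)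
      (fun z => χ z * Du i z + fderiv ℝ χ z (dirX i) * u z) := fun i => (hDu i).2.cutoff hχ'
  have hrep : ∀ w : SpaceTime N → ℝ, AEStronglyMeasurable w volume →
      (∀ z ∉ tsupport χ, w z = 0) → ∃ w' : SpaceTime N → ℝ, StronglyMeasurable w' ∧
        HasCompactSupport w' ∧ w =ᵐ[volume] w' := by
    intro w hw h0
    refine ⟨(tsupport χ).indicator (hw.mk w),
      hw.stronglyMeasurable_mk.indicator (isClosed_tsupport χ).measurableSet,
      HasCompactSupport.of_support_subset_isCompact hχ.compact support_indicator_subset, ?_⟩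
    filter_upwards [hw.ae_eq_mk] with z hz
    by_cases h : z ∈ tsupport χ
    · simp [h, hz]
    · simp [h, h0 z h]
  let i₀ : Fin N := ⟨0, hN⟩
  obtain ⟨U, hUm, hUc, hUe⟩ := hrep _ (hlp i₀).1 fun z hz => by rw [hχ.eq_zero hz, zero_mul]
  have hG : ∀ i, ∃ G : SpaceTime N → ℝ, StronglyMeasurable G ∧ HasCompactSupport G ∧
      (fun z => χ z * Du i z + fderiv ℝ χ z (dirX i) * u z) =ᵐ[volume] G := fun i =>
    hrep _ (hgp i).1 fun z hz => by
      rw [hχ.eq_zero hz, hχ.fderiv_eq_zero hz, zero_mul, zero_mul, zero_add]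
  choose G hGm hGc hGe using hG
  have hUi : Integrable U := by
    refine Integrable.congr ?_ hUe
    exact integrable_mul_of_locallyIntegrableOn (hDu i₀).2.locInt hχ.smooth.continuous hχ.compact
      hχ'.support
  have hUp : ∀ i, MemLp U (ENNReal.ofReal (p i)) := fun i => (hlp i).ae_eq hUe
  have hGp : ∀ i, MemLp (G i) (ENNReal.ofReal (p i)) := fun i => (hgp i).ae_eq (hGe i)
  have hU2 : MemLp U 2 := by
    have hfin : volume (tsupport χ) ≠ ⊤ := hχ.compact.isCompact.measure_lt_top.ne
    have h1 : MemLp (fun z => χ z * u z) 2 volume := by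
      refine (hlp i₀).mono_exponent_of_measure_support_ne_top
        (s := tsupport χ) (fun z hz => by rw [hχ.eq_zero hz, zero_mul]) hfin ?_
      rw [← ENNReal.ofReal_ofNat]
      exact ENNReal.ofReal_le_ofReal (hp i₀)
    exact h1.ae_eq hUe
  have hGi : ∀ i, Integrable (G i) := fun i => by
    have h1 := (hGp i).locallyIntegrable (by
      rw [← ENNReal.ofReal_one]; exact ENNReal.ofReal_le_ofReal (by linarith [hp i]))
    have h2 := (integrableOn_iff_integrable_of_support_subset (subset_tsupport (G i))).1
      (h1.integrableOn_isCompact (hGc i).isCompact)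
    exact h2
  have hUG : ∀ i, HasWeakDeriv univ (dirX i) U (G i) := fun i => (hwk i).congr_ae hUe (hGe i)
  have hUu : ∀ᵐ z, z ∈ tsupport η → U z = u z := by
    filter_upwards [hUe] with z hz hzK
    rw [← hz, (hχn z (hKK hzK)).self_of_nhds, one_mul]
  have hGDu : ∀ i, ∀ᵐ z, z ∈ tsupport η → G i z = Du i z := fun i => by
    filter_upwards [hGe i] with z hz hzK
    have h1 := hχn z (hKK hzK)
    have h2 : fderiv ℝ χ z = 0 := by
      have : χ =ᶠ[𝓝 z] fun _ => 1 := h1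
      rw [this.fderiv_eq]; simp
    rw [← hz, h1.self_of_nhds, h2]; simp
  -- The localized obstacle.
  have hφc : Continuous fun z => χ z * φ z := by
    rw [continuous_iff_continuousAt]
    intro z
    by_cases hz : z ∈ Q
    · exact hχ.smooth.continuous.continuousAt.mul
        (hφ.continuousAt (mem_of_superset (hQ.mem_nhds hz) hQD))
    · have h1 : χ =ᶠ[𝓝 z] 0 := notMem_tsupport_iff_eventuallyEq.1 fun h => hz (hχ.support h)
      refine (continuousAt_const (y := (0 : ℝ))).congr ?_
      filter_upwards [h1] with y hy
      simp [hy]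
  have hφs : HasCompactSupport fun z => χ z * φ z := hχ.compact.mul_right
  have hφU : ∀ᵐ z, χ z * φ z ≤ U z := by
    have h1 := (ae_restrict_iff' hDm).1 hu.memK.obstacle
    filter_upwards [h1, hUe] with z hz hze
    rw [← hze]
    by_cases hzD : z ∈ spaceTimeDomain Ω T
    · exact mul_le_mul_of_nonneg_left (hz hzD) (hχ0 z)
    · simp [hχoff z hzD]
  obtain ⟨f, m, h, hpos, hfC, hmC, hft, hf2, hfp, hfg, hmt, hae, hobs⟩ :=
    exists_approximation hp hUm hUi hUc hU2 hUp hGm hGi hGc hGp hUG hφc hφs hφU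
  -- Small enough that `s - λ F(s)` is nondecreasing; `L + 1` avoids division by zero when `L = 0`.
  let lam : ℝ := 1 / (L + 1)
  have hlam : 0 < lam := by positivity
  have hlamL : lam * L ≤ 1 := by
    simp only [lam]; rw [one_div, inv_mul_le_iff₀ (by positivity)]; linarith
  have hstep : ∀ s r : ℝ, s ≤ r → s - lam * F s ≤ r - lam * F r := by
    have hmono : Monotone fun s => s - lam * F s := by
      have hd : ∀ s, HasDerivAt (fun s => s - lam * F s) (1 - lam * F' s) s := fun s =>
        (hasDerivAt_id s).sub ((hF s).const_mul lam)
      refine monotone_of_deriv_nonneg (fun s => (hd s).differentiableAt) fun s => ?_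
      rw [(hd s).deriv]
      have := mul_le_mul_of_nonneg_left (hFL s) hlam.le
      linarith
    exact fun s r hsr => hmono hsr
  -- Below `k` the correction has the right sign; above `k`, monotonicity reduces to the value at
  -- `k`. So the corrected function stays above the obstacle.
  have hlow : ∀ s, min s k ≤ s - lam * F s := by
    intro s
    rcases le_total s k with hs | hs
    · have := mul_nonneg hlam.le (neg_nonneg.2 (hFk s hs))
      rw [min_eq_left hs]; linarith
    · have h1 := hstep k s hs
      have := mul_nonneg hlam.le (neg_nonneg.2 (hFk k le_rfl))
      rw [min_eq_right hs]; linarith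
  let X : ℝ → ℝ := fun ε => ∫ z, fderiv ℝ η z (dirT N) * (lam * Ψ (U z) - U z * ε)
  let Y : ℝ → Fin N → ℝ := fun ε i => ∫ z, flux (p i) (G i z) *
    (fderiv ℝ η z (dirX i) * (ε - lam * F (U z)) - η z * (lam * F' (U z) * G i z))
  have hTX : ∀ ε, _ := fun ε => time_intTendsto hη (dirT N) hFc hFB hΨ lam hUm.measurable hUi
    (fun n => (hfC n).continuous) hmC
    (fun n => continuous_fderiv_apply_of_contDiff_one (hfC n) (dirT N)) hf2 hmt ε
  have hTY : ∀ ε i, _ := fun ε i => diffusion_intTendsto (hp i) hη (dirX i) hFc hF'c hFB hF0 hFL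
    hlam.le hlamL hUm.measurable (hGm i).measurable (hGp i) (fun n => (hfC n).continuous)
    (fun n => continuous_fderiv_apply_of_contDiff_one (hfC n) (dirX i)) (hfp i) (hfg i) hae ε
  have hXY : ∀ ε > 0, 0 ≤ X ε + ∑ i, Y ε i := by
    intro ε hε
    refine ge_of_tendsto ((hTX ε).tendsto.add
      (tendsto_finsetSum Finset.univ fun i _ => (hTY ε i).tendsto)) ?_
    filter_upwards [hobs ε hε] with n hn
    -- `M + q` is the convex combination of `M` and the corrected approximant with weight `ζ`, and
    -- both lie above the obstacle on the support of `ζ`.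
    let q : SpaceTime N → ℝ := fun z => ζ z * (f n z - lam * F (f n z) + ε - M)
    have hFC : ContDiff ℝ 1 F := by
      rw [contDiff_one_iff_deriv]
      exact ⟨hFd, by rwa [funext fun s => (hF s).deriv]⟩
    have hqC : ContDiff ℝ 1 q := hζ.contDiff_one.mul
      ((((hfC n).sub (contDiff_const.mul (hFC.comp (hfC n)))).add contDiff_const).sub
        contDiff_const)
    have hqc : HasCompactSupport q := hζ.compact.mul_right
    have hqφ : ∀ z ∈ spaceTimeDomain Ω T, φ z ≤ M + q z := by
      intro z hz
      by_cases hzζ : z ∈ tsupport ζ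
      · have h1 := hn z
        rw [(hχn z hzζ).self_of_nhds, one_mul] at h1
        have h2 := hφk z (hζ.support hzζ)
        have h3 := hlow (f n z)
        have h4 : φ z ≤ f n z - lam * F (f n z) + ε := by
          rcases min_choice (f n z) k with h5 | h5 <;> rw [h5] at h3 <;> linarith
        have h5 := hM' z hz
        have h6 := mul_le_mul_of_nonneg_left h4 (hζ0 z)
        have h7 := mul_le_mul_of_nonneg_left h5 (sub_nonneg.2 (hζ1 z))
        simp only [q]
        linarith
      · simp only [q, hζ.eq_zero hzζ, zero_mul, add_zero]
        exact hM' z hz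
    have hqe : ∀ z ∈ tsupport η, q z = f n z - lam * F (f n z) + ε - M := fun z hz => by
      simp only [q, (hζn z hz).self_of_nhds, one_mul]
    have hqd : ∀ z ∈ tsupport η, ∀ d, fderiv ℝ q z d =
        (1 - lam * F' (f n z)) * fderiv ℝ (f n) z d := by
      intro z hz d
      have h1 : q =ᶠ[𝓝 z] fun z => f n z - lam * F (f n z) + ε - M := by
        filter_upwards [hζn z hz] with y hy
        simp only [q, hy, one_mul]
      have h2 := ((hfC n).differentiable one_ne_zero z).hasFDerivAt
      have h3 := (((h2.sub (((hF (f n z)).comp_hasFDerivAt z h2).const_mul lam)).add_const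
        ε).sub_const M).congr_of_eventuallyEq h1
      rw [h3.fderiv]
      simp; ring
    have hineq := hu.ineq Du hDu _ (memK_const_add hΩb hΩ hqC hqc p hqφ) _
      (isWeakGrad_const_add hΩb hqC hqc p) _ (isWeakTimeDeriv_const_add hΩb hqC hqc) η
      (hη.mono hQΩ) hη0
    refine hineq.trans (add_le_add ?_ (le_of_eq (Finset.sum_congr rfl fun i _ => ?_)))
    · refine le_trans (le_of_eq ?_) (time_term_le (ε := ε) hη hη0 hF hF'c hΨ hF0 hFL hlam.le
        hlamL hUi hU2 (hfC n) (hmC n) (hpos n) (hft n))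
      rw [timeTerm, setIntegral_eq_integral_of_tsupport (hη.support.trans hQD) fun z hz => by
        rw [hη.eq_zero hz, hη.fderiv_eq_zero hz]; simp]
      refine integral_congr_ae ?_
      filter_upwards [hUu] with z hz
      by_cases hzK : z ∈ tsupport η
      · simp only [hqe z hzK, hqd z hzK, hz hzK]; ring
      · simp only [hη.eq_zero hzK, hη.fderiv_eq_zero hzK]; ring
    · rw [setIntegral_eq_integral_of_tsupport (hη.support.trans hQD) fun z hz => by
        rw [hη.eq_zero hz, hη.fderiv_eq_zero hz]; simp]
      refine integral_congr_ae ?_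
      filter_upwards [hUu, hGDu i] with z hz hzG
      by_cases hzK : z ∈ tsupport η
      · simp only [hqe z hzK, hqd z hzK, hz hzK, hzG hzK, flux]; ring
      · simp only [hη.eq_zero hzK, hη.fderiv_eq_zero hzK]; ring
  -- The limits in `n` are affine in `ε`, so `ε → 0` needs no further convergence theorem.
  have hX : ∀ ε, X ε = (1 - ε) * X 0 + ε * X 1 := by
    intro ε
    simp only [X]
    rw [← integral_const_mul, ← integral_const_mul, ← integral_add
      ((hTX 0).integrable.const_mul _) ((hTX 1).integrable.const_mul _)]
    exact integral_congr_ae (Eventually.of_forall fun z => by simp only; ring)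
  have hY : ∀ ε i, Y ε i = (1 - ε) * Y 0 i + ε * Y 1 i := by
    intro ε i
    simp only [Y]
    rw [← integral_const_mul, ← integral_const_mul, ← integral_add
      ((hTY 0 i).integrable.const_mul _) ((hTY 1 i).integrable.const_mul _)]
    exact integral_congr_ae (Eventually.of_forall fun z => by simp only; ring)
  have hXY0 : 0 ≤ X 0 + ∑ i, Y 0 i := by
    have hlim : Tendsto (fun ε => (1 - ε) * (X 0 + ∑ i, Y 0 i) + ε * (X 1 + ∑ i, Y 1 i))
        (𝓝[>] 0) (𝓝 ((1 - 0) * (X 0 + ∑ i, Y 0 i) + 0 * (X 1 + ∑ i, Y 1 i))) := by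
      refine Tendsto.mono_left (Continuous.tendsto ?_ 0) nhdsWithin_le_nhds
      fun_prop
    have := ge_of_tendsto hlim (b := 0) (by
      filter_upwards [self_mem_nhdsWithin] with ε hε
      have h1 := hXY ε hε
      rw [hX ε, Finset.sum_congr rfl fun i _ => hY ε i, Finset.sum_add_distrib,
        ← Finset.mul_sum, ← Finset.mul_sum] at h1
      linarith)
    simpa using this
  have hX0 : X 0 = lam * ∫ z, fderiv ℝ η z (dirT N) * Ψ (u z) := by
    simp only [X]
    rw [← integral_const_mul]
    refine integral_congr_ae ?_
    filter_upwards [hUu] with z hz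
    by_cases hzK : z ∈ tsupport η
    · simp only [hz hzK]; ring
    · simp only [hη.fderiv_eq_zero hzK]; ring
  have hY0 : ∀ i, Y 0 i = -(lam * ∫ z, flux (p i) (Du i z) *
      (fderiv ℝ η z (dirX i) * F (u z) + η z * (F' (u z) * Du i z))) := by
    intro i
    simp only [Y]
    rw [← integral_const_mul, ← integral_neg]
    refine integral_congr_ae ?_
    filter_upwards [hUu, hGDu i] with z hz hzG
    by_cases hzK : z ∈ tsupport η
    · simp only [hz hzK, hzG hzK]; ring
    · simp only [hη.eq_zero hzK, hη.fderiv_eq_zero hzK]; ring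
  rw [hX0, Finset.sum_congr rfl fun i _ => hY0 i, Finset.sum_neg_distrib, ← Finset.mul_sum] at hXY0
  exact le_of_mul_le_mul_left (by linarith) hlam

end AnisoObstacle

/-! ### The logarithmic function and its smooth profile -/

namespace AnisoObstacle

section LogProfile

theorem logGamma_nonneg (H c s : ℝ) : 0 ≤ logGamma H c s := le_max_right _ _

theorem logGamma_of_le {H c s : ℝ} (hH : 0 < H) (hs : s ≤ c) : logGamma H c s = 0 := by
  refine max_eq_right (Real.log_nonpos ?_ ?_)
  · exact div_nonneg hH.le (by linarith)
  · rw [div_le_one (by linarith)]; linarith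

theorem logGamma_of_ge {H c s : ℝ} (hc : 0 < c) (hs : c ≤ s) (hsH : s ≤ H) :
    logGamma H c s = Real.log (H / (H - s + c)) := by
  refine max_eq_left (Real.log_nonneg ?_)
  rw [one_le_div (by linarith)]; linarith

theorem logGamma_le {H c s : ℝ} (hc : 0 < c) (hH : 0 < H) (hsH : s ≤ H) :
    logGamma H c s ≤ |Real.log (H / c)| := by
  rcases le_total s c with h | h
  · rw [logGamma_of_le hH h]; exact abs_nonneg _
  · rw [logGamma_of_ge hc h hsH]
    refine le_trans (Real.log_le_log (by positivity) ?_) (le_abs_self _)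
    gcongr
    linarith

theorem hasDerivAt_log_div {H c s : ℝ} (hH : 0 < H) (hs : s < H + c) :
    HasDerivAt (fun s => Real.log (H / (H - s + c))) (1 / (H - s + c)) s := by
  have ha : H - s + c ≠ 0 := by linarith
  have h1 : HasDerivAt (fun s : ℝ => H - s + c) (-1) s := by
    simpa using ((hasDerivAt_id s).const_sub H).add_const c
  have h2 := (h1.inv ha).const_mul H
  have h3 := h2.log (by simp only [Pi.inv_apply]; positivity)
  simp only [Pi.inv_apply] at h3
  refine (h3.congr_deriv ?_).congr_of_eventuallyEq (Eventually.of_forall fun r => by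
    simp only [div_eq_mul_inv])
  field_simp

theorem deriv_logGamma {H c s : ℝ} (hc : 0 < c) (hs : c < s) (hsH : s ≤ H) :
    deriv (logGamma H c) s = 1 / (H - s + c) := by
  have hH : 0 < H := by linarith
  refine ((hasDerivAt_log_div hH (by linarith)).congr_of_eventuallyEq ?_).deriv
  filter_upwards [Ioo_mem_nhds hs (show s < H + c by linarith)] with r hr
  refine max_eq_left (Real.log_nonneg ?_)
  rw [one_le_div (by linarith [hr.2])]; linarith [hr.1]

/-- A `C¹` approximation from below of the derivative of the squared logarithmic function. -/
theorem exists_log_profile {H c : ℝ} (hc : 0 < c) (hcH : c < H) {ε : ℝ} (hε : 0 < ε) :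
    ∃ (F F' Ψ : ℝ → ℝ) (L B : ℝ), (∀ s, HasDerivAt F (F' s) s) ∧ Continuous F' ∧
      (∀ s, HasDerivAt Ψ (F s) s) ∧ (∀ s, 0 ≤ F' s) ∧ (∀ s, F' s ≤ L) ∧ (∀ s, |F s| ≤ B) ∧
      (∀ s, 0 ≤ F s) ∧ (∀ s ≤ c, F s = 0) ∧ (∀ s, 0 ≤ Ψ s) ∧
      ∀ s ≤ H, F s ≤ 2 * logGamma H c s / (H - s + c) ∧ F s ≤ F' s * (H - s + c) ∧
        Ψ s ≤ logGamma H c s ^ 2 ∧ logGamma H c s ^ 2 ≤ Ψ s + ε := by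
  have hH : 0 < H := hc.trans hcH
  let γ : ℝ → ℝ := fun s => Real.log (H / (H - s + c))
  -- The second derivative of `γ²`.
  let g : ℝ → ℝ := fun s => 2 * (1 + γ s) / (H - s + c) ^ 2
  have ha : ∀ s ∈ Icc c H, 0 < H - s + c := fun s hs => by linarith [hs.2]
  have hγd : ∀ s ∈ Icc c H, HasDerivAt γ (1 / (H - s + c)) s := fun s hs =>
    hasDerivAt_log_div hH (by linarith [hs.2])
  have hγ0 : ∀ s ∈ Icc c H, 0 ≤ γ s := fun s hs => by
    refine Real.log_nonneg ?_
    rw [one_le_div (ha s hs)]; linarith [hs.1]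
  have hγc : γ c = 0 := by simp [γ, hH.ne']
  have hγcont : ContinuousOn γ (Icc c H) := fun s hs => (hγd s hs).continuousAt.continuousWithinAt
  have hgcont : ContinuousOn g (Icc c H) := by
    refine ContinuousOn.div (by fun_prop) (by fun_prop) fun s hs => ?_
    have := ha s hs
    positivity
  have hg0 : ∀ s ∈ Icc c H, 0 ≤ g s := fun s hs => by
    have := hγ0 s hs
    positivity
  obtain ⟨L, hL⟩ := isCompact_Icc.exists_bound_of_continuousOn hgcont
  have hgL : ∀ s ∈ Icc c H, g s ≤ L := fun s hs => (le_abs_self _).trans (hL s hs)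
  have hL0 : 0 ≤ L := (hg0 c ⟨le_rfl, hcH.le⟩).trans (hgL c ⟨le_rfl, hcH.le⟩)
  -- The ramp of width `δ` costs at most `L δ` in `F`, hence at most `(H - c) L δ ≤ ε` in `Ψ`.
  let δ : ℝ := ε / ((H - c) * L + 1)
  have hδ : 0 < δ := div_pos hε (by nlinarith)
  have hδε : (H - c) * (L * δ) ≤ ε := by
    have : (H - c) * (L * δ) = ε * ((H - c) * L / ((H - c) * L + 1)) := by simp only [δ]; ring
    rw [this]
    refine mul_le_of_le_one_right hε.le ?_
    rw [div_le_one (by nlinarith)]; linarith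
  -- The ramp removes the jump of `(Γ²)''` at `c`.
  let χ : ℝ → ℝ := fun s => min 1 (max 0 ((s - c) / δ))
  have hχc : Continuous χ := by fun_prop
  have hχ0 : ∀ s, 0 ≤ χ s := fun s => le_min zero_le_one (le_max_left _ _)
  have hχ1 : ∀ s, χ s ≤ 1 := fun s => min_le_left _ _
  have hχm : Monotone χ := fun s r h => by
    simp only [χ]; gcongr
  have hχz : ∀ s ≤ c, χ s = 0 := fun s hs => by
    have : (s - c) / δ ≤ 0 := div_nonpos_of_nonpos_of_nonneg (by linarith) hδ.le
    simp [χ, max_eq_left this]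
  have hχo : ∀ s, c + δ ≤ s → χ s = 1 := fun s hs => by
    have : 1 ≤ (s - c) / δ := by rw [one_le_div hδ]; linarith
    simp only [χ]
    exact min_eq_left (this.trans (le_max_right _ _))
  -- Clamping by `κ` and the cut-off `τ` beyond `H` keep `F'` continuous with compact support, hence
  -- `F` bounded; neither changes anything on `[c, H]`.
  let κ : ℝ → ℝ := fun s => max c (min s H)
  have hκ : ∀ s, κ s ∈ Icc c H := fun s => ⟨le_max_left _ _, max_le hcH.le (min_le_right _ _)⟩
  have hκe : ∀ s ∈ Icc c H, κ s = s := fun s hs => by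
    simp only [κ]; rw [min_eq_left hs.2, max_eq_right hs.1]
  let τ : ℝ → ℝ := fun s => max 0 (min 1 (H + 1 - s))
  have hτ0 : ∀ s, 0 ≤ τ s := fun s => le_max_left _ _
  have hτ1 : ∀ s, τ s ≤ 1 := fun s => max_le zero_le_one (min_le_left _ _)
  have hτo : ∀ s ≤ H, τ s = 1 := fun s hs => by
    simp only [τ]; rw [min_eq_left (by linarith), max_eq_right zero_le_one]
  let F' : ℝ → ℝ := fun s => χ s * g (κ s) * τ s
  have hF'c : Continuous F' := by
    have h1 : Continuous fun s => g (κ s) := hgcont.comp_continuous (by fun_prop) hκ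
    have h2 : Continuous τ := by fun_prop
    exact (hχc.mul h1).mul h2
  have hF'0 : ∀ s, 0 ≤ F' s := fun s =>
    mul_nonneg (mul_nonneg (hχ0 s) (hg0 _ (hκ s))) (hτ0 s)
  have hF'L : ∀ s, F' s ≤ L := fun s => by
    calc F' s ≤ 1 * L * 1 := by
          have := hg0 _ (hκ s)
          have := hgL _ (hκ s)
          have := hχ1 s
          have := hχ0 s
          have := hτ1 s
          have := hτ0 s
          simp only [F']
          gcongr
      _ = L := by ring
  have hF'z : ∀ s ≤ c, F' s = 0 := fun s hs => by simp [F', hχz s hs]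
  have hF'e : ∀ s ∈ Icc c H, F' s = χ s * g s := fun s hs => by
    simp [F', hκe s hs, hτo s hs.2]
  have hF's : HasCompactSupport F' := by
    refine HasCompactSupport.of_support_subset_isCompact (isCompact_Icc (a := c) (b := H + 1))
      fun s hs => ?_
    by_contra hn
    rw [mem_Icc, not_and_or, not_le, not_le] at hn
    refine hs ?_
    rcases hn with h | h
    · exact hF'z s h.le
    · have : τ s = 0 := by
        simp only [τ]; rw [max_eq_left]; exact (min_le_right _ _).trans (by linarith)
      simp [F', this]
  have hF'i : Integrable F' := hF'c.integrable_of_hasCompactSupport hF's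
  let F : ℝ → ℝ := fun s => ∫ r in c..s, F' r
  have hFd : ∀ s, HasDerivAt F (F' s) s := fun s =>
    intervalIntegral.integral_hasDerivAt_right (hF'c.intervalIntegrable _ _)
      (hF'c.stronglyMeasurableAtFilter _ _) hF'c.continuousAt
  have hFc : Continuous F := continuous_iff_continuousAt.2 fun s => (hFd s).continuousAt
  have hFz : ∀ s ≤ c, F s = 0 := fun s hs => by
    simp only [F]
    rw [intervalIntegral.integral_symm, intervalIntegral.integral_congr (g := fun _ => 0)]
    · simp
    · intro r hr
      rw [uIcc_of_le hs] at hr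
      exact hF'z r hr.2
  have hF0 : ∀ s, 0 ≤ F s := fun s => by
    rcases le_total s c with h | h
    · rw [hFz s h]
    · exact intervalIntegral.integral_nonneg h fun r _ => hF'0 r
  have hFB : ∀ s, |F s| ≤ ∫ r, |F' r| := fun s => by
    have h1 := intervalIntegral.norm_integral_le_integral_norm_uIoc (f := F') (a := c) (b := s)
      (μ := volume)
    exact h1.trans (setIntegral_le_integral hF'i.norm
      (Eventually.of_forall fun r => norm_nonneg _))
  let Ψ : ℝ → ℝ := fun s => ∫ r in c..s, F r
  have hΨd : ∀ s, HasDerivAt Ψ (F s) s := fun s =>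
    intervalIntegral.integral_hasDerivAt_right (hFc.intervalIntegrable _ _)
      (hFc.stronglyMeasurableAtFilter _ _) hFc.continuousAt
  have hΨz : ∀ s ≤ c, Ψ s = 0 := fun s hs => by
    simp only [Ψ]
    rw [intervalIntegral.integral_symm, intervalIntegral.integral_congr (g := fun _ => 0)]
    · simp
    · intro r hr
      rw [uIcc_of_le hs] at hr
      exact hFz r hr.2
  let P : ℝ → ℝ := fun s => 2 * γ s / (H - s + c)
  have hPd : ∀ s ∈ Icc c H, HasDerivAt P (g s) s := fun s hs => by
    have h1 : HasDerivAt (fun s : ℝ => H - s + c) (-1) s := by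
      simpa using ((hasDerivAt_id s).const_sub H).add_const c
    have h2 := ((hγd s hs).const_mul 2).div h1 (ha s hs).ne'
    refine h2.congr_deriv ?_
    have := (ha s hs).ne'
    simp only [g]
    field_simp
    ring
  have hPcont : ContinuousOn P (Icc c H) := fun s hs =>
    (hPd s hs).continuousAt.continuousWithinAt
  have hsub : ∀ s ∈ Icc c H, Icc c s ⊆ Icc c H := fun s hs => Icc_subset_Icc_right hs.2
  have hgint : ∀ s ∈ Icc c H, IntervalIntegrable g volume c s := fun s hs => by
    refine ContinuousOn.intervalIntegrable ?_
    rw [uIcc_of_le hs.1]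
    exact hgcont.mono (hsub s hs)
  have hPint : ∀ s ∈ Icc c H, IntervalIntegrable P volume c s := fun s hs => by
    refine ContinuousOn.intervalIntegrable ?_
    rw [uIcc_of_le hs.1]
    exact hPcont.mono (hsub s hs)
  have hPI : ∀ s ∈ Icc c H, ∫ r in c..s, g r = P s := fun s hs => by
    rw [intervalIntegral.integral_eq_sub_of_hasDerivAt (f := P) (fun r hr => ?_) (hgint s hs)]
    · simp [P, hγc]
    · rw [uIcc_of_le hs.1] at hr
      exact hPd r (hsub s hs hr)
  have hγI : ∀ s ∈ Icc c H, ∫ r in c..s, P r = γ s ^ 2 := fun s hs => by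
    rw [intervalIntegral.integral_eq_sub_of_hasDerivAt (f := fun s => γ s ^ 2) (fun r hr => ?_)
      (hPint s hs)]
    · simp [hγc]
    · rw [uIcc_of_le hs.1] at hr
      refine ((hγd r (hsub s hs hr)).pow 2).congr_deriv ?_
      simp only [P]; ring
  -- As `χ` is nondecreasing, `∫ χ g ≤ χ(s) ∫ g`. Retaining the factor `χ(s)` lets `F ≤ F' (H - s +
  -- c)` survive the ramp.
  have hFχ : ∀ s ∈ Icc c H, F s ≤ χ s * P s := fun s hs => by
    rw [← hPI s hs, ← intervalIntegral.integral_const_mul]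
    refine intervalIntegral.integral_mono_on hs.1 (hF'c.intervalIntegrable _ _)
      ((hgint s hs).const_mul _) fun r hr => ?_
    rw [hF'e r (hsub s hs hr)]
    exact mul_le_mul_of_nonneg_right (hχm hr.2) (hg0 r (hsub s hs hr))
  have hP0 : ∀ s ∈ Icc c H, 0 ≤ P s := fun s hs => by
    have := hγ0 s hs
    have := ha s hs
    positivity
  have hFP : ∀ s ∈ Icc c H, F s ≤ P s := fun s hs =>
    (hFχ s hs).trans (mul_le_of_le_one_left (hP0 s hs) (hχ1 s))
  have hPF : ∀ s ∈ Icc c H, P s - F s ≤ L * δ := fun s hs => by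
    have h1χ : Continuous fun r => 1 - χ r := by fun_prop
    have e1 : P s - F s ≤ ∫ r in c..s, L * (1 - χ r) := by
      rw [← hPI s hs, ← intervalIntegral.integral_sub (hgint s hs) (hF'c.intervalIntegrable _ _)]
      refine intervalIntegral.integral_mono_on hs.1
        ((hgint s hs).sub (hF'c.intervalIntegrable _ _))
        ((h1χ.intervalIntegrable _ _).const_mul _) fun r hr => ?_
      have hr' := hsub s hs hr
      rw [hF'e r hr']
      have := mul_le_mul_of_nonneg_right (hgL r hr') (sub_nonneg.2 (hχ1 r))
      linarith
    have e2 : ∫ r in c..s, (1 - χ r) ≤ δ := by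
      have e3 : ∫ r in c..s, (1 - χ r) ≤ ∫ r in c..(max s (c + δ)), (1 - χ r) :=
        intervalIntegral.integral_mono_interval le_rfl hs.1 (le_max_left _ _)
          (Eventually.of_forall fun r => sub_nonneg.2 (hχ1 r)) (h1χ.intervalIntegrable _ _)
      have e4 := intervalIntegral.integral_add_adjacent_intervals
        (h1χ.intervalIntegrable (μ := volume) c (c + δ))
        (h1χ.intervalIntegrable (c + δ) (max s (c + δ)))
      have e5 : ∫ r in (c + δ)..(max s (c + δ)), (1 - χ r) = 0 := by
        rw [intervalIntegral.integral_congr (g := fun _ => 0)]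
        · simp
        · intro r hr
          rw [uIcc_of_le (le_max_right _ _)] at hr
          simp [hχo r hr.1]
      have e6 : ∫ r in c..(c + δ), (1 - χ r) ≤ ∫ _ in c..(c + δ), (1 : ℝ) :=
        intervalIntegral.integral_mono_on (by linarith) (h1χ.intervalIntegrable _ _)
          (by simp) fun r _ => by linarith [hχ0 r]
      rw [intervalIntegral.integral_const] at e6
      simp only [add_sub_cancel_left, smul_eq_mul, mul_one] at e6
      linarith
    rw [intervalIntegral.integral_const_mul] at e1
    exact e1.trans (mul_le_mul_of_nonneg_left e2 hL0)
  refine ⟨F, F', Ψ, L, ∫ r, |F' r|, hFd, hF'c, hΨd, hF'0, hF'L, hFB, hF0,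
    hFz, fun s => ?_, fun s hsH => ?_⟩
  · rcases le_total s c with h | h
    · rw [hΨz s h]
    · exact intervalIntegral.integral_nonneg h fun r _ => hF0 r
  rcases le_total s c with h | h
  · rw [hFz s h, hF'z s h, hΨz s h, logGamma_of_le hH h]
    simp [hε.le]
  · have hs : s ∈ Icc c H := ⟨h, hsH⟩
    have hlg : logGamma H c s = γ s := logGamma_of_ge hc h hsH
    rw [hlg]
    refine ⟨hFP s hs, ?_, ?_, ?_⟩
    · refine (hFχ s hs).trans ?_
      rw [hF'e s hs, mul_assoc]
      refine mul_le_mul_of_nonneg_left ?_ (hχ0 s)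
      have h1 : g s * (H - s + c) = 2 * (1 + γ s) / (H - s + c) := by
        have := (ha s hs).ne'
        simp only [g]; field_simp
      rw [h1]
      have := ha s hs
      simp only [P]
      gcongr
      linarith
    · rw [← hγI s hs]
      exact intervalIntegral.integral_mono_on h (hFc.intervalIntegrable _ _) (hPint s hs)
        fun r hr => hFP r (hsub s hs hr)
    · have e1 : γ s ^ 2 - Ψ s ≤ ∫ _ in c..s, L * δ := by
        rw [← hγI s hs, ← intervalIntegral.integral_sub (hPint s hs) (hFc.intervalIntegrable _ _)]
        exact intervalIntegral.integral_mono_on h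
          ((hPint s hs).sub (hFc.intervalIntegrable _ _)) (by simp)
          fun r hr => hPF r (hsub s hs hr)
      rw [intervalIntegral.integral_const, smul_eq_mul] at e1
      have e2 : (s - c) * (L * δ) ≤ (H - c) * (L * δ) := by gcongr
      linarith

end LogProfile

/-! ### Spatial cut-off with a universal gradient constant -/

section Cutoff

theorem exists_bound_deriv_smoothTransition :
    ∃ K : ℝ, 0 < K ∧ ∀ s, |deriv Real.smoothTransition s| ≤ K := by
  have hc : Continuous (deriv Real.smoothTransition) :=
    (Real.smoothTransition.contDiff (n := 1)).continuous_deriv le_rfl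
  obtain ⟨K, hK⟩ := (isCompact_Icc (a := (0 : ℝ)) (b := 1)).exists_bound_of_continuousOn
    hc.continuousOn
  refine ⟨|K| + 1, by positivity, fun s => ?_⟩
  by_cases hs : s ∈ Icc (0 : ℝ) 1
  · have := hK s hs
    rw [Real.norm_eq_abs] at this
    linarith [le_abs_self K]
  · have : deriv Real.smoothTransition s = 0 := by
      rw [mem_Icc, not_and_or, not_le, not_le] at hs
      rcases hs with h | h
      · exact IsLocalMin.deriv_eq_zero (Eventually.of_forall fun r => by
          rw [Real.smoothTransition.zero_of_nonpos h.le]; exact Real.smoothTransition.nonneg r)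
      · exact IsLocalMax.deriv_eq_zero (Eventually.of_forall fun r => by
          rw [Real.smoothTransition.one_of_one_le h.le]; exact Real.smoothTransition.le_one r)
    rw [this, abs_zero]; positivity

/-- Compose the one-variable smooth transition with a quadratic function of the distance, which is
smooth at the centre as well. The constant depends only on the transition function, not on the
radii. -/
theorem exists_ball_cutoff : ∃ K : ℝ, 0 < K ∧ ∀ {V : Type} [NormedAddCommGroup V]
    [InnerProductSpace ℝ V] [ProperSpace V] (x₀ : V) (ρ₁ ρ₂ : ℝ), 0 < ρ₂ → ρ₂ < ρ₁ →
    ∃ ζ : V → ℝ, ContDiff ℝ ∞ ζ ∧ HasCompactSupport ζ ∧ tsupport ζ ⊆ Metric.ball x₀ ρ₁ ∧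
      (∀ x, 0 ≤ ζ x) ∧ (∀ x, ζ x ≤ 1) ∧ (∀ x ∈ Metric.ball x₀ ρ₂, ζ x = 1) ∧
      ∀ x e, ‖e‖ = 1 → |fderiv ℝ ζ x e| ≤ K / (ρ₁ - ρ₂) := by
  obtain ⟨K, hK0, hK⟩ := exists_bound_deriv_smoothTransition
  refine ⟨4 * K, by positivity, fun {V} _ _ _ x₀ ρ₁ ρ₂ h0 h12 => ?_⟩
  -- Stopping at the midpoint keeps the closed support inside the open ball.
  let r : ℝ := (ρ₁ + ρ₂) / 2
  have hr : ρ₂ < r := by simp only [r]; linarith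
  have hr1 : r < ρ₁ := by simp only [r]; linarith
  have hr0 : 0 < r := h0.trans hr
  let D : ℝ := r ^ 2 - ρ₂ ^ 2
  have hD : 0 < D := by simp only [D]; nlinarith
  let b : V → ℝ := fun x => (r ^ 2 - ‖x - x₀‖ ^ 2) / D
  let ζ : V → ℝ := fun x => Real.smoothTransition (b x)
  have hb : ContDiff ℝ ∞ b :=
    (contDiff_const.sub ((contDiff_id.sub contDiff_const).norm_sq ℝ)).div_const _
  have hζ : ContDiff ℝ ∞ ζ := (Real.smoothTransition.contDiff (n := ⊤)).comp hb
  have hz : ∀ x, r ≤ ‖x - x₀‖ → b x ≤ 0 := fun x hx => by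
    refine div_nonpos_of_nonpos_of_nonneg ?_ hD.le
    have := pow_le_pow_left₀ hr0.le hx 2
    linarith
  have hsub : Function.support ζ ⊆ Metric.closedBall x₀ r := fun x hx => by
    by_contra hn
    rw [Metric.mem_closedBall, dist_eq_norm, not_le] at hn
    exact hx (Real.smoothTransition.zero_of_nonpos (hz x hn.le))
  refine ⟨ζ, hζ, HasCompactSupport.of_support_subset_isCompact (isCompact_closedBall x₀ r) hsub,
    (closure_minimal hsub Metric.isClosed_closedBall).trans
      (Metric.closedBall_subset_ball hr1),
    fun x => Real.smoothTransition.nonneg _, fun x => Real.smoothTransition.le_one _,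
    fun x hx => ?_, fun x e he => ?_⟩
  · refine Real.smoothTransition.one_of_one_le ?_
    rw [Metric.mem_ball, dist_eq_norm] at hx
    rw [one_le_div hD]
    have := pow_le_pow_left₀ (norm_nonneg _) hx.le 2
    simp only [D]; linarith
  · have hbd : HasFDerivAt b (D⁻¹ • -((2 : ℝ) • (innerSL ℝ (x - x₀) : V →L[ℝ] ℝ))) x := by
      have h1 := ((hasFDerivAt_id x).sub_const x₀).norm_sq
      have h2 := (h1.const_sub (r ^ 2)).const_mul D⁻¹
      refine (h2.congr_of_eventuallyEq (Eventually.of_forall fun y => ?_)).congr_fderiv ?_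
      · simp only [b, id]; ring
      · ext v; simp
    have hS : HasDerivAt Real.smoothTransition (deriv Real.smoothTransition (b x)) (b x) :=
      ((Real.smoothTransition.contDiff (n := 1)).differentiable one_ne_zero _).hasDerivAt
    have h3 := hS.comp_hasFDerivAt x hbd
    rw [show ζ = Real.smoothTransition ∘ b from rfl, h3.fderiv]
    have h4 : (deriv Real.smoothTransition (b x) • (D⁻¹ • -((2 : ℝ) • (innerSL ℝ (x - x₀) : V →L[ℝ] ℝ)))) e =
        -(deriv Real.smoothTransition (b x) * (D⁻¹ * (2 * inner ℝ (x - x₀) e))) := by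
      simp [inner_sub_left]
    rw [h4, abs_neg]
    -- Outside radius `r` the transition is at its minimum, so its derivative is zero; inside, the
    -- gradient of `b` is at most `2 r / D`, with `D = (ρ₁ - ρ₂) / 2 * (r + ρ₂)`.
    rcases le_total r ‖x - x₀‖ with h | h
    · have : deriv Real.smoothTransition (b x) = 0 :=
        IsLocalMin.deriv_eq_zero (Eventually.of_forall fun r => by
          rw [Real.smoothTransition.zero_of_nonpos (hz x h)]
          exact Real.smoothTransition.nonneg r)
      rw [this, zero_mul, abs_zero]
      have := sub_pos.2 h12
      positivity
    · have h5 : |inner ℝ (x - x₀) e| ≤ r := by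
        refine (abs_real_inner_le_norm _ _).trans ?_
        rw [he, mul_one]; exact h
      rw [abs_mul, abs_mul, abs_mul, abs_inv, abs_of_pos hD, abs_two]
      calc |deriv Real.smoothTransition (b x)| * (D⁻¹ * (2 * |inner ℝ (x - x₀) e|))
          ≤ K * (D⁻¹ * (2 * r)) := by
            gcongr
            exact hK _
        _ ≤ 4 * K / (ρ₁ - ρ₂) := by
            have hρ := sub_pos.2 h12
            rw [inv_mul_eq_div, mul_div_assoc', div_le_div_iff₀ hD hρ]
            have : D = (ρ₁ - ρ₂) / 2 * (r + ρ₂) := by simp only [D, r]; ring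
            rw [this]
            have : 0 ≤ K * (ρ₁ - ρ₂) * ρ₂ := by positivity
            nlinarith

end Cutoff

/-! ### Growth of a function from its distributional derivative -/

section TimeLocalization

/-- The derivative of the rescaled transition is a nonnegative weight of mass one on `[s, s + δ]`,
so the integral is an average of `y`. -/
theorem integral_deriv_smoothTransition_mul_bounds {y : ℝ → ℝ} {s δ A B : ℝ} (hδ : 0 < δ)
    (hy : ContinuousOn y (Icc s (s + δ))) (hA : ∀ r ∈ Icc s (s + δ), A ≤ y r)
    (hB : ∀ r ∈ Icc s (s + δ), y r ≤ B) :
    Integrable (fun r => deriv (fun r => Real.smoothTransition ((r - s) / δ)) r * y r) ∧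
    A ≤ ∫ r, deriv (fun r => Real.smoothTransition ((r - s) / δ)) r * y r ∧
    ∫ r, deriv (fun r => Real.smoothTransition ((r - s) / δ)) r * y r ≤ B := by
  set S : ℝ → ℝ := fun r => Real.smoothTransition ((r - s) / δ) with hS
  have hSC : ContDiff ℝ 1 S := (Real.smoothTransition.contDiff (n := 1)).comp
    ((contDiff_id.sub contDiff_const).div_const _)
  have hS' : Continuous (deriv S) := hSC.continuous_deriv le_rfl
  have hmono : Monotone S := fun a b hab => Real.smoothTransition.monotone (by gcongr)
  have hS0 : ∀ r, 0 ≤ deriv S r := fun r => hmono.deriv_nonneg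
  have hoff : ∀ r ∉ Icc s (s + δ), deriv S r = 0 := fun r hr => by
    rw [mem_Icc, not_and_or, not_le, not_le] at hr
    rcases hr with h | h
    · refine IsLocalMin.deriv_eq_zero (Eventually.of_forall fun t => ?_)
      have : S r = 0 := Real.smoothTransition.zero_of_nonpos
        (div_nonpos_of_nonpos_of_nonneg (by linarith) hδ.le)
      rw [this]; exact Real.smoothTransition.nonneg _
    · refine IsLocalMax.deriv_eq_zero (Eventually.of_forall fun t => ?_)
      have : S r = 1 := Real.smoothTransition.one_of_one_le
        (by rw [one_le_div hδ]; linarith)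
      rw [this]; exact Real.smoothTransition.le_one _
  have hint : ∫ r in Icc s (s + δ), deriv S r = 1 := by
    rw [integral_Icc_eq_integral_Ioc, ← intervalIntegral.integral_of_le (by linarith),
      intervalIntegral.integral_deriv_eq_sub (fun r _ => hSC.differentiable one_ne_zero r)
        (hS'.intervalIntegrable _ _)]
    simp [hS, hδ.ne']
  have hyi : IntegrableOn (fun r => deriv S r * y r) (Icc s (s + δ)) :=
    (hS'.continuousOn.mul hy).integrableOn_compact isCompact_Icc
  have hS'i : IntegrableOn (deriv S) (Icc s (s + δ)) :=
    hS'.continuousOn.integrableOn_compact isCompact_Icc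
  have heq : ∫ r, deriv S r * y r = ∫ r in Icc s (s + δ), deriv S r * y r :=
    (setIntegral_eq_integral_of_forall_compl_eq_zero fun r hr => by
      rw [hoff r hr, zero_mul]).symm
  refine ⟨(integrableOn_iff_integrable_of_support_subset fun r hr => ?_).1 hyi, ?_, ?_⟩
  · by_contra hn
    exact hr (by simp only [hoff r hn, zero_mul])
  · rw [heq]
    calc A = ∫ r in Icc s (s + δ), deriv S r * A := by rw [integral_mul_const, hint, one_mul]
      _ ≤ _ := setIntegral_mono_on (hS'i.mul_const A) hyi measurableSet_Icc fun r hr =>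
        mul_le_mul_of_nonneg_left (hA r hr) (hS0 r)
  · rw [heq]
    calc ∫ r in Icc s (s + δ), deriv S r * y r ≤ ∫ r in Icc s (s + δ), deriv S r * B :=
        setIntegral_mono_on hyi (hS'i.mul_const B) measurableSet_Icc fun r hr =>
          mul_le_mul_of_nonneg_left (hB r hr) (hS0 r)
      _ = B := by rw [integral_mul_const, hint, one_mul]

/-- A continuous function whose distributional derivative is bounded in mass by `R` from above
grows by at most `R`. -/
theorem le_add_of_forall_testFunction {y : ℝ → ℝ} {t₁ t₂ R : ℝ}
    (hy : ContinuousOn y (Icc t₁ t₂))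
    (h : ∀ θ : ℝ → ℝ, ContDiff ℝ ∞ θ → HasCompactSupport θ → tsupport θ ⊆ Ioo t₁ t₂ →
      (∀ r, 0 ≤ θ r) → (∀ r, θ r ≤ 1) → -R ≤ ∫ r, deriv θ r * y r)
    {t : ℝ} (ht : t ∈ Ioo t₁ t₂) : y t ≤ y t₁ + R := by
  -- Test functions must be supported in the open interval; the left endpoint is reached afterwards
  -- by continuity.
  have key : ∀ s ∈ Ioo t₁ t, y t ≤ y s + R := by
    intro s hs
    refine le_of_forall_pos_le_add fun τ hτ => ?_
    have hcont : ∀ a ∈ Ioo t₁ t₂, ∀ᶠ r in 𝓝 a, |y r - y a| < τ / 2 := fun a ha => by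
      have := (hy.continuousAt (Icc_mem_nhds ha.1 ha.2)).tendsto
      have := (Metric.tendsto_nhds.1 this) (τ / 2) (by positivity)
      simpa [Real.dist_eq] using this
    have hs2 : s ∈ Ioo t₁ t₂ := ⟨hs.1, hs.2.trans ht.2⟩
    obtain ⟨d₁, hd₁, hb₁⟩ := Metric.eventually_nhds_iff.1 (hcont s hs2)
    obtain ⟨d₂, hd₂, hb₂⟩ := Metric.eventually_nhds_iff.1 (hcont t ht)
    let δ : ℝ := min (min d₁ d₂) (t₂ - t) / 2
    have hm : 0 < min (min d₁ d₂) (t₂ - t) := lt_min (lt_min hd₁ hd₂) (sub_pos.2 ht.2)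
    have hδ : 0 < δ := half_pos hm
    have hδ' : δ < min (min d₁ d₂) (t₂ - t) := half_lt_self hm
    have hδ1 : δ < d₁ := hδ'.trans_le ((min_le_left _ _).trans (min_le_left _ _))
    have hδ2 : δ < d₂ := hδ'.trans_le ((min_le_left _ _).trans (min_le_right _ _))
    have hδ3 : δ < t₂ - t := hδ'.trans_le (min_le_right _ _)
    have hbd : ∀ a d, δ < d → (∀ ⦃r⦄, dist r a < d → |y r - y a| < τ / 2) →
        ∀ r ∈ Icc a (a + δ), |y r - y a| < τ / 2 := fun a d hd hb r hr => by
      refine hb ?_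
      rw [Real.dist_eq, abs_of_nonneg (by linarith [hr.1])]
      linarith [hr.2]
    have hbs := hbd s d₁ hδ1 hb₁
    have hbt := hbd t d₂ hδ2 hb₂
    obtain ⟨i1, -, u1⟩ := integral_deriv_smoothTransition_mul_bounds (A := y s - τ / 2)
      (B := y s + τ / 2) hδ
      (hy.mono (Icc_subset_Icc hs2.1.le (by linarith [hs.2])))
      (fun r hr => by linarith [(abs_lt.1 (hbs r hr)).1])
      (fun r hr => by linarith [(abs_lt.1 (hbs r hr)).2])
    obtain ⟨i2, l2, -⟩ := integral_deriv_smoothTransition_mul_bounds (A := y t - τ / 2)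
      (B := y t + τ / 2) hδ
      (hy.mono (Icc_subset_Icc ht.1.le (by linarith)))
      (fun r hr => by linarith [(abs_lt.1 (hbt r hr)).1])
      (fun r hr => by linarith [(abs_lt.1 (hbt r hr)).2])
    let S : ℝ → ℝ → ℝ := fun a r => Real.smoothTransition ((r - a) / δ)
    have hSC : ∀ a, ContDiff ℝ ∞ (S a) := fun a =>
      (Real.smoothTransition.contDiff (n := ⊤)).comp ((contDiff_id.sub contDiff_const).div_const _)
    -- A smoothed indicator of `[s, t]`: its derivative averages `y` near `s` minus `y` near `t`.
    let θ : ℝ → ℝ := fun r => S s r - S t r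
    have hsupp : Function.support θ ⊆ Icc s (t + δ) := fun r hr => by
      by_contra hn
      rw [mem_Icc, not_and_or, not_le, not_le] at hn
      refine hr ?_
      rcases hn with h1 | h1
      · have e1 : S s r = 0 := Real.smoothTransition.zero_of_nonpos
          (div_nonpos_of_nonpos_of_nonneg (by linarith) hδ.le)
        have e2 : S t r = 0 := Real.smoothTransition.zero_of_nonpos
          (div_nonpos_of_nonpos_of_nonneg (by linarith [hs.2]) hδ.le)
        simp [θ, e1, e2]
      · have e1 : S s r = 1 := Real.smoothTransition.one_of_one_le
          (by rw [one_le_div hδ]; linarith [hs.2])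
        have e2 : S t r = 1 := Real.smoothTransition.one_of_one_le
          (by rw [one_le_div hδ]; linarith)
        simp [θ, e1, e2]
    have := h θ ((hSC s).sub (hSC t))
      (HasCompactSupport.of_support_subset_isCompact isCompact_Icc hsupp)
      ((closure_minimal hsupp isClosed_Icc).trans fun r hr =>
        ⟨hs.1.trans_le hr.1, by linarith [hr.2]⟩)
      (fun r => sub_nonneg.2 (Real.smoothTransition.monotone (by gcongr; exact hs.2.le)))
      (fun r => by
        have e1 : S s r ≤ 1 := Real.smoothTransition.le_one _
        have e2 : 0 ≤ S t r := Real.smoothTransition.nonneg _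
        simp only [θ]; linarith)
    have e : ∫ r, deriv θ r * y r = (∫ r, deriv (S s) r * y r) - ∫ r, deriv (S t) r * y r := by
      rw [← integral_sub i1 i2]
      refine integral_congr_ae (Eventually.of_forall fun r => ?_)
      have : deriv θ r = deriv (S s) r - deriv (S t) r :=
        deriv_fun_sub ((hSC s).differentiable (by simp) r) ((hSC t).differentiable (by simp) r)
      simp only [this, S]; ring
    rw [e] at this
    linarith
  have hlim : Tendsto y (𝓝[Ioo t₁ t] t₁) (𝓝 (y t₁)) :=
    (hy t₁ ⟨le_rfl, (ht.1.trans ht.2).le⟩).mono (fun r hr => ⟨hr.1.le, (hr.2.trans ht.2).le⟩)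
  have hne : (𝓝[Ioo t₁ t] t₁).NeBot := by
    rw [nhdsWithin_Ioo_eq_nhdsGT ht.1]; infer_instance
  exact ge_of_tendsto (hlim.add_const R) (eventually_mem_nhdsWithin.mono key)

end TimeLocalization

end AnisoObstacle

/-! ### Absorption of the cut-off term, and time slices -/

namespace AnisoObstacle

/-- Either the cut-off term is dominated by the nonnegative gradient term, or `v ≤ v' a` forces `ξ
|G| ≤ q K a`, and then `v ≤ 2Γ/a` bounds the cut-off term. The exponent `q ≥ p` ensures `ξ^(q-1) ≤
ξ^(p-1)`, so `ξ` can be paired with `|G|`. -/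
theorem neg_le_flux_mul_of_profile {p : ℝ} (hp : 2 ≤ p) {q : ℕ} (hq : p ≤ q)
    {ξ d K G v v' a Γ σ : ℝ} (hξ0 : 0 ≤ ξ) (hξ1 : ξ ≤ 1) (hd : |d| ≤ K) (hv : 0 ≤ v)
    (hv' : 0 ≤ v') (ha : 0 < a) (hΓ : 0 ≤ Γ) (h1 : v ≤ 2 * Γ / a) (h2 : v ≤ v' * a)
    (hσ : |σ| = 1) :
    -(2 * (q * K) ^ p * (Γ * a ^ (p - 2))) ≤
      flux p G * (q * ξ ^ (q - 1) * d * (σ * v) + ξ ^ q * (v' * G)) := by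
  have hK : 0 ≤ K := (abs_nonneg d).trans hd
  have hq2 : 2 ≤ q := by exact_mod_cast hp.trans hq
  set x := |G| with hx
  have hx0 : 0 ≤ x := abs_nonneg _
  have hR : 0 ≤ 2 * (q * K) ^ p * (Γ * a ^ (p - 2)) := by positivity
  have key : x ^ (p - 1) * (q * ξ ^ (q - 1) * |d| * v) ≤
      ξ ^ q * v' * x ^ p + 2 * (q * K) ^ p * (Γ * a ^ (p - 2)) := by
    have hA : 0 ≤ ξ ^ q * v' * x ^ p := by positivity
    rcases hξ0.eq_or_lt with h0 | h0
    · rw [← h0, zero_pow (by omega)]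
      simp only [mul_zero, zero_mul]
      rw [← h0] at hA
      linarith
    have hpow : ξ ^ q = ξ ^ (q - 1) * ξ := by rw [← pow_succ]; congr 1; omega
    rcases le_or_gt (q * |d| * v) (ξ * v' * x) with h | h
    · have hxp : x ^ p = x ^ (p - 1) * x := by
        rcases hx0.eq_or_lt with h3 | h3
        · rw [← h3, Real.zero_rpow (by linarith), mul_zero]
        · nth_rw 3 [← Real.rpow_one x]
          rw [← Real.rpow_add h3]; congr 1; ring
      calc x ^ (p - 1) * (q * ξ ^ (q - 1) * |d| * v)
          = x ^ (p - 1) * ξ ^ (q - 1) * (q * |d| * v) := by ring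
        _ ≤ x ^ (p - 1) * ξ ^ (q - 1) * (ξ * v' * x) := by gcongr
        _ = ξ ^ q * v' * x ^ p := by rw [hpow, hxp]; ring
        _ ≤ _ := by linarith
    · have h3 : ξ * v' * x < q * |d| * (v' * a) := h.trans_le (by gcongr)
      have hv'0 : 0 < v' := by
        rcases hv'.eq_or_lt with h4 | h4
        · rw [← h4] at h3; simp at h3
        · exact h4
      have h4 : ξ * x ≤ q * K * a := by
        have h5 : ξ * x < q * |d| * a := by
          refine lt_of_mul_lt_mul_right ?_ hv'
          linarith
        refine h5.le.trans ?_
        gcongr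
      have h6 : ξ ^ (q - 1) ≤ ξ ^ (p - 1) := by
        rw [← Real.rpow_natCast]
        refine Real.rpow_le_rpow_of_exponent_ge h0 hξ1 ?_
        rw [Nat.cast_sub (by omega), Nat.cast_one]
        linarith
      calc x ^ (p - 1) * (q * ξ ^ (q - 1) * |d| * v)
          ≤ x ^ (p - 1) * (q * ξ ^ (p - 1) * K * (2 * Γ / a)) := by gcongr
        _ = (ξ * x) ^ (p - 1) * (q * K * (2 * Γ / a)) := by
            rw [Real.mul_rpow h0.le hx0]; ring
        _ ≤ (q * K * a) ^ (p - 1) * (q * K * (2 * Γ / a)) := by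
            gcongr
            linarith
        _ = 2 * (q * K) ^ p * (Γ * a ^ (p - 2)) := by
            have hqK : 0 ≤ (q : ℝ) * K := by positivity
            rw [Real.mul_rpow hqK ha.le]
            have e1 : ((q : ℝ) * K) ^ p = (q * K) ^ (p - 1) * (q * K) := by
              rcases hqK.eq_or_lt with h7 | h7
              · rw [← h7, Real.zero_rpow (by linarith), mul_zero]
              · nth_rw 3 [← Real.rpow_one ((q : ℝ) * K)]
                rw [← Real.rpow_add h7]; congr 1; ring
            have e2 : a ^ (p - 2) = a ^ (p - 1) / a := by
              nth_rw 3 [← Real.rpow_one a]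
              rw [← Real.rpow_sub ha]; congr 1; ring
            rw [e1, e2]; ring
        _ ≤ _ := by linarith
  have e1 : flux p G * (q * ξ ^ (q - 1) * d * (σ * v) + ξ ^ q * (v' * G)) =
      flux p G * (q * ξ ^ (q - 1) * d * (σ * v)) + ξ ^ q * v' * x ^ p := by
    rw [hx, ← flux_mul_self hp]; ring
  have e2 : |flux p G * (q * ξ ^ (q - 1) * d * (σ * v))| =
      x ^ (p - 1) * (q * ξ ^ (q - 1) * |d| * v) := by
    rw [abs_mul, abs_flux hp, abs_mul, abs_mul, abs_mul, abs_mul, hσ, abs_of_nonneg hv,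
      abs_of_nonneg (pow_nonneg hξ0 _), Nat.abs_cast, one_mul]
  rw [e1]
  have := neg_abs_le (flux p G * (q * ξ ^ (q - 1) * d * (σ * v)))
  rw [e2] at this
  linarith

/-- A set of full measure accumulates from the right at each such `t`, including the left endpoint,
where the initial slice is needed. -/
theorem frequently_nhdsGT_of_ae_Ioo {P : ℝ → Prop} {t₁ t₂ t : ℝ}
    (h : ∀ᵐ s ∂(volume.restrict (Ioo t₁ t₂)), P s) (ht : t ∈ Ico t₁ t₂) :
    ∃ᶠ s in 𝓝[>] t, P s := by
  intro hn
  obtain ⟨b, hb, hsub⟩ := (mem_nhdsGT_iff_exists_Ioo_subset).1 hn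
  have hlt : t < min b t₂ := lt_min hb ht.2
  have h1 : volume.restrict (Ioo t₁ t₂) (Ioo t (min b t₂)) = 0 := by
    refine measure_mono_null (fun s hs => ?_) (ae_iff.1 h)
    exact hsub ⟨hs.1, hs.2.trans_le (min_le_left _ _)⟩
  rw [Measure.restrict_apply measurableSet_Ioo, inter_eq_left.2 (Ioo_subset_Ioo ht.1
    (min_le_right _ _)), Real.volume_Ioo, ENNReal.ofReal_eq_zero] at h1
  linarith

variable {N : ℕ}

theorem ae_slice_of_ae_prod {B : Set (EuclideanSpace ℝ (Fin N))} {I : Set ℝ}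
    {P : SpaceTime N → Prop} (h : ∀ᵐ z ∂((volume : Measure (SpaceTime N)).restrict (B ×ˢ I)), P z) :
    ∀ᵐ t ∂(volume.restrict I), ∀ᵐ x ∂(volume.restrict B), P (x, t) := by
  have h1 : ∀ᵐ z ∂((volume.restrict B).prod (volume.restrict I)), P z := by
    rwa [Measure.prod_restrict]
  have h2 : ∀ᵐ z ∂((volume.restrict I).prod (volume.restrict B)), P z.swap :=
    Measure.measurePreserving_swap.quasiMeasurePreserving.ae h1
  exact Measure.ae_ae_of_ae_prod h2

/-- A one-sided bound on a cylinder passes to every time slice of an `L²`-continuous function. -/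
theorem ContL2.ae_slice_le {Ω : Set (EuclideanSpace ℝ (Fin N))} {T : ℝ} {u : SpaceTime N → ℝ}
    (hu : ContL2 Ω T u) {B : Set (EuclideanSpace ℝ (Fin N))} (hB : B ⊆ Ω) {t₁ t₂ : ℝ}
    (ht₁ : 0 ≤ t₁) (ht₂ : t₂ ≤ T) {σ k H : ℝ} (hσ : |σ| = 1)
    (h : ∀ᵐ z ∂((volume : Measure (SpaceTime N)).restrict (B ×ˢ Ioo t₁ t₂)), σ * (u z - k) ≤ H)
    {t : ℝ} (ht : t ∈ Ico t₁ t₂) :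
    ∀ᵐ x ∂(volume.restrict B), σ * (u (x, t) - k) ≤ H := by
  have htT : t ∈ Icc 0 T := ⟨ht₁.trans ht.1, ht.2.le.trans ht₂⟩
  -- The excess over `H` at time `t` is at most `|u(x, s) - u(x, t)|` for any good time `s`, so its
  -- `L²` norm is arbitrarily small.
  let g : EuclideanSpace ℝ (Fin N) → ℝ := fun x => max (σ * (u (x, t) - k) - H) 0
  have hut : AEStronglyMeasurable (fun x => u (x, t)) (volume.restrict B) :=
    (hu.memLp t htT).1.mono_measure (Measure.restrict_mono hB le_rfl)
  have hg : AEStronglyMeasurable g (volume.restrict B) := by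
    have h1 : Continuous fun r : ℝ => max (σ * (r - k) - H) 0 := by fun_prop
    exact h1.comp_aestronglyMeasurable hut
  have hfreq := frequently_nhdsGT_of_ae_Ioo (ae_slice_of_ae_prod h) ht
  have hlim : Tendsto (fun s => eLpNorm (fun x => u (x, s) - u (x, t)) 2 (volume.restrict Ω))
      (𝓝[>] t) (𝓝 0) := by
    refine (hu.cont t htT).mono_left ?_
    rw [← nhdsWithin_Ioo_eq_nhdsGT (ht.2)]
    exact nhdsWithin_mono _ fun s hs => ⟨htT.1.trans hs.1.le, hs.2.le.trans ht₂⟩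
  have hle : ∀ s, (∀ᵐ x ∂(volume.restrict B), σ * (u (x, s) - k) ≤ H) →
      eLpNorm g 2 (volume.restrict B) ≤
        eLpNorm (fun x => u (x, s) - u (x, t)) 2 (volume.restrict Ω) := by
    intro s hs
    refine le_trans (eLpNorm_mono_ae ?_) (eLpNorm_mono_measure _ (Measure.restrict_mono hB le_rfl))
    filter_upwards [hs] with x hx
    simp only [g]
    rw [Real.norm_eq_abs, Real.norm_eq_abs, abs_of_nonneg (le_max_right _ _)]
    refine max_le ?_ (abs_nonneg _)
    have h1 : σ * (u (x, t) - k) - σ * (u (x, s) - k) = -σ * (u (x, s) - u (x, t)) := by ring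
    have h2 : -σ * (u (x, s) - u (x, t)) ≤ |u (x, s) - u (x, t)| := by
      refine (le_abs_self _).trans ?_
      rw [abs_mul, abs_neg, hσ, one_mul]
    linarith
  have hzero : eLpNorm g 2 (volume.restrict B) = 0 := by
    refine le_antisymm (le_of_forall_gt fun ε hε => ?_) (zero_le)
    obtain ⟨s, hs1, hs2⟩ := (hfreq.and_eventually (hlim.eventually_lt_const hε)).exists
    exact (hle s hs1).trans_lt hs2
  rw [eLpNorm_eq_zero_iff hg (by simp)] at hzero
  filter_upwards [hzero] with x hx
  have : σ * (u (x, t) - k) - H ≤ g x := le_max_left _ _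
  rw [hx, Pi.zero_apply] at this
  linarith

/-- `Ψ` is Lipschitz and `Ω` has finite measure, so `L²` continuity of `u` in time gives `L¹`
continuity of `Ψ(u)`. -/
theorem ContL2.continuousOn_integral {Ω : Set (EuclideanSpace ℝ (Fin N))}
    (hΩb : Bornology.IsBounded Ω) {T : ℝ} {u : SpaceTime N → ℝ} (hu : ContL2 Ω T u)
    {Ψ : ℝ → ℝ} {B : ℝ} (hΨc : Continuous Ψ) (hΨ : ∀ a b, |Ψ a - Ψ b| ≤ B * |a - b|)
    {ξ : EuclideanSpace ℝ (Fin N) → ℝ} (hξc : Continuous ξ) (hξ : ∀ x, |ξ x| ≤ 1) :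
    (∀ t ∈ Icc 0 T, IntegrableOn (fun x => ξ x * Ψ (u (x, t))) Ω) ∧
      ContinuousOn (fun t => ∫ x in Ω, ξ x * Ψ (u (x, t))) (Icc 0 T) := by
  have := isFiniteMeasure_restrict_of_isBounded hΩb
  have hint : ∀ t ∈ Icc 0 T, IntegrableOn (fun x => ξ x * Ψ (u (x, t))) Ω := by
    intro t ht
    have h1 : Integrable (fun x => u (x, t)) (volume.restrict Ω) :=
      (hu.memLp t ht).integrable (by simp)
    have h2 : Integrable (fun x => Ψ (u (x, t))) (volume.restrict Ω) := by
      refine ((integrable_const |Ψ 0|).add (h1.abs.const_mul B)).mono'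
        (hΨc.comp_aestronglyMeasurable h1.1) (Eventually.of_forall fun x => ?_)
      have h3 := hΨ (u (x, t)) 0
      rw [sub_zero] at h3
      have h4 := abs_sub_abs_le_abs_sub (Ψ (u (x, t))) (Ψ 0)
      simp only [Pi.add_apply, Real.norm_eq_abs]
      linarith
    exact h2.bdd_mul hξc.aestronglyMeasurable (Eventually.of_forall hξ)
  refine ⟨hint, fun t₀ ht₀ => ?_⟩
  have hB : 0 ≤ B := by
    have := (abs_nonneg _).trans (hΨ 1 0)
    simpa using this
  set V : ℝ≥0∞ := volume.restrict Ω univ ^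
    (1 / (1 : ℝ≥0∞).toReal - 1 / (2 : ℝ≥0∞).toReal) with hV
  have hVt : V ≠ ⊤ := ENNReal.rpow_ne_top_of_nonneg (by norm_num) (measure_ne_top _ _)
  have hlim := ENNReal.Tendsto.const_mul (a := ENNReal.ofReal B * V) (hu.cont t₀ ht₀)
    (Or.inr (ENNReal.mul_ne_top ENNReal.ofReal_ne_top hVt))
  rw [mul_zero] at hlim
  rw [ContinuousWithinAt, tendsto_iff_edist_tendsto_0]
  refine tendsto_of_tendsto_of_tendsto_of_le_of_le' tendsto_const_nhds hlim
    (Eventually.of_forall fun _ => zero_le) ?_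
  filter_upwards [self_mem_nhdsWithin] with t ht
  rw [edist_eq_enorm_sub, ← integral_sub (hint t ht) (hint t₀ ht₀)]
  calc ‖∫ x in Ω, (ξ x * Ψ (u (x, t)) - ξ x * Ψ (u (x, t₀)))‖ₑ
      ≤ ∫⁻ x in Ω, ‖ξ x * Ψ (u (x, t)) - ξ x * Ψ (u (x, t₀))‖ₑ :=
        enorm_integral_le_lintegral_enorm _
    _ ≤ ∫⁻ x in Ω, ENNReal.ofReal B * ‖u (x, t) - u (x, t₀)‖ₑ := by
        refine lintegral_mono fun x => ?_
        rw [← mul_sub, enorm_mul]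
        simp only [Real.enorm_eq_ofReal_abs]
        rw [← ENNReal.ofReal_mul (abs_nonneg _), ← ENNReal.ofReal_mul hB]
        refine ENNReal.ofReal_le_ofReal ?_
        calc _ ≤ 1 * (B * |u (x, t) - u (x, t₀)|) :=
              mul_le_mul (hξ x) (hΨ _ _) (abs_nonneg _) zero_le_one
          _ = _ := one_mul _
    _ = ENNReal.ofReal B * eLpNorm (fun x => u (x, t) - u (x, t₀)) 1 (volume.restrict Ω) := by
        rw [lintegral_const_mul' _ _ ENNReal.ofReal_ne_top, eLpNorm_one_eq_lintegral_enorm]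
    _ ≤ ENNReal.ofReal B * (eLpNorm (fun x => u (x, t) - u (x, t₀)) 2 (volume.restrict Ω) * V) := by
        gcongr
        exact eLpNorm_le_eLpNorm_mul_rpow_measure_univ one_le_two
          ((hu.memLp t ht).1.sub (hu.memLp t₀ ht₀).1)
    _ = _ := by ring

theorem isTestFunction_prod {B : Set (EuclideanSpace ℝ (Fin N))} {I : Set ℝ}
    {ξ : EuclideanSpace ℝ (Fin N) → ℝ} {θ : ℝ → ℝ} (hξ : ContDiff ℝ ∞ ξ)
    (hξc : HasCompactSupport ξ) (hξB : tsupport ξ ⊆ B) (hθ : ContDiff ℝ ∞ θ)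
    (hθc : HasCompactSupport θ) (hθI : tsupport θ ⊆ I) :
    IsTestFunction (B ×ˢ I) (fun z : SpaceTime N => ξ z.1 * θ z.2) := by
  have hsub : Function.support (fun z : SpaceTime N => ξ z.1 * θ z.2) ⊆
      tsupport ξ ×ˢ tsupport θ := fun z hz =>
    ⟨subset_tsupport _ (left_ne_zero_of_mul hz), subset_tsupport _ (right_ne_zero_of_mul hz)⟩
  have hK : IsCompact (tsupport ξ ×ˢ tsupport θ) := hξc.isCompact.prod hθc.isCompact
  refine ⟨(hξ.comp contDiff_fst).mul (hθ.comp contDiff_snd),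
    HasCompactSupport.of_support_subset_isCompact hK hsub, ?_⟩
  exact (closure_minimal hsub hK.isClosed).trans (prod_mono hξB hθI)

theorem fderiv_prod_apply {ξ : EuclideanSpace ℝ (Fin N) → ℝ} {θ : ℝ → ℝ}
    (hξ : Differentiable ℝ ξ) (hθ : Differentiable ℝ θ) (z d : SpaceTime N) :
    fderiv ℝ (fun z : SpaceTime N => ξ z.1 * θ z.2) z d =
      fderiv ℝ ξ z.1 d.1 * θ z.2 + ξ z.1 * (d.2 * deriv θ z.2) := by
  have h1 := (hξ z.1).hasFDerivAt.comp z (hasFDerivAt_fst (𝕜 := ℝ) (p := z))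
  have h2 := (hθ z.2).hasDerivAt.comp_hasFDerivAt z (hasFDerivAt_snd (𝕜 := ℝ) (p := z))
  have h3 := (h1.mul h2).fderiv
  simp only [Function.comp_def, Pi.mul_def] at h3
  rw [h3]
  simp
  ring

end AnisoObstacle

/-! ### The logarithmic estimate at a fixed height -/

namespace AnisoObstacle

variable {N : ℕ}

/-- The integrand on the right-hand side of the logarithmic estimate. -/
noncomputable def logWeight (H c p s : ℝ) : ℝ := logGamma H c s * (H - s + c) ^ (p - 2)

theorem measurable_logGamma (H c : ℝ) : Measurable (logGamma H c) := by
  unfold logGamma; fun_prop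

theorem measurable_logWeight (H c p : ℝ) : Measurable (logWeight H c p) := by
  have := measurable_logGamma H c
  unfold logWeight; fun_prop

theorem logWeight_nonneg {H c p s : ℝ} (hc : 0 < c) (hs : s ≤ H) : 0 ≤ logWeight H c p s :=
  mul_nonneg (logGamma_nonneg _ _ _) (Real.rpow_nonneg (by linarith) _)

/-- Where `Γ` does not vanish one has `s ≥ c`, so the base `H - s + c` is at most `H`, and its
exponent `p - 2` is nonnegative. -/
theorem logWeight_le {H c p s : ℝ} (hp : 2 ≤ p) (hc : 0 < c) (hcH : c < H) (hs : s ≤ H) :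
    logWeight H c p s ≤ |Real.log (H / c)| * H ^ (p - 2) := by
  have hH : 0 < H := hc.trans hcH
  rcases le_total s c with h | h
  · rw [logWeight, logGamma_of_le hH h, zero_mul]; positivity
  · exact mul_le_mul (logGamma_le hc hH hs)
      (Real.rpow_le_rpow (by linarith) (by linarith) (by linarith))
      (Real.rpow_nonneg (by linarith) _) (abs_nonneg _)

theorem integrableOn_logWeight {D Q : Set (SpaceTime N)} (hQD : Q ⊆ D)
    (hQf : volume Q ≠ ⊤) {u : SpaceTime N → ℝ}
    (hu : AEStronglyMeasurable u (volume.restrict D)) {σ k H c p : ℝ} (hp : 2 ≤ p) (hc : 0 < c)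
    (hcH : c < H) (hH : ∀ᵐ z ∂(volume.restrict Q), σ * (u z - k) ≤ H) :
    IntegrableOn (fun z => logWeight H c p (σ * (u z - k))) Q := by
  have hm : AEStronglyMeasurable (fun z => logWeight H c p (σ * (u z - k)))
      (volume.restrict Q) := by
    have h1 : Measurable fun r : ℝ => logWeight H c p (σ * (r - k)) :=
      (measurable_logWeight H c p).comp (by fun_prop)
    exact (h1.comp_aemeasurable
      (hu.mono_measure (Measure.restrict_mono hQD le_rfl)).aemeasurable).aestronglyMeasurable
  have : IsFiniteMeasure (volume.restrict Q) :=
    ⟨by rw [Measure.restrict_apply_univ]; exact hQf.lt_top⟩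
  refine Integrable.of_bound hm (|Real.log (H / c)| * H ^ (p - 2)) ?_
  filter_upwards [hH] with z hz
  rw [Real.norm_of_nonneg (logWeight_nonneg hc hz)]
  exact logWeight_le hp hc hcH hz

/-- The evolution of `∫ ζ^q Ψ(σ (u - k))` for an approximate logarithmic profile. -/
theorem profile_evolution {Ω : Set (EuclideanSpace ℝ (Fin N))} (hΩ : IsOpen Ω)
    (hΩb : Bornology.IsBounded Ω) {T : ℝ} {p : Fin N → ℝ} (hp : ∀ i, 2 ≤ p i) (hN : 0 < N)
    {φ u : SpaceTime N → ℝ} (hφ : ContinuousOn φ (spaceTimeDomain Ω T))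
    (hφb : BddAbove (φ '' spaceTimeDomain Ω T)) (hu : IsLocalWeakSolution Ω T p φ u)
    {x₀ : EuclideanSpace ℝ (Fin N)} {ρ₁ t₁ t₂ : ℝ} (hball : Metric.ball x₀ ρ₁ ⊆ Ω)
    (ht₁ : 0 < t₁) (ht₂ : t₂ < T)
    {ζ : EuclideanSpace ℝ (Fin N) → ℝ} (hζ : ContDiff ℝ ∞ ζ) (hζc : HasCompactSupport ζ)
    (hζs : tsupport ζ ⊆ Metric.ball x₀ ρ₁) (hζ0 : ∀ x, 0 ≤ ζ x) (hζ1 : ∀ x, ζ x ≤ 1)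
    {K : ℝ} (hK : ∀ x i, |fderiv ℝ ζ x (EuclideanSpace.single i 1)| ≤ K)
    {q : ℕ} (hq : ∀ i, p i ≤ q) {σ k k' H c : ℝ} (hσ : |σ| = 1) (hc : 0 < c) (hcH : c < H)
    (hH : ∀ᵐ z ∂(volume.restrict (cylinder x₀ ρ₁ t₁ t₂)), σ * (u z - k) ≤ H)
    (hφk : ∀ z ∈ cylinder x₀ ρ₁ t₁ t₂, φ z ≤ k') (hk' : σ = 1 → k' ≤ k)
    {F F' Ψ : ℝ → ℝ} {L B : ℝ} (hF : ∀ s, HasDerivAt F (F' s) s) (hF'c : Continuous F')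
    (hΨ : ∀ s, HasDerivAt Ψ (F s) s) (hF'0 : ∀ s, 0 ≤ F' s) (hF'L : ∀ s, F' s ≤ L)
    (hFB : ∀ s, |F s| ≤ B) (hF0 : ∀ s, 0 ≤ F s) (hFc : ∀ s ≤ c, F s = 0)
    (hFH : ∀ s ≤ H, F s ≤ 2 * logGamma H c s / (H - s + c) ∧ F s ≤ F' s * (H - s + c))
    {t : ℝ} (ht : t ∈ Ioo t₁ t₂) :
    ∫ x in Ω, ζ x ^ q * Ψ (σ * (u (x, t) - k)) ≤
      (∫ x in Ω, ζ x ^ q * Ψ (σ * (u (x, t₁) - k))) +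
        ∑ i, 2 * (q * K) ^ p i *
          ∫ z in cylinder x₀ ρ₁ t₁ t₂, logWeight H c (p i) (σ * (u z - k)) := by
  obtain ⟨Du, hDu⟩ := hu.memK.weakGrad
  set Q := cylinder x₀ ρ₁ t₁ t₂ with hQdef
  have hσ2 : σ * σ = 1 := by rw [← abs_mul_abs_self, hσ, one_mul]
  have hQo : IsOpen Q := Metric.isOpen_ball.prod isOpen_Ioo
  have hQΩ : Q ⊆ Ω ×ˢ Ioo 0 T := prod_mono hball (Ioo_subset_Ioo ht₁.le ht₂.le)
  have hUo : Ω ×ˢ Ioo 0 T ⊆ spaceTimeDomain Ω T := prod_mono_right Ioo_subset_Ioc_self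
  have hQD : Q ⊆ spaceTimeDomain Ω T := hQΩ.trans hUo
  have hDm : MeasurableSet (spaceTimeDomain Ω T) := hΩ.measurableSet.prod measurableSet_Ioc
  have hQf : volume Q ≠ ⊤ :=
    (Metric.isBounded_ball.prod (Metric.isBounded_Ioo t₁ t₂)).measure_lt_top.ne
  let i₀ : Fin N := ⟨0, hN⟩
  have hum := (hu.memK.memLp i₀).1
  have hq1 : 2 ≤ q := by exact_mod_cast (hp i₀).trans (hq i₀)
  have hlin : ∀ r, HasDerivAt (fun r : ℝ => σ * (r - k)) σ r := fun r => by
    simpa using ((hasDerivAt_id r).sub_const k).const_mul σ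
  -- The outer `σ` makes `Fh` nondecreasing for both signs, since `σ² = 1`.
  let Fh : ℝ → ℝ := fun r => σ * F (σ * (r - k))
  let Fh' : ℝ → ℝ := fun r => F' (σ * (r - k))
  let Ψh : ℝ → ℝ := fun r => Ψ (σ * (r - k))
  have hFhd : ∀ r, HasDerivAt Fh (Fh' r) r := fun r => by
    refine (((hF (σ * (r - k))).comp r (hlin r)).const_mul σ).congr_deriv ?_
    simp only [Fh']
    linear_combination F' (σ * (r - k)) * hσ2
  have hΨhd : ∀ r, HasDerivAt Ψh (Fh r) r := fun r => by
    refine ((hΨ (σ * (r - k))).comp r (hlin r)).congr_deriv ?_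
    simp only [Fh]; ring
  have hFhB : ∀ r, |Fh r| ≤ B := fun r => by
    simp only [Fh]; rw [abs_mul, hσ, one_mul]; exact hFB _
  have hFhk : ∀ r ≤ k', Fh r ≤ 0 := fun r hr => by
    simp only [Fh]
    rcases (abs_eq zero_le_one).1 hσ with h | h
    · have := hk' h
      rw [hFc _ (by rw [h]; linarith), mul_zero]
    · rw [h]; linarith [hF0 (-1 * (r - k))]
  have hΨhc : Continuous Ψh := continuous_iff_continuousAt.2 fun r => (hΨhd r).continuousAt
  have hΨhL : ∀ a b, |Ψh a - Ψh b| ≤ B * |a - b| := fun a b => by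
    have := convex_univ.norm_image_sub_le_of_norm_hasDerivWithin_le (f := Ψh) (C := B)
      (fun s _ => (hΨhd s).hasDerivWithinAt) (fun s _ => hFhB s) (mem_univ b) (mem_univ a)
    simpa using this
  have hξ1 : ∀ x, |ζ x ^ q| ≤ 1 := fun x => by
    rw [abs_of_nonneg (pow_nonneg (hζ0 x) _)]; exact pow_le_one₀ (hζ0 x) (hζ1 x)
  have hξC : ContDiff ℝ ∞ fun x => ζ x ^ q := hζ.pow q
  have hξs : tsupport (fun x => ζ x ^ q) ⊆ tsupport ζ :=
    closure_mono fun x hx => by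
      intro h0
      exact hx (by simp only [h0]; exact zero_pow (by omega))
  have hξc : HasCompactSupport fun x => ζ x ^ q :=
    hζc.of_isClosed_subset (isClosed_tsupport _) hξs
  have hξz : ∀ x ∉ Ω, ζ x ^ q = 0 := fun x hx => by
    rw [image_eq_zero_of_notMem_tsupport fun h => hx (hball (hζs h)), zero_pow (by omega)]
  obtain ⟨hyi, hyc⟩ := hu.memK.contL2.continuousOn_integral hΩb hΨhc hΨhL
    hξC.continuous hξ1
  have hji : ∀ i, IntegrableOn (fun z => logWeight H c (p i) (σ * (u z - k))) Q := fun i =>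
    integrableOn_logWeight hQD hQf hum (hp i) hc hcH hH
  refine le_add_of_forall_testFunction (t₂ := t₂)
    (y := fun t => ∫ x in Ω, ζ x ^ q * Ψ (σ * (u (x, t) - k)))
    (hyc.mono (Icc_subset_Icc ht₁.le ht₂.le)) (fun θ hθ hθc hθs hθ0 hθ1 => ?_) ht
  have hη : IsTestFunction Q fun z => ζ z.1 ^ q * θ z.2 :=
    isTestFunction_prod hξC hξc (hξs.trans hζs) hθ hθc hθs
  have hη0 : ∀ z : SpaceTime N, 0 ≤ ζ z.1 ^ q * θ z.2 := fun z =>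
    mul_nonneg (pow_nonneg (hζ0 _) _) (hθ0 _)
  have hζd : Differentiable ℝ ζ := hζ.differentiable (by simp)
  have hθd : Differentiable ℝ θ := hθ.differentiable (by simp)
  have hdT : ∀ z : SpaceTime N, fderiv ℝ (fun z : SpaceTime N => ζ z.1 ^ q * θ z.2) z (dirT N) =
      ζ z.1 ^ q * deriv θ z.2 := fun z => by
    rw [fderiv_prod_apply (hξC.differentiable (by simp)) hθd]
    simp [dirT]
  have hdX : ∀ (z : SpaceTime N) i,
      fderiv ℝ (fun z : SpaceTime N => ζ z.1 ^ q * θ z.2) z (dirX i) =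
      q * ζ z.1 ^ (q - 1) * fderiv ℝ ζ z.1 (EuclideanSpace.single i 1) * θ z.2 := fun z i => by
    rw [fderiv_prod_apply (hξC.differentiable (by simp)) hθd]
    have := ((hζd z.1).hasFDerivAt.pow q).fderiv
    rw [this]
    simp [dirX]
  have hen := energy_inequality hΩ hΩb hp hN hφ hφb hu hDu hQo hQΩ hFhd
    (show Continuous Fh' from hF'c.comp (by fun_prop)) hΨhd (fun s => hF'0 _) (fun s => hF'L _)
    hFhB hFhk hφk hη hη0
  -- Fubini turns the time term into the pairing of `θ'` with `t ↦ ∫ ζ^q Ψ`.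
  have hfub : ∫ z : SpaceTime N, fderiv ℝ (fun z : SpaceTime N => ζ z.1 ^ q * θ z.2) z (dirT N) *
      Ψh (u z) = ∫ r, deriv θ r * ∫ x in Ω, ζ x ^ q * Ψ (σ * (u (x, r) - k)) := by
    have hfin := isFiniteMeasure_restrict_spaceTimeDomain hΩb T
    have hoff : ∀ z ∉ spaceTimeDomain Ω T,
        fderiv ℝ (fun z : SpaceTime N => ζ z.1 ^ q * θ z.2) z (dirT N) = 0 := fun z hz =>
      hη.fderiv_eq_zero (fun h => hz (hQD (hη.support h))) _
    have h1 : MemLp (fun z => Ψh (u z)) 1 (volume.restrict (spaceTimeDomain Ω T)) := by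
      rw [memLp_one_iff_integrable]
      have hui : Integrable u (volume.restrict (spaceTimeDomain Ω T)) :=
        (hu.memK.memLp i₀).integrable (by
          rw [← ENNReal.ofReal_one]; exact ENNReal.ofReal_le_ofReal (by linarith [hp i₀]))
      refine ((integrable_const |Ψh 0|).add (hui.abs.const_mul B)).mono'
        (hΨhc.comp_aestronglyMeasurable hum) (Eventually.of_forall fun z => ?_)
      have h3 := hΨhL (u z) 0
      rw [sub_zero] at h3
      have h4 := abs_sub_abs_le_abs_sub (Ψh (u z)) (Ψh 0)
      simp only [Pi.add_apply, Real.norm_eq_abs]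
      linarith
    have h2 := memLp_mul_of_restrict hDm h1 (hη.continuous_fderiv_apply (dirT N))
      (hη.hasCompactSupport_fderiv_apply _) hoff
    rw [memLp_one_iff_integrable] at h2
    have h3 := integral_prod_symm _ h2
    rw [← Measure.volume_eq_prod] at h3
    rw [h3]
    refine integral_congr_ae (Eventually.of_forall fun r => ?_)
    simp only [hdT]
    rw [← integral_const_mul, setIntegral_eq_integral_of_forall_compl_eq_zero fun x hx => by
      rw [hξz x hx]; ring]
    refine integral_congr_ae (Eventually.of_forall fun x => ?_)
    simp only [Ψh]; ring
  rw [hfub] at hen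
  refine le_trans ?_ hen
  rw [← Finset.sum_neg_distrib]
  refine Finset.sum_le_sum fun i _ => ?_
  have hK0 : 0 ≤ K := (abs_nonneg _).trans (hK x₀ i)
  have hj0 : 0 ≤ ∫ z in Q, logWeight H c (p i) (σ * (u z - k)) := by
    refine integral_nonneg_of_ae ?_
    filter_upwards [hH] with z hz
    exact logWeight_nonneg hc hz
  set E : SpaceTime N → ℝ := fun z => flux (p i) (Du i z) *
    (fderiv ℝ (fun z : SpaceTime N => ζ z.1 ^ q * θ z.2) z (dirX i) * Fh (u z) +
      ζ z.1 ^ q * θ z.2 * (Fh' (u z) * Du i z)) with hE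
  -- If `E` were not integrable its integral would be `0` by convention, and the lower bound would
  -- hold trivially.
  by_cases hEi : Integrable E
  · have hEQ : ∫ z, E z = ∫ z in Q, E z :=
      (setIntegral_eq_integral_of_tsupport hη.support fun z hz => by
        have e1 := hη.eq_zero hz
        simp only [hE, hη.fderiv_eq_zero hz, e1]; ring).symm
    rw [hEQ, ← integral_const_mul, ← integral_neg]
    refine integral_mono_ae ((hji i).const_mul _).neg hEi.integrableOn ?_
    filter_upwards [hH] with z hz
    have ha : 0 < H - σ * (u z - k) + c := by linarith
    have hyoung := neg_le_flux_mul_of_profile (hp i) (hq i) (G := Du i z) (hζ0 z.1) (hζ1 z.1)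
      (hK z.1 i) (hF0 (σ * (u z - k))) (hF'0 (σ * (u z - k))) ha (logGamma_nonneg H c _)
      (hFH _ hz).1 (hFH _ hz).2 hσ
    have hw : 0 ≤ 2 * (q * K) ^ p i * logWeight H c (p i) (σ * (u z - k)) := by
      have := logWeight_nonneg (p := p i) hc hz
      positivity
    have e1 : E z = θ z.2 * (flux (p i) (Du i z) * (q * ζ z.1 ^ (q - 1) *
        fderiv ℝ ζ z.1 (EuclideanSpace.single i 1) * (σ * F (σ * (u z - k))) +
        ζ z.1 ^ q * (F' (σ * (u z - k)) * Du i z))) := by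
      simp only [hE, hdX, Fh, Fh']; ring
    rw [e1]
    have h1 := mul_le_mul_of_nonneg_left hyoung (hθ0 z.2)
    have h2 := mul_le_mul_of_nonneg_right (hθ1 z.2) hw
    simp only [logWeight] at h2 ⊢
    linarith
  · rw [integral_undef hEi]
    have : 0 ≤ 2 * (q * K) ^ p i * ∫ z in Q, logWeight H c (p i) (σ * (u z - k)) := by positivity
    linarith

/-- Replacing `Ψ` by `Γ²` costs nothing at time `t₁`, where `Ψ ≤ Γ²`, and at most `ε` times the
measure of the small ball at time `t`; then `ε` is made arbitrarily small. -/
theorem log_estimate {Ω : Set (EuclideanSpace ℝ (Fin N))} (hΩ : IsOpen Ω)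
    (hΩb : Bornology.IsBounded Ω) {T : ℝ} {p : Fin N → ℝ} (hp : ∀ i, 2 ≤ p i) (hN : 0 < N)
    {φ u : SpaceTime N → ℝ} (hφ : ContinuousOn φ (spaceTimeDomain Ω T))
    (hφb : BddAbove (φ '' spaceTimeDomain Ω T)) (hu : IsLocalWeakSolution Ω T p φ u)
    {x₀ : EuclideanSpace ℝ (Fin N)} {ρ₁ ρ₂ t₁ t₂ : ℝ} (hρ : ρ₂ < ρ₁)
    (hball : Metric.ball x₀ ρ₁ ⊆ Ω) (ht₁ : 0 < t₁) (ht₂ : t₂ < T)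
    {ζ : EuclideanSpace ℝ (Fin N) → ℝ} (hζ : ContDiff ℝ ∞ ζ) (hζc : HasCompactSupport ζ)
    (hζs : tsupport ζ ⊆ Metric.ball x₀ ρ₁) (hζ0 : ∀ x, 0 ≤ ζ x) (hζ1 : ∀ x, ζ x ≤ 1)
    (hζ2 : ∀ x ∈ Metric.ball x₀ ρ₂, ζ x = 1)
    {K : ℝ} (hK : ∀ x i, |fderiv ℝ ζ x (EuclideanSpace.single i 1)| ≤ K)
    {q : ℕ} (hq : ∀ i, p i ≤ q) {σ k k' H c : ℝ} (hσ : |σ| = 1) (hc : 0 < c) (hcH : c < H)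
    (hH : ∀ᵐ z ∂(volume.restrict (cylinder x₀ ρ₁ t₁ t₂)), σ * (u z - k) ≤ H)
    (hφk : ∀ z ∈ cylinder x₀ ρ₁ t₁ t₂, φ z ≤ k') (hk' : σ = 1 → k' ≤ k)
    {t : ℝ} (ht : t ∈ Ioo t₁ t₂) :
    ∫⁻ x in Metric.ball x₀ ρ₂, ENNReal.ofReal (logGamma H c (σ * (u (x, t) - k)) ^ 2) ≤
      (∫⁻ x in Metric.ball x₀ ρ₁, ENNReal.ofReal (logGamma H c (σ * (u (x, t₁) - k)) ^ 2)) +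
        ∑ i, ENNReal.ofReal (2 * (q * K) ^ p i) *
          ∫⁻ z in cylinder x₀ ρ₁ t₁ t₂,
            ENNReal.ofReal (logWeight H c (p i) (σ * (u z - k))) := by
  have hq1 : 1 ≤ q := by
    have : (1 : ℝ) ≤ q := by linarith [hp ⟨0, hN⟩, hq ⟨0, hN⟩]
    exact_mod_cast this
  have hK0 : 0 ≤ K := (abs_nonneg _).trans (hK x₀ ⟨0, hN⟩)
  have hslice : ∀ s ∈ Ico t₁ t₂,
      ∀ᵐ x ∂(volume.restrict (Metric.ball x₀ ρ₁)), σ * (u (x, s) - k) ≤ H := fun s hs =>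
    hu.memK.contL2.ae_slice_le hball ht₁.le ht₂.le hσ hH hs
  set Q := cylinder x₀ ρ₁ t₁ t₂ with hQdef
  have hQo : IsOpen Q := Metric.isOpen_ball.prod isOpen_Ioo
  have hQD : Q ⊆ spaceTimeDomain Ω T :=
    prod_mono hball ((Ioo_subset_Ioo ht₁.le ht₂.le).trans Ioo_subset_Ioc_self)
  have hQf : volume Q ≠ ⊤ :=
    (Metric.isBounded_ball.prod (Metric.isBounded_Ioo t₁ t₂)).measure_lt_top.ne
  have hum := (hu.memK.memLp ⟨0, hN⟩).1
  refine ENNReal.le_of_forall_pos_le_add fun δ hδ _ => ?_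
  set V := volume (Metric.ball x₀ ρ₂) with hV
  have hVt : V ≠ ⊤ := Metric.isBounded_ball.measure_lt_top.ne
  have hδ' : (0 : ℝ) < δ := hδ
  have hV0 : 0 ≤ V.toReal := ENNReal.toReal_nonneg
  let ε : ℝ := δ / (V.toReal + 1)
  have hε : 0 < ε := by positivity
  have hεV : ENNReal.ofReal ε * V ≤ δ := by
    rw [← ENNReal.ofReal_toReal hVt, ← ENNReal.ofReal_mul hε.le, ← ENNReal.ofReal_coe_nnreal]
    refine ENNReal.ofReal_le_ofReal ?_
    simp only [ε]
    rw [div_mul_eq_mul_div, div_le_iff₀ (by positivity)]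
    nlinarith
  obtain ⟨F, F', Ψ, L, B, hF, hF'c, hΨ, hF'0, hF'L, hFB, hF0, hFc, hΨ0, hFH⟩ :=
    exists_log_profile hc hcH hε
  have hevol := profile_evolution hΩ hΩb hp hN hφ hφb hu hball ht₁ ht₂ hζ hζc hζs hζ0 hζ1 hK hq
    hσ hc hcH hH hφk hk' hF hF'c hΨ hF'0 hF'L hFB hF0 hFc
    (fun s hs => ⟨(hFH s hs).1, (hFH s hs).2.1⟩) ht
  have hΨc : Continuous fun r => Ψ (σ * (r - k)) := by
    have : Continuous Ψ := continuous_iff_continuousAt.2 fun r => (hΨ r).continuousAt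
    fun_prop
  have hΨL : ∀ a b, |Ψ (σ * (a - k)) - Ψ (σ * (b - k))| ≤ B * |a - b| := fun a b => by
    have := convex_univ.norm_image_sub_le_of_norm_hasDerivWithin_le (f := Ψ) (C := B)
      (fun s _ => (hΨ s).hasDerivWithinAt) (fun s _ => hFB s) (mem_univ (σ * (b - k)))
      (mem_univ (σ * (a - k)))
    rw [Real.norm_eq_abs, Real.norm_eq_abs] at this
    refine this.trans (le_of_eq ?_)
    rw [show σ * (a - k) - σ * (b - k) = σ * (a - b) by ring, abs_mul, hσ, one_mul]
  obtain ⟨hyi, -⟩ := hu.memK.contL2.continuousOn_integral hΩb hΨc hΨL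
    (hζ.continuous.pow q) (fun x => by
      simp only [Pi.pow_apply]
      rw [abs_of_nonneg (pow_nonneg (hζ0 x) _)]; exact pow_le_one₀ (hζ0 x) (hζ1 x))
  simp only [Pi.pow_apply] at hyi
  have hnn : ∀ s x, 0 ≤ ζ x ^ q * Ψ (σ * (u (x, s) - k)) := fun s x =>
    mul_nonneg (pow_nonneg (hζ0 x) _) (hΨ0 _)
  have hy : ∀ s ∈ Icc 0 T, ENNReal.ofReal (∫ x in Ω, ζ x ^ q * Ψ (σ * (u (x, s) - k))) =
      ∫⁻ x in Ω, ENNReal.ofReal (ζ x ^ q * Ψ (σ * (u (x, s) - k))) := fun s hs =>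
    ofReal_integral_eq_lintegral_ofReal (hyi s hs) (Eventually.of_forall (hnn s))
  have htT : t ∈ Icc 0 T := ⟨ht₁.le.trans ht.1.le, ht.2.le.trans ht₂.le⟩
  have ht₁T : t₁ ∈ Icc 0 T := ⟨ht₁.le, (ht.1.trans ht.2).le.trans ht₂.le⟩
  have hlow : ∫⁻ x in Metric.ball x₀ ρ₂, ENNReal.ofReal (logGamma H c (σ * (u (x, t) - k)) ^ 2) ≤
      ENNReal.ofReal (∫ x in Ω, ζ x ^ q * Ψ (σ * (u (x, t) - k))) + δ := by
    have hsub : Metric.ball x₀ ρ₂ ⊆ Metric.ball x₀ ρ₁ := Metric.ball_subset_ball hρ.le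
    calc ∫⁻ x in Metric.ball x₀ ρ₂, ENNReal.ofReal (logGamma H c (σ * (u (x, t) - k)) ^ 2)
        ≤ ∫⁻ x in Metric.ball x₀ ρ₂, (ENNReal.ofReal (ζ x ^ q * Ψ (σ * (u (x, t) - k))) +
            ENNReal.ofReal ε) := by
          refine lintegral_mono_ae ?_
          filter_upwards [ae_mono (Measure.restrict_mono hsub le_rfl) (hslice t ⟨ht.1.le, ht.2⟩),
            ae_restrict_mem Metric.isOpen_ball.measurableSet] with x hx hxB
          rw [← ENNReal.ofReal_add (hnn t x) hε.le, hζ2 x hxB, one_pow, one_mul]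
          exact ENNReal.ofReal_le_ofReal (hFH _ hx).2.2.2
      _ = (∫⁻ x in Metric.ball x₀ ρ₂, ENNReal.ofReal (ζ x ^ q * Ψ (σ * (u (x, t) - k)))) +
            ENNReal.ofReal ε * V := by
          rw [lintegral_add_right _ measurable_const, lintegral_const,
            Measure.restrict_apply_univ]
      _ ≤ _ := by
          rw [hy t htT]
          gcongr
          exact hsub.trans hball
  have hup : ENNReal.ofReal (∫ x in Ω, ζ x ^ q * Ψ (σ * (u (x, t₁) - k))) ≤
      ∫⁻ x in Metric.ball x₀ ρ₁,
        ENNReal.ofReal (logGamma H c (σ * (u (x, t₁) - k)) ^ 2) := by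
    have h1 : ∫ x in Ω, ζ x ^ q * Ψ (σ * (u (x, t₁) - k)) =
        ∫ x in Metric.ball x₀ ρ₁, ζ x ^ q * Ψ (σ * (u (x, t₁) - k)) := by
      refine setIntegral_eq_of_subset_of_forall_sdiff_eq_zero hΩ.measurableSet hball fun x hx => ?_
      rw [image_eq_zero_of_notMem_tsupport fun h => hx.2 (hζs h), zero_pow (by omega), zero_mul]
    rw [h1, ofReal_integral_eq_lintegral_ofReal ((hyi t₁ ht₁T).mono_set hball)
      (Eventually.of_forall (hnn t₁))]
    refine lintegral_mono_ae ?_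
    filter_upwards [hslice t₁ ⟨le_rfl, ht.1.trans ht.2⟩] with x hx
    refine ENNReal.ofReal_le_ofReal ?_
    exact (mul_le_of_le_one_left (hΨ0 _) (pow_le_one₀ (hζ0 x) (hζ1 x))).trans (hFH _ hx).2.2.1
  have hR : ENNReal.ofReal (∑ i, 2 * (q * K) ^ p i *
      ∫ z in Q, logWeight H c (p i) (σ * (u z - k))) =
      ∑ i, ENNReal.ofReal (2 * (q * K) ^ p i) *
        ∫⁻ z in Q, ENNReal.ofReal (logWeight H c (p i) (σ * (u z - k))) := by
    have hj0 : ∀ i, 0 ≤ᵐ[volume.restrict Q] fun z => logWeight H c (p i) (σ * (u z - k)) :=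
      fun i => by
        filter_upwards [hH] with z hz
        exact logWeight_nonneg hc hz
    rw [ENNReal.ofReal_sum_of_nonneg fun i _ => mul_nonneg (by positivity)
      (integral_nonneg_of_ae (hj0 i))]
    refine Finset.sum_congr rfl fun i _ => ?_
    rw [ENNReal.ofReal_mul (by positivity), ofReal_integral_eq_lintegral_ofReal
      (integrableOn_logWeight hQD hQf hum (hp i) hc hcH hH) (hj0 i)]
  refine hlow.trans ?_
  gcongr
  refine (ENNReal.ofReal_le_ofReal hevol).trans (ENNReal.ofReal_add_le.trans ?_)
  rw [hR]
  gcongr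

end AnisoObstacle

/-! ### The estimate in terms of the essential height -/

namespace AnisoObstacle

variable {N : ℕ}

/-- `Γ` already vanishes up to `c > 0`, so the truncation can be dropped and both cases become
functions of `σ (u - k)`. -/
theorem logGamma_max_zero {H c : ℝ} (hH : 0 < H) (hc : 0 < c) (s : ℝ) :
    logGamma H c (max s 0) = logGamma H c s := by
  rcases le_total s 0 with h | h
  · rw [max_eq_right h, logGamma_of_le hH hc.le, logGamma_of_le hH (h.trans hc.le)]
  · rw [max_eq_left h]

/-- Above `c` the derivative is `1 / (H - s + c)`. At and below `c` the factor `Γ` is zero, so the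
value of `deriv` at the kink is irrelevant. -/
theorem logGamma_mul_deriv_rpow {H c p s : ℝ} (hc : 0 < c) (hcH : c < H) (hs : s ≤ H) :
    logGamma H c (max s 0) * deriv (logGamma H c) (max s 0) ^ (2 - p) = logWeight H c p s := by
  have hH : 0 < H := hc.trans hcH
  rw [logGamma_max_zero hH hc]
  rcases le_or_gt s c with h | h
  · rw [logWeight, logGamma_of_le hH h, zero_mul, zero_mul]
  · have ha : 0 < H - s + c := by linarith
    rw [logWeight, max_eq_left (hc.trans h).le, deriv_logGamma hc h hs, one_div,
      Real.inv_rpow ha.le, ← Real.rpow_neg ha.le, neg_sub]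

theorem ae_le_toReal_height {Q : Set (SpaceTime N)} {w : SpaceTime N → ℝ}
    (h : height Q w ≠ ⊤) : ∀ᵐ z ∂(volume.restrict Q), w z ≤ (height Q w).toReal := by
  have h1 : ∀ᵐ z ∂(volume.restrict Q), ENNReal.ofReal |w z| ≤ height Q w :=
    ENNReal.ae_le_essSup fun z => ENNReal.ofReal |w z|
  filter_upwards [h1] with z hz
  exact (le_abs_self _).trans ((ENNReal.ofReal_le_iff_le_toReal h).1 hz)

theorem log_estimate_height {p : Fin N → ℝ} (hp : ∀ i, 2 ≤ p i) (hN : 0 < N) {K C : ℝ}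
    (hK : 0 < K) {q : ℕ} (hq : ∀ i, p i ≤ q) (hC : ∀ i, 2 * (q * K) ^ p i ≤ C)
    {Ω : Set (EuclideanSpace ℝ (Fin N))} (hΩ : IsOpen Ω) (hΩb : Bornology.IsBounded Ω) {T : ℝ}
    {φ u : SpaceTime N → ℝ} (hφ : ContinuousOn φ (spaceTimeDomain Ω T))
    (hφb : BddAbove (φ '' spaceTimeDomain Ω T)) (hu : IsLocalWeakSolution Ω T p φ u)
    {x₀ : EuclideanSpace ℝ (Fin N)} {ρ₁ ρ₂ t₁ t₂ : ℝ} (hρ : ρ₂ < ρ₁)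
    (hball : Metric.ball x₀ ρ₁ ⊆ Ω) (ht₁ : 0 < t₁) (ht₂ : t₂ < T)
    {ζ : EuclideanSpace ℝ (Fin N) → ℝ} (hζ : ContDiff ℝ ∞ ζ) (hζc : HasCompactSupport ζ)
    (hζs : tsupport ζ ⊆ Metric.ball x₀ ρ₁) (hζ0 : ∀ x, 0 ≤ ζ x) (hζ1 : ∀ x, ζ x ≤ 1)
    (hζ2 : ∀ x ∈ Metric.ball x₀ ρ₂, ζ x = 1)
    (hζK : ∀ x i, |fderiv ℝ ζ x (EuclideanSpace.single i 1)| ≤ K / (ρ₁ - ρ₂))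
    {σ k k' : ℝ} (hσ : |σ| = 1) {Q : Set (SpaceTime N)} (hQ : Q = cylinder x₀ ρ₁ t₁ t₂)
    (hφk : ∀ z ∈ Q, φ z ≤ k') (hk' : σ = 1 → k' ≤ k) {w : SpaceTime N → ℝ}
    (hw : ∀ z, w z = max (σ * (u z - k)) 0) (hfin : height Q w ≠ ⊤)
    {c : ℝ} (hc : 0 < c) (hcH : c < (height Q w).toReal) :
    essSup (fun t => ∫⁻ x in Metric.ball x₀ ρ₂, ENNReal.ofReal (Gam Q w c (x, t) ^ 2))
        (volume.restrict (Ioo t₁ t₂)) ≤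
      (∫⁻ x in Metric.ball x₀ ρ₁, ENNReal.ofReal (Gam Q w c (x, t₁) ^ 2)) +
        ENNReal.ofReal C * ∑ i, ENNReal.ofReal (1 / (ρ₁ - ρ₂) ^ p i) *
          ∫⁻ z in Q, ENNReal.ofReal (Gam Q w c z * Gam' Q w c z ^ (2 - p i)) := by
  set H := (height Q w).toReal with hHdef
  have hH0 : 0 < H := hc.trans hcH
  have hρ' : 0 < ρ₁ - ρ₂ := sub_pos.2 hρ
  have hae : ∀ᵐ z ∂(volume.restrict Q), σ * (u z - k) ≤ H := by
    filter_upwards [ae_le_toReal_height hfin] with z hz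
    exact (le_max_left _ _).trans ((hw z).symm.le.trans hz)
  have hGam : ∀ z, Gam Q w c z = logGamma H c (σ * (u z - k)) := fun z => by
    rw [Gam, hw, logGamma_max_zero hH0 hc]
  have hrhs : ∀ i, ∫⁻ z in Q, ENNReal.ofReal (Gam Q w c z * Gam' Q w c z ^ (2 - p i)) =
      ∫⁻ z in Q, ENNReal.ofReal (logWeight H c (p i) (σ * (u z - k))) := fun i => by
    refine lintegral_congr_ae ?_
    filter_upwards [hae] with z hz
    rw [Gam, Gam', hw, logGamma_mul_deriv_rpow hc hcH hz]
  simp only [hrhs]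
  simp only [hGam]
  subst hQ
  refine essSup_le_of_ae_le _ ?_
  filter_upwards [ae_restrict_mem measurableSet_Ioo] with t ht
  refine (log_estimate hΩ hΩb hp hN hφ hφb hu hρ hball ht₁ ht₂ hζ hζc hζs hζ0 hζ1 hζ2 hζK hq hσ hc
    hcH hae hφk hk' ht).trans ?_
  gcongr
  rw [Finset.mul_sum]
  refine Finset.sum_le_sum fun i _ => ?_
  rw [← mul_assoc]
  gcongr
  have hC0 : 0 ≤ C := le_trans (by positivity) (hC i)
  rw [← ENNReal.ofReal_mul hC0]
  refine ENNReal.ofReal_le_ofReal ?_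
  rw [← mul_div_assoc, Real.div_rpow (by positivity) hρ'.le, mul_one_div, mul_div_assoc']
  gcongr
  exact hC i

end AnisoObstacle

theorem lemma3p2 (N : ℕ) (hN : 2 ≤ N) (p : Fin N → ℝ) (hp : ∀ i, 2 ≤ p i) :
    ∃ C : ℝ, 0 < C ∧
      ∀ (Ω : Set (EuclideanSpace ℝ (Fin N))), IsOpen Ω → IsConnected Ω → Bornology.IsBounded Ω →
      ∀ (T : ℝ), 0 < T →
      ∀ (φ : AnisoObstacle.SpaceTime N → ℝ),
        ContinuousOn φ (AnisoObstacle.spaceTimeDomain Ω T) →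
        BddAbove (φ '' AnisoObstacle.spaceTimeDomain Ω T) →
      ∀ (u : AnisoObstacle.SpaceTime N → ℝ), AnisoObstacle.IsLocalWeakSolution Ω T p φ u →
      ∀ (x₀ : EuclideanSpace ℝ (Fin N)) (ρ₁ ρ₂ t₁ t₂ : ℝ),
        0 < ρ₂ → ρ₂ < ρ₁ → Metric.ball x₀ ρ₁ ⊆ Ω → 0 < t₁ → t₁ < t₂ → t₂ < T →
      ∀ (Q₁ : Set (AnisoObstacle.SpaceTime N)), Q₁ = AnisoObstacle.cylinder x₀ ρ₁ t₁ t₂ →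
        (∀ k : ℝ, (∀ z ∈ Q₁, φ z ≤ k) →
          ∀ w, w = AnisoObstacle.truncPos u k →
          AnisoObstacle.height Q₁ w ≠ ⊤ →
          ∀ c : ℝ, 0 < c → c < (AnisoObstacle.height Q₁ w).toReal →
            essSup (fun t => ∫⁻ x in Metric.ball x₀ ρ₂,
                ENNReal.ofReal (AnisoObstacle.Gam Q₁ w c (x, t) ^ 2))
              (volume.restrict (Ioo t₁ t₂)) ≤
            (∫⁻ x in Metric.ball x₀ ρ₁, ENNReal.ofReal (AnisoObstacle.Gam Q₁ w c (x, t₁) ^ 2)) +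
              ENNReal.ofReal C * ∑ i, ENNReal.ofReal (1 / (ρ₁ - ρ₂) ^ p i) *
                ∫⁻ z in Q₁, ENNReal.ofReal
                  (AnisoObstacle.Gam Q₁ w c z * AnisoObstacle.Gam' Q₁ w c z ^ (2 - p i)))
        ∧
        (∀ k : ℝ, 0 < k →
          ∀ w, w = AnisoObstacle.truncNeg u k →
          AnisoObstacle.height Q₁ w ≠ ⊤ →
          ∀ c : ℝ, 0 < c → c < (AnisoObstacle.height Q₁ w).toReal →
            essSup (fun t => ∫⁻ x in Metric.ball x₀ ρ₂,
                ENNReal.ofReal (AnisoObstacle.Gam Q₁ w c (x, t) ^ 2))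
              (volume.restrict (Ioo t₁ t₂)) ≤
            (∫⁻ x in Metric.ball x₀ ρ₁, ENNReal.ofReal (AnisoObstacle.Gam Q₁ w c (x, t₁) ^ 2)) +
              ENNReal.ofReal C * ∑ i, ENNReal.ofReal (1 / (ρ₁ - ρ₂) ^ p i) *
                ∫⁻ z in Q₁, ENNReal.ofReal
                  (AnisoObstacle.Gam Q₁ w c z * AnisoObstacle.Gam' Q₁ w c z ^ (2 - p i))) := by
  obtain ⟨K, hK, hcut⟩ := AnisoObstacle.exists_ball_cutoff
  have hN0 : 0 < N := by omega
  -- One exponent serves all directions, since each `p i` is at most the sum.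
  obtain ⟨q, hq⟩ := exists_nat_ge (∑ i, p i)
  have hp0 : ∀ i, 0 ≤ p i := fun i => by linarith [hp i]
  have hpq : ∀ i, p i ≤ q := fun i =>
    (Finset.single_le_sum (fun j _ => hp0 j) (Finset.mem_univ i)).trans hq
  have hqK : ∀ i, 0 ≤ 2 * ((q : ℝ) * K) ^ p i := fun i => by positivity
  -- `K` comes from the smooth transition alone and `q` from the `p i`, so the constant depends on
  -- no other data.
  refine ⟨1 + ∑ i, 2 * ((q : ℝ) * K) ^ p i,
    add_pos_of_pos_of_nonneg one_pos (Finset.sum_nonneg fun i _ => hqK i), ?_⟩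
  have hC : ∀ i, 2 * ((q : ℝ) * K) ^ p i ≤ 1 + ∑ i, 2 * ((q : ℝ) * K) ^ p i := fun i =>
    (Finset.single_le_sum (fun j _ => hqK j) (Finset.mem_univ i)).trans (by linarith)
  intro Ω hΩ _ hΩb T _ φ hφ hφb u hu x₀ ρ₁ ρ₂ t₁ t₂ hρ₂ hρ hball ht₁ _ ht₂ Q hQ
  obtain ⟨ζ, hζ, hζc, hζs, hζ0, hζ1, hζ2, hζK⟩ := hcut x₀ ρ₁ ρ₂ hρ₂ hρ
  have hζK' : ∀ x i, |fderiv ℝ ζ x (EuclideanSpace.single i 1)| ≤ K / (ρ₁ - ρ₂) := fun x i =>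
    hζK x _ (by simp)
  refine ⟨fun k hk w hw hfin c hc hcH => ?_, fun k _ w hw hfin c hc hcH => ?_⟩
  · exact AnisoObstacle.log_estimate_height hp hN0 hK hpq hC hΩ hΩb hφ hφb hu hρ hball ht₁ ht₂
      hζ hζc hζs hζ0 hζ1 hζ2 hζK' (σ := 1) (k := k) abs_one hQ hk (fun _ => le_rfl)
      (fun z => by rw [hw, AnisoObstacle.truncPos, one_mul]) hfin hc hcH
  · obtain ⟨M, hM⟩ := hφb
    have hQD : Q ⊆ AnisoObstacle.spaceTimeDomain Ω T := by
      rw [hQ]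
      exact prod_mono hball ((Ioo_subset_Ioo ht₁.le ht₂.le).trans Ioo_subset_Ioc_self)
    -- For `σ = -1` any upper bound `M` of the obstacle will do as `k'`; the condition linking `k'`
    -- to `k` is vacuous.
    exact AnisoObstacle.log_estimate_height hp hN0 hK hpq hC hΩ hΩb hφ ⟨M, hM⟩ hu hρ hball ht₁ ht₂
      hζ hζc hζs hζ0 hζ1 hζ2 hζK' (σ := -1) (k := k) (k' := M) (by simp) hQ
      (fun z hz => hM (mem_image_of_mem φ (hQD hz))) (fun h => by norm_num at h)
      (fun z => by rw [hw, AnisoObstacle.truncNeg, neg_one_mul, neg_sub]) hfin hc hcH
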